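/- Let $\upsilon>0$, $\sigma>0$, $U(q)=\tfrac14q^4$ and $H(p,q)=\tfrac12p^2+\tfrac14q^4+\tfrac{\upsilon}{2}pq$. Let $\tau\in(0,1)$, $t_n=n\tau$, $T_n=[t_n,t_{n+1})$ for $n\in\mathbb N=\{0,1,2,\dots\}$, and let $W$ be a standard one-dimensional Wiener process on a filtered probability space $(\Omega,\mathcal F,\{\mathcal F_t\}_{t\ge0},\mathbb P)$. For a deterministic initial value $(P_0,Q_0)\in\mathbb R^2$ the splitting system is defined recursively by $(P_\tau(0),Q_\tau(0))=(P_0,Q_0)$ and, for each $n\in\mathbb N$: let $(\bar P_{T_n},\bar Q_{T_n})$ solve on $[t_n,t_{n+1}]$ the Hamiltonian system $$d\bar P_{T_n}(t)=-\tfrac{\upsilon}{2}\bar P_{T_n}(t)\,dt-\bar Q_{T_n}(t)^3\,dt,\qquad d\bar Q_{T_n}(t)=\bar P_{T_n}(t)\,dt+\tfrac{\upsilon}{2}\bar Q_{T_n}(t)\,dt,$$ with value $(P_\tau(t_n),Q_\tau(t_n))$ at $t=t_n$; let $(\tilde P_{T_n},\tilde Q_{T_n})$ solve on $[t_n,t_{n+1}]$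 the linear stochastic differential equation $$d\tilde P_{T_n}(t)=-\tfrac{\upsilon}{2}\tilde P_{T_n}(t)\,dt+\sigma\,dW_t,\qquad d\tilde Q_{T_n}(t)=-\tfrac{\upsilon}{2}\tilde Q_{T_n}(t)\,dt,$$ with value $(\bar P_{T_n}(t_{n+1}),\bar Q_{T_n}(t_{n+1}))$ at $t=t_n$; and put $(P_\tau(t_{n+1}),Q_\tau(t_{n+1}))=(\tilde P_{T_n}(t_{n+1}),\tilde Q_{T_n}(t_{n+1}))$. **Proposition 2.4.** (i) For every real $p\ge1$ there is a constant $C=C(p)>0$, depending only on $p$, $\upsilon$ and $\sigma$ (not on $\tau$ or $(P_0,Q_0)$), such that $$\sup_{n\in\mathbb N}\sup_{t\in T_n}\mathbb E\big[|\bar P_{T_n}(t)|^{2p}+|\bar Q_{T_n}(t)|^{4p}+|\tilde P_{T_n}(t)|^{2p}+|\tilde Q_{T_n}(t)|^{4p}\big]\le C\big(1+|H(P_0,Q_0)|^p\big).$$ In addition, for every $\tau\in(0,1)$ the solution $X_\tau(t_n)=(P_\tau(t_n),Q_\tau(t_n))$, $n\in\mathbb N$, of the splitting system is uniquely ergodic: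 it is a time-homogeneous Markov chain with respect to $(\mathcal F_{t_n})_{n\in\mathbb N}$ which has exactly one invariant probability measure $\pi$ on $\mathbb R^2$, and $\pi$ is ergodic, that is, for every $g\in L^2(\mathbb R^2;\pi)$, $$\lim_{N\to\infty}\frac1N\sum_{n=0}^{N-1}\mathbb E_{(p,q)}\big[g(X_\tau(t_n))\big]=\int_{\mathbb R^2}g\,d\pi\quad\text{in }L^2(\mathbb R^2;\pi),$$ where $\mathbb E_{(p,q)}$ is the expectation for the initial value $(P_0,Q_0)=(p,q)$. (ii) There is a constant $C>0$, depending only on $\upsilon$ and $\sigma$, such that for all $\tau\in(0,1)$, all $(P_0,Q_0)\in\mathbb R^2$ and all $n\in\mathbb N$, $$\mathbb E\Big[\exp\Big\{\frac{H(P_\tau(t_n),Q_\tau(t_n))}{e^{\sigma^2t_n}}\Big\}\Big]\le\exp\big(H(P_0,Q_0)+Ct_n\big).$$ -/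

import Mathlib

open MeasureTheory ProbabilityTheory Filter Topology Set
open scoped NNReal ENNReal

universe u

noncomputable section

/-- The modified Hamiltonian `H(p, q) = p² / 2 + q⁴ / 4 + (υ / 2) p q`
for the potential `U(q) = q⁴ / 4`. -/
def langevinH (υ p q : ℝ) : ℝ := p ^ 2 / 2 + q ^ 4 / 4 + υ / 2 * p * q

/-- The grid point `t_n = n τ`. -/
def gridTime (τ : ℝ) (n : ℕ) : ℝ := (n : ℝ) * τ

/-- `W` is a standard one-dimensional Wiener process with respect to the filtration `𝓕`. -/
structure IsWienerProcess {Ω : Type u} {mΩ : MeasurableSpace Ω} (μ : Measure Ω)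
    (𝓕 : Filtration ℝ≥0 mΩ) (W : ℝ≥0 → Ω → ℝ) : Prop where
  brownian : IsBrownianReal W μ
  adapted : Adapted 𝓕 W
  indep_increments : ∀ s t : ℝ≥0, s ≤ t →
    Indep (MeasurableSpace.comap (fun ω => W t ω - W s ω) inferInstance) (𝓕 s) μ

/-- The processes that make up a solution of the splitting system. On the `n`-th time interval
`T_n = [t_n, t_{n+1})`, `barP n, barQ n` is the Hamiltonian part and `tildeP n, tildeQ n` the
stochastic part; `P n, Q n` are the values `P_τ(t_n), Q_τ(t_n)` at the grid points. -/
structure SplittingProcess (Ω : Type u) where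
  P : ℕ → Ω → ℝ
  Q : ℕ → Ω → ℝ
  barP : ℕ → ℝ → Ω → ℝ
  barQ : ℕ → ℝ → Ω → ℝ
  tildeP : ℕ → ℝ → Ω → ℝ
  tildeQ : ℕ → ℝ → Ω → ℝ

/-- The grid values `X_τ(t_n) = (P_τ(t_n), Q_τ(t_n))`. -/
def SplittingProcess.grid {Ω : Type u} (X : SplittingProcess Ω) (n : ℕ) (ω : Ω) : ℝ × ℝ :=
  (X.P n ω, X.Q n ω)

/-- The splitting system along one path `w` of the driving noise, with initial value `(P₀, Q₀)`.
On each `[t_n, t_{n+1}]` one first solves exactly the Hamiltonian system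
`dP̄ = (-(υ/2) P̄ - Q̄³) dt, dQ̄ = (P̄ + (υ/2) Q̄) dt` from `(P_τ(t_n), Q_τ(t_n))`, and then the
linear stochastic equation `dP̃ = -(υ/2) P̃ dt + σ dW, dQ̃ = -(υ/2) Q̃ dt` from
`(P̄(t_{n+1}), Q̄(t_{n+1}))`. The noise being additive, the equation for `P̃` is an integral
equation for continuous paths. -/
structure IsSplittingPath (υ σ τ : ℝ) (w : ℝ≥0 → ℝ) (P₀ Q₀ : ℝ) (P Q : ℕ → ℝ)
    (barP barQ tildeP tildeQ : ℕ → ℝ → ℝ) : Prop where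
  initP : P 0 = P₀
  initQ : Q 0 = Q₀
  barP_start : ∀ n, barP n (gridTime τ n) = P n
  barQ_start : ∀ n, barQ n (gridTime τ n) = Q n
  barP_ode : ∀ n, ∀ t ∈ Icc (gridTime τ n) (gridTime τ (n + 1)),
    HasDerivWithinAt (barP n) (-(υ / 2) * barP n t - barQ n t ^ 3)
      (Icc (gridTime τ n) (gridTime τ (n + 1))) t
  barQ_ode : ∀ n, ∀ t ∈ Icc (gridTime τ n) (gridTime τ (n + 1)),
    HasDerivWithinAt (barQ n) (barP n t + υ / 2 * barQ n t)
      (Icc (gridTime τ n) (gridTime τ (n + 1))) t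
  tildeP_cont : ∀ n, ContinuousOn (tildeP n) (Icc (gridTime τ n) (gridTime τ (n + 1)))
  tildeP_sde : ∀ n, ∀ t ∈ Icc (gridTime τ n) (gridTime τ (n + 1)),
    tildeP n t = barP n (gridTime τ (n + 1)) - (∫ s in (gridTime τ n)..t, υ / 2 * tildeP n s)
      + σ * (w t.toNNReal - w (gridTime τ n).toNNReal)
  tildeQ_start : ∀ n, tildeQ n (gridTime τ n) = barQ n (gridTime τ (n + 1))
  tildeQ_ode : ∀ n, ∀ t ∈ Icc (gridTime τ n) (gridTime τ (n + 1)),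
    HasDerivWithinAt (tildeQ n) (-(υ / 2) * tildeQ n t)
      (Icc (gridTime τ n) (gridTime τ (n + 1))) t
  stepP : ∀ n, P (n + 1) = tildeP n (gridTime τ (n + 1))
  stepQ : ∀ n, Q (n + 1) = tildeQ n (gridTime τ (n + 1))

/-- `X` solves the splitting system driven by `W` with step size `τ` and deterministic initial
value `(P₀, Q₀)`: the processes are adapted (the Hamiltonian part on `T_n` is determined at time
`t_n`) and almost every path satisfies the equations. -/
structure IsSplittingSolution {Ω : Type u} {mΩ : MeasurableSpace Ω} (υ σ τ : ℝ) (μ : Measure Ω)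
    (𝓕 : Filtration ℝ≥0 mΩ) (W : ℝ≥0 → Ω → ℝ) (P₀ Q₀ : ℝ) (X : SplittingProcess Ω) : Prop where
  adapted_P : ∀ n, Measurable[𝓕 (gridTime τ n).toNNReal] (X.P n)
  adapted_Q : ∀ n, Measurable[𝓕 (gridTime τ n).toNNReal] (X.Q n)
  adapted_barP : ∀ n, ∀ t ∈ Icc (gridTime τ n) (gridTime τ (n + 1)),
    Measurable[𝓕 (gridTime τ n).toNNReal] (X.barP n t)
  adapted_barQ : ∀ n, ∀ t ∈ Icc (gridTime τ n) (gridTime τ (n + 1)),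
    Measurable[𝓕 (gridTime τ n).toNNReal] (X.barQ n t)
  adapted_tildeP : ∀ n, ∀ t ∈ Icc (gridTime τ n) (gridTime τ (n + 1)),
    Measurable[𝓕 t.toNNReal] (X.tildeP n t)
  adapted_tildeQ : ∀ n, ∀ t ∈ Icc (gridTime τ n) (gridTime τ (n + 1)),
    Measurable[𝓕 t.toNNReal] (X.tildeQ n t)
  path : ∀ᵐ ω ∂μ, IsSplittingPath υ σ τ (fun t => W t ω) P₀ Q₀
    (fun n => X.P n ω) (fun n => X.Q n ω)
    (fun n t => X.barP n t ω) (fun n t => X.barQ n t ω)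
    (fun n t => X.tildeP n t ω) (fun n t => X.tildeQ n t ω)

/-- `Y` is a time-homogeneous Markov chain started at `x`, with respect to the discrete family
`𝓖` of σ-algebras, with one-step transition kernel `K`. -/
structure IsMarkovChainFrom {Ω : Type u} {mΩ : MeasurableSpace Ω} (μ : Measure Ω)
    (𝓖 : ℕ → MeasurableSpace Ω) (K : Kernel (ℝ × ℝ) (ℝ × ℝ)) (x : ℝ × ℝ)
    (Y : ℕ → Ω → ℝ × ℝ) : Prop where
  init : ∀ᵐ ω ∂μ, Y 0 ω = x
  adapted : ∀ n, Measurable[𝓖 n] (Y n)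
  markov : ∀ n, ∀ A : Set (ℝ × ℝ), MeasurableSet A →
    μ⟦Y (n + 1) ⁻¹' A | 𝓖 n⟧ =ᵐ[μ] fun ω => (K (Y n ω)).real A

/-- The probability measure `π` is ergodic for the family `Y` of chains (`Y x` is the chain
started at `x`): time averages of `x ↦ E[g(Y_n^x)]` converge to `π(g)` in `L²(π)`. -/
def IsErgodicLimit {Ω : Type u} {mΩ : MeasurableSpace Ω} (μ : Measure Ω)
    (Y : ℝ × ℝ → ℕ → Ω → ℝ × ℝ) (π : Measure (ℝ × ℝ)) : Prop :=
  ∀ g : ℝ × ℝ → ℝ, MemLp g 2 π →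
    Tendsto (fun N : ℕ => eLpNorm
      (fun x => (N : ℝ)⁻¹ * (∑ n ∈ Finset.range N, ∫ ω, g (Y x n ω) ∂μ) - ∫ y, g y ∂π) 2 π)
      atTop (𝓝 0)

/-- The family `Y` of processes, `Y x` starting at `x`, is a time-homogeneous Markov chain that
has exactly one invariant probability measure, and this measure is ergodic. -/
def IsUniquelyErgodic {Ω : Type u} {mΩ : MeasurableSpace Ω} (μ : Measure Ω)
    (𝓖 : ℕ → MeasurableSpace Ω) (Y : ℝ × ℝ → ℕ → Ω → ℝ × ℝ) : Prop :=
  ∃ K : Kernel (ℝ × ℝ) (ℝ × ℝ), IsMarkovKernel K ∧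
    (∀ x, IsMarkovChainFrom μ 𝓖 K x (Y x)) ∧
    ∃ π : Measure (ℝ × ℝ), IsProbabilityMeasure π ∧ K.Invariant π ∧
      (∀ π' : Measure (ℝ × ℝ), IsProbabilityMeasure π' → K.Invariant π' → π' = π) ∧
      IsErgodicLimit μ Y π

end

/-! Everything rests on the energy `E = H + υ ^ 4 / 8`, which dominates `p ^ 2 / 4 + q ^ 4 / 8`. The
Hamiltonian substep conserves `E`. The stochastic substep over a time `T` is explicit: with `a =
exp(-υ T / 2)` it maps `(p, q)` to `(a p + w, a q)`, where `w` is centred Gaussian with variance `v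
= σ ^ 2 (1 - a ^ 2) / υ` and independent of the past. Hence `E` becomes at most `a ^ 2 E + (1 - a ^
2) υ ^ 4 / 8 + a (p + υ q / 2) w + w ^ 2 / 2` (`langevinEnergy_step_le`). The cross term is harmless
because `(p + υ q / 2) ^ 2 ≤ 2 E`, so a Gaussian integral turns an exponential moment with parameter
`θ` into one with parameter `θ a ^ 2 / (1 - θ v)`.

This yields both integrability statements. If `θ ≤ υ / (2 σ ^ 2)`, the new parameter is at most `θ
a`, and the bounds close up uniformly in time; taking `θ` of order `1 / (1 + E₀)`, with `E₀` the
initial energy, converts them into power moments with the right dependence on the initial value. If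
instead `θ` is `exp(-σ ^ 2 t_n)`, the growth of the parameter in one step is absorbed by its decay
in `n`, at the price of a factor `exp(C τ)`.

Unique ergodicity follows from Harris' theorem in the form of Hairer and Mattingly,
`exists_unique_invariant_of_drift_of_minorization`. The drift condition is the step inequality
integrated in `w`. The minorization (`IsHamiltonianFlow.exists_minorization`) is a controllability
argument, since noise enters only the momentum. From position near `0`, a momentum spread over an
interval is carried by the flow to positions covering an interval, and the next noise spreads the
momentum again, so two steps dominate Lebesgue measure on a rectangle. From any other position there
is a momentum for which the flow does not increase `|q|`; the damping then shrinks `|q|` by the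
factor `a`, and finitely many steps reach the neighbourhood of `0`. Compactness of energy sublevel
sets makes the constants uniform.

Harris' theorem gives convergence of `κ ^ n φ` to `π(φ)` at every point for bounded `φ`. Since `κ`
contracts `L²(π)`, density of simple functions extends it to `L²`, and Cesàro averaging gives the
ergodic limit. -/

/-! ### Gaussian integrals -/

/-- The exponential moment of a quadratic polynomial under a centred Gaussian law. -/
theorem lintegral_exp_quadratic_gaussianReal (v : ℝ≥0) (θ b : ℝ) (h : θ * v < 1) :
    ∫⁻ w, ENNReal.ofReal (Real.exp (θ * (b * w + w ^ 2 / 2))) ∂(gaussianReal 0 v)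
      = ENNReal.ofReal (Real.exp (θ ^ 2 * b ^ 2 * v / (2 * (1 - θ * v))) / √(1 - θ * v)) := by
  rcases eq_or_ne v 0 with rfl | hv
  · rw [gaussianReal_zero_var, lintegral_dirac' _ (by fun_prop)]
    simp
  -- Completing the square: the tilted density is a constant multiple of the Gaussian density with
  -- variance `v / (1 - θ v)` and mean `θ b v / (1 - θ v)`.
  have hv0 : (0 : ℝ) < v := lt_of_le_of_ne v.2 (fun h => hv (NNReal.coe_eq_zero.1 h.symm))
  have hd : 0 < 1 - θ * v := by linarith
  set v' : ℝ≥0 := ⟨v / (1 - θ * v), by positivity⟩ with hv'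
  have hv'c : (v' : ℝ) = v / (1 - θ * v) := rfl
  have hv'0 : v' ≠ 0 := by
    intro h0
    have : (v' : ℝ) = 0 := by rw [h0]; rfl
    rw [hv'c] at this
    have : 0 < (v : ℝ) / (1 - θ * v) := by positivity
    linarith
  set m : ℝ := θ * b * v' with hm
  rw [gaussianReal_of_var_ne_zero 0 hv,
    lintegral_withDensity_eq_lintegral_mul _ (measurable_gaussianPDF 0 v) (by fun_prop)]
  have key : ∀ w : ℝ, (gaussianPDF 0 v * fun w =>
        ENNReal.ofReal (Real.exp (θ * (b * w + w ^ 2 / 2)))) w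
      = ENNReal.ofReal (Real.exp (θ ^ 2 * b ^ 2 * v / (2 * (1 - θ * v))) / √(1 - θ * v))
        * gaussianPDF m v' w := by
    intro w
    simp only [Pi.mul_apply, gaussianPDF, gaussianPDFReal_def]
    rw [← ENNReal.ofReal_mul (by positivity), ← ENNReal.ofReal_mul (by positivity)]
    congr 1
    have h1 : √(2 * Real.pi * v') = √(2 * Real.pi * v) / √(1 - θ * v) := by
      rw [hv'c, ← Real.sqrt_div (by positivity), mul_div_assoc]
    have hs : √(1 - θ * v) ≠ 0 := (Real.sqrt_pos.2 hd).ne'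
    have hs' : √(2 * Real.pi * v) ≠ 0 := (Real.sqrt_pos.2 (by positivity)).ne'
    rw [h1, inv_div, mul_assoc, ← Real.exp_add]
    have h2 : -(w - 0) ^ 2 / (2 * (v : ℝ)) + θ * (b * w + w ^ 2 / 2)
        = θ ^ 2 * b ^ 2 * v / (2 * (1 - θ * v)) + -(w - m) ^ 2 / (2 * v') := by
      rw [hm, hv'c]
      obtain ⟨D, hD⟩ : ∃ D : ℝ, D = 1 - θ * v := ⟨_, rfl⟩
      rw [← hD] at hd ⊢
      have hθ : θ = (1 - D) / v := by rw [hD]; field_simp; ring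
      rw [hθ]
      field_simp
      ring
    rw [h2, Real.exp_add, div_mul_eq_mul_div]
    generalize √(1 - θ * v) = A at hs
    field_simp
  rw [lintegral_congr key, lintegral_const_mul _ (measurable_gaussianPDF m v'),
    lintegral_gaussianPDF_eq_one m hv'0, mul_one]

theorem integrable_pow_gaussianReal (v : ℝ≥0) (n : ℕ) :
    Integrable (fun w : ℝ => w ^ n) (gaussianReal 0 v) := by
  rcases Nat.eq_zero_or_pos n with rfl | hn
  · simp
  have h := (memLp_id_gaussianReal (μ := 0) (v := v) n).integrable_norm_pow (by positivity)
  refine h.mono (by fun_prop) (Eventually.of_forall fun w => ?_)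
  simp

theorem integral_sq_gaussianReal (v : ℝ≥0) : ∫ w, w ^ 2 ∂(gaussianReal 0 v) = v := by
  have h := variance_fun_id_gaussianReal (μ := 0) (v := v)
  rw [variance_eq_integral (by fun_prop)] at h
  simpa using h

/-! ### The linear stochastic differential equation -/

/-- Abel summation along a path: the solution of `dD = -k D dr + σ dw` is a limit of Riemann
sums of `e^{-k(t-r)} σ dw`. -/
theorem tendsto_sum_exp_mul_increment {k σ s t : ℝ} (hst : s ≤ t) {D w : ℝ → ℝ}
    (hD : ContinuousOn D (Icc s t))
    (h : ∀ r ∈ Icc s t, D r = D s - (∫ x in s..r, k * D x) + σ * (w r - w s)) :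
    Tendsto (fun m : ℕ => ∑ i ∈ Finset.range (m + 1),
      Real.exp (-k * (t - (s + (i + 1 : ℕ) * ((t - s) / (m + 1))))) *
        (σ * (w (s + (i + 1 : ℕ) * ((t - s) / (m + 1))) - w (s + (i : ℕ) * ((t - s) / (m + 1))))))
      atTop (𝓝 (D t - Real.exp (-k * (t - s)) * D s)) := by
  set e : ℝ → ℝ := fun r => Real.exp (-k * (t - r)) with he
  have hec : Continuous e := by fun_prop
  have hed : ∀ r, HasDerivAt e (k * e r) r := by
    intro r
    have h1 : HasDerivAt (fun r => -k * (t - r)) (-k * (0 - 1)) r :=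
      ((hasDerivAt_const r t).sub (hasDerivAt_id r)).const_mul (-k)
    have := h1.exp
    convert this using 1
    simp only [he]; ring
  -- The error on a mesh cell is an integral of `k (F(x, g i) - F(g (i + 1), x))` for this
  -- two-variable function `F`, so uniform continuity on the square controls all cells at once.
  have hF : ContinuousOn (fun z : ℝ × ℝ => e z.1 * D z.2) (Icc s t ×ˢ Icc s t) :=
    (hec.comp continuous_fst).continuousOn.mul
      (hD.comp continuousOn_snd (fun z hz => hz.2))
  have hU := (isCompact_Icc.prod isCompact_Icc).uniformContinuousOn_of_continuous hF
  rw [Metric.tendsto_atTop]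
  intro ε hε
  set C : ℝ := |k| * (t - s) with hC
  have hC0 : 0 ≤ C := mul_nonneg (abs_nonneg _) (by linarith)
  obtain ⟨δ, hδ, hδ'⟩ := Metric.uniformContinuousOn_iff.1 hU (ε / (C + 1)) (by positivity)
  obtain ⟨M, hM⟩ := exists_nat_gt ((t - s) / δ)
  refine ⟨M, fun m hm => ?_⟩
  set d : ℝ := (t - s) / (m + 1) with hd
  have hd0 : 0 ≤ d := div_nonneg (by linarith) (by positivity)
  have hmd : ((m : ℝ) + 1) * d = t - s := by rw [hd]; field_simp
  have hdδ : d < δ := by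
    have h1 : (t - s) / δ < (m : ℝ) + 1 := by
      have : (M : ℝ) ≤ m := by exact_mod_cast hm
      linarith
    rw [div_lt_iff₀ hδ] at h1
    rw [hd, div_lt_iff₀ (by positivity)]
    linarith
  set g : ℕ → ℝ := fun i => s + (i : ℝ) * d with hg
  have hgs : ∀ i, g (i + 1) = g i + d := by intro i; simp only [hg]; push_cast; ring
  have hg0 : g 0 = s := by simp [hg]
  have hgm : g (m + 1) = t := by simp only [hg]; push_cast; linarith
  have hgmem : ∀ i ≤ m + 1, g i ∈ Icc s t := by
    intro i hi
    have h1 : (i : ℝ) ≤ (m : ℝ) + 1 := by exact_mod_cast hi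
    have h2 : (i : ℝ) * d ≤ ((m : ℝ) + 1) * d := mul_le_mul_of_nonneg_right h1 hd0
    have h3 : 0 ≤ (i : ℝ) * d := by positivity
    constructor <;> simp only [hg] <;> linarith
  have hkD : ContinuousOn (fun x => k * D x) (Icc s t) := continuousOn_const.mul hD
  have hint : ∀ a ∈ Icc s t, ∀ b ∈ Icc s t,
      IntervalIntegrable (fun x => k * D x) volume a b := by
    intro a ha b hb
    refine (hkD.mono ?_).intervalIntegrable
    rw [← uIcc_of_le hst]
    exact uIcc_subset_uIcc (by rwa [uIcc_of_le hst]) (by rwa [uIcc_of_le hst])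
  -- Telescoping `e D` and subtracting the noise term leaves only an integral against `dx`; no
  -- integral against `w` has to be defined.
  have hterm : ∀ i ∈ Finset.range (m + 1),
      (e (g (i + 1)) * D (g (i + 1)) - e (g i) * D (g i))
        - e (g (i + 1)) * (σ * (w (g (i + 1)) - w (g i)))
      = ∫ x in (g i)..(g (i + 1)), k * (e x * D (g i) - e (g (i + 1)) * D x) := by
    intro i hi
    have hi' := Finset.mem_range.1 hi
    have m1 := hgmem i (by omega)
    have m2 := hgmem (i + 1) (by omega)
    have e1 := h _ m1
    have e2 := h _ m2
    have e3 := intervalIntegral.integral_add_adjacent_intervals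
      (hint s ⟨le_rfl, hst⟩ _ m1) (hint _ m1 _ m2)
    have e4 : ∫ x in (g i)..(g (i + 1)), k * e x = e (g (i + 1)) - e (g i) :=
      intervalIntegral.integral_eq_sub_of_hasDerivAt (fun x _ => hed x)
        ((continuous_const.mul hec).intervalIntegrable _ _)
    have e5 : ∫ x in (g i)..(g (i + 1)), k * (e x * D (g i) - e (g (i + 1)) * D x)
        = (∫ x in (g i)..(g (i + 1)), k * e x) * D (g i)
          - e (g (i + 1)) * ∫ x in (g i)..(g (i + 1)), k * D x := by
      rw [← intervalIntegral.integral_mul_const, ← intervalIntegral.integral_const_mul,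
        ← intervalIntegral.integral_sub (f := fun x => k * e x * D (g i))
          (Continuous.intervalIntegrable (by fun_prop) _ _) ((hint _ m1 _ m2).const_mul _)]
      congr 1; ext x; ring
    rw [e5, e4]
    have e6 : σ * (w (g (i + 1)) - w (g i))
        = D (g (i + 1)) - D (g i) + ∫ x in (g i)..(g (i + 1)), k * D x := by linarith
    rw [e6]; ring
  have hsum : D t - e s * D s - ∑ i ∈ Finset.range (m + 1),
      e (g (i + 1)) * (σ * (w (g (i + 1)) - w (g i)))
      = ∑ i ∈ Finset.range (m + 1),
        ∫ x in (g i)..(g (i + 1)), k * (e x * D (g i) - e (g (i + 1)) * D x) := by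
    rw [← Finset.sum_congr rfl hterm, Finset.sum_sub_distrib,
      Finset.sum_range_sub (fun i => e (g i) * D (g i)), hg0, hgm]
    simp [he]
  have hbound : ∀ i ∈ Finset.range (m + 1),
      ‖∫ x in (g i)..(g (i + 1)), k * (e x * D (g i) - e (g (i + 1)) * D x)‖
        ≤ |k| * (ε / (C + 1)) * d := by
    intro i hi
    have hi' := Finset.mem_range.1 hi
    have m1 := hgmem i (by omega)
    have m2 := hgmem (i + 1) (by omega)
    have := intervalIntegral.norm_integral_le_of_norm_le_const
      (a := g i) (b := g (i + 1)) (C := |k| * (ε / (C + 1)))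
      (f := fun x => k * (e x * D (g i) - e (g (i + 1)) * D x)) ?_
    · rwa [hgs i, add_sub_cancel_left, abs_of_nonneg hd0, ← hgs i] at this
    · intro x hx
      rw [uIoc_of_le (by rw [hgs]; linarith)] at hx
      have hxm : x ∈ Icc s t := ⟨m1.1.trans hx.1.le, hx.2.trans m2.2⟩
      rw [norm_mul, Real.norm_eq_abs]
      refine mul_le_mul_of_nonneg_left ?_ (abs_nonneg _)
      have := hδ' (x, g i) ⟨hxm, m1⟩ (g (i + 1), x) ⟨m2, hxm⟩ ?_
      · rw [Real.dist_eq] at this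
        exact this.le
      · rw [Prod.dist_eq, max_lt_iff]
        rw [hgs i] at hx
        constructor
        · rw [Real.dist_eq, abs_lt]; simp only [hgs i]; constructor <;> linarith [hx.1, hx.2]
        · rw [Real.dist_eq, abs_lt]; constructor <;> linarith [hx.1, hx.2]
  rw [dist_comm, Real.dist_eq, ← Real.norm_eq_abs]
  change ‖D t - e s * D s - ∑ i ∈ Finset.range (m + 1),
      e (g (i + 1)) * (σ * (w (g (i + 1)) - w (g i)))‖ < ε
  rw [hsum]
  refine (norm_sum_le _ _).trans_lt ((Finset.sum_le_sum hbound).trans_lt ?_)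
  rw [Finset.sum_const, Finset.card_range, nsmul_eq_mul]
  push_cast
  have : ((m : ℝ) + 1) * (|k| * (ε / (C + 1)) * d) = C / (C + 1) * ε := by
    rw [hC, ← hmd]; ring
  rw [this]
  have h1 : C / (C + 1) < 1 := by rw [div_lt_one (by positivity)]; linarith
  nlinarith

/-- A deterministic instance of the preceding convergence: `D r = (1 - e^{-2k(r-s)}) / (2k)` solves
`dD = -2k D dr + dr`, so the path `w` is the identity. The limit is the variance of the stochastic
convolution. -/
theorem tendsto_sum_sq_exp {k s t : ℝ} (hk : 0 < k) (hst : s ≤ t) (σ : ℝ) :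
    Tendsto (fun m : ℕ => ∑ i ∈ Finset.range (m + 1),
      (Real.exp (-k * (t - (s + (i + 1 : ℕ) * ((t - s) / (m + 1))))) * σ) ^ 2
        * ((s + (i + 1 : ℕ) * ((t - s) / (m + 1))) - (s + (i : ℕ) * ((t - s) / (m + 1)))))
      atTop (𝓝 (σ ^ 2 * (1 - Real.exp (-(2 * k) * (t - s))) / (2 * k))) := by
  have hd : ∀ x, HasDerivAt (fun r => (1 - Real.exp (-(2 * k) * (r - s))) / (2 * k))
      (Real.exp (-(2 * k) * (x - s))) x := by
    intro x
    have h1 : HasDerivAt (fun r => -(2 * k) * (r - s)) (-(2 * k) * 1) x :=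
      ((hasDerivAt_id x).sub_const s).const_mul _
    refine ((h1.exp.const_sub 1).div_const (2 * k)).congr_deriv ?_
    field_simp
  have h := tendsto_sum_exp_mul_increment (k := 2 * k) (σ := 1) (w := id) hst
    (D := fun r => (1 - Real.exp (-(2 * k) * (r - s))) / (2 * k)) (by fun_prop) ?_
  · have h2 := h.const_mul (σ ^ 2)
    convert h2 using 2 with m
    · rw [Finset.mul_sum]
      refine Finset.sum_congr rfl fun i _ => ?_
      have : ∀ x : ℝ, Real.exp (-(2 * k) * x) = Real.exp (-k * x) ^ 2 := by
        intro x; rw [← Real.exp_nat_mul]; congr 1; push_cast; ring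
      rw [this]
      simp only [id]
      ring
    · simp; ring
  · intro r _
    have h3 : ∫ x in s..r, 2 * k * ((1 - Real.exp (-(2 * k) * (x - s))) / (2 * k))
        = (r - s) - (1 - Real.exp (-(2 * k) * (r - s))) / (2 * k) := by
      have h4 : ∀ x ∈ uIcc s r, HasDerivAt
          (fun r => r - (1 - Real.exp (-(2 * k) * (r - s))) / (2 * k))
          (2 * k * ((1 - Real.exp (-(2 * k) * (x - s))) / (2 * k))) x := by
        intro x _
        refine ((hasDerivAt_id x).sub (hd x)).congr_deriv ?_
        field_simp
      rw [intervalIntegral.integral_eq_sub_of_hasDerivAt h4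
        (Continuous.intervalIntegrable (by fun_prop) _ _)]
      simp; ring
    rw [h3]
    simp

/-- The joint characteristic function of weighted Brownian increments, on an event known at the
starting time. -/
theorem IsWienerProcess.setIntegral_cexp_sum_increments {Ω : Type u} {mΩ : MeasurableSpace Ω}
    {μ : Measure Ω} [IsProbabilityMeasure μ] {𝓕 : Filtration ℝ≥0 mΩ} {W : ℝ≥0 → Ω → ℝ}
    (hW : IsWienerProcess μ 𝓕 W) {r : ℕ → ℝ≥0} (hr : Monotone r) (c : ℕ → ℝ) {A : Set Ω}
    (hA : MeasurableSet[𝓕 (r 0)] A) (n : ℕ) :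
    ∫ ω in A, Complex.exp (((∑ i ∈ Finset.range n, c i * (W (r (i + 1)) ω - W (r i) ω) : ℝ) : ℂ)
      * Complex.I) ∂μ
    = μ.real A * Complex.exp ((-(∑ i ∈ Finset.range n,
        c i ^ 2 * ((r (i + 1) : ℝ) - r i)) / 2 : ℝ) : ℂ) := by
  have hWm : ∀ i j, i ≤ j → Measurable[𝓕 (r j)] (W (r i)) := fun i j hij =>
    (hW.adapted (r i)).mono (𝓕.mono (hr hij)) le_rfl
  have hSm : ∀ n, Measurable[𝓕 (r n)] (fun ω => Complex.exp
      (((∑ i ∈ Finset.range n, c i * (W (r (i + 1)) ω - W (r i) ω) : ℝ) : ℂ) * Complex.I)) := by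
    intro n
    refine Complex.measurable_exp.comp (Measurable.mul_const
      (Complex.measurable_ofReal.comp ?_) _)
    refine Finset.measurable_fun_sum _ fun i hi => ?_
    have hi' := Finset.mem_range.1 hi
    exact ((hWm (i + 1) n hi').sub (hWm i n hi'.le)).const_mul _
  have hA' : ∀ n, MeasurableSet[𝓕 (r n)] A := fun n => 𝓕.mono (hr (Nat.zero_le n)) _ hA
  have hAm : MeasurableSet A := 𝓕.le _ _ hA
  induction n with
  | zero => simp [measureReal_def]
  | succ n ih =>
    -- The indicator of `A` stays with the earlier increments: both are known at time `r n`, hence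
    -- independent of the last increment `g`.
    set f : Ω → ℂ := A.indicator (fun ω => Complex.exp
      (((∑ i ∈ Finset.range n, c i * (W (r (i + 1)) ω - W (r i) ω) : ℝ) : ℂ) * Complex.I)) with hf
    set g : Ω → ℂ := fun ω => Complex.exp
      (((c n * (W (r (n + 1)) ω - W (r n) ω) : ℝ) : ℂ) * Complex.I) with hg
    have hfm : Measurable[𝓕 (r n)] f := (hSm n).indicator (hA' n)
    have hφ : Measurable (fun x : ℝ => Complex.exp (((c n * x : ℝ) : ℂ) * Complex.I)) := by
      fun_prop
    have hgm : Measurable[MeasurableSpace.comap (fun ω => W (r (n + 1)) ω - W (r n) ω)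
        inferInstance] g :=
      hφ.comp (comap_measurable _)
    have hW' : Measurable (fun ω => W (r (n + 1)) ω - W (r n) ω) :=
      ((hW.adapted _).mono (𝓕.le _) le_rfl).sub ((hW.adapted _).mono (𝓕.le _) le_rfl)
    have hind : f ⟂ᵢ[μ] g := by
      rw [IndepFun_iff_Indep]
      exact (indep_of_indep_of_le (hW.indep_increments _ _ (hr n.le_succ))
        hgm.comap_le hfm.comap_le).symm
    have hgm' : Measurable g := hφ.comp hW'
    have h1 : ∫ ω in A, Complex.exp (((∑ i ∈ Finset.range (n + 1),
        c i * (W (r (i + 1)) ω - W (r i) ω) : ℝ) : ℂ) * Complex.I) ∂μ = ∫ ω, f ω * g ω ∂μ := by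
      rw [← integral_indicator hAm]
      congr 1; ext ω
      by_cases hω : ω ∈ A
      · simp only [hf, hg, indicator_of_mem hω, ← Complex.exp_add]
        congr 1
        rw [Finset.sum_range_succ]
        push_cast; ring
      · simp [hf, indicator_of_notMem hω]
    rw [h1, hind.integral_fun_mul_eq_mul_integral
      (hfm.mono (𝓕.le _) le_rfl).aestronglyMeasurable hgm'.aestronglyMeasurable]
    have h2 : ∫ ω, f ω ∂μ = μ.real A * Complex.exp ((-(∑ i ∈ Finset.range n,
        c i ^ 2 * ((r (i + 1) : ℝ) - r i)) / 2 : ℝ) : ℂ) := by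
      rw [hf, integral_indicator hAm, ih]
    have hlaw := hW.brownian.hasLaw_sub (r (n + 1)) (r n)
    have h3 : ∫ ω, g ω ∂μ
        = Complex.exp ((-(c n ^ 2 * ((r (n + 1) : ℝ) - r n)) / 2 : ℝ) : ℂ) := by
      have h4 : ∫ ω, g ω ∂μ = charFun (μ.map (W (r (n + 1)) - W (r n))) (c n) := by
        rw [charFun_apply_real, integral_map hlaw.aemeasurable (by fun_prop)]
        simp [hg]
      have h5 : ((nndist (r (n + 1) : ℝ) (r n) : ℝ≥0) : ℝ) = r (n + 1) - r n := by
        rw [coe_nndist, Real.dist_eq, abs_of_nonneg]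
        exact sub_nonneg.2 (by exact_mod_cast hr n.le_succ)
      rw [h4, hlaw.map_eq, charFun_gaussianReal]
      congr 1
      have h6 : (((nndist (r (n + 1) : ℝ) (r n) : ℝ≥0) : ℝ) : ℂ)
        = ((r (n + 1) - r n : ℝ) : ℂ) := by rw [h5]
      have h7 : ((nndist (r (n + 1)).1 (r n).1 : ℝ≥0) : ℂ) = ((r (n + 1) - r n : ℝ) : ℂ) := h6
      simp only [h7]
      push_cast; ring
    rw [h2, h3, mul_assoc, ← Complex.exp_add]
    congr 2
    rw [Finset.sum_range_succ]
    push_cast; ring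

/-- The stochastic convolution `D t - e^{-k(t-s)} D s` of the linear equation
`dD = -k D dr + σ dW` is a centred Gaussian variable independent of the past of `s`. -/
theorem IsWienerProcess.map_restrict_stochastic_convolution {Ω : Type u} {mΩ : MeasurableSpace Ω}
    {μ : Measure Ω} [IsProbabilityMeasure μ] {𝓕 : Filtration ℝ≥0 mΩ} {W : ℝ≥0 → Ω → ℝ}
    (hW : IsWienerProcess μ 𝓕 W) {k σ s t : ℝ} (hk : 0 < k) (hs : 0 ≤ s) (hst : s ≤ t)
    {D : ℝ → Ω → ℝ} {ξ : Ω → ℝ} (hξ : Measurable ξ)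
    (hD : ∀ᵐ ω ∂μ, ContinuousOn (fun r => D r ω) (Icc s t) ∧
      (∀ r ∈ Icc s t, D r ω = D s ω - (∫ x in s..r, k * D x ω)
        + σ * (W r.toNNReal ω - W s.toNNReal ω)) ∧
      ξ ω = D t ω - Real.exp (-k * (t - s)) * D s ω)
    {A : Set Ω} (hA : MeasurableSet[𝓕 s.toNNReal] A) :
    (μ.restrict A).map ξ = μ A •
      gaussianReal 0 (σ ^ 2 * (1 - Real.exp (-(2 * k) * (t - s))) / (2 * k)).toNNReal := by
  set V : ℝ := σ ^ 2 * (1 - Real.exp (-(2 * k) * (t - s))) / (2 * k) with hV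
  have hV0 : 0 ≤ V := by
    have : Real.exp (-(2 * k) * (t - s)) ≤ 1 := Real.exp_le_one_iff.2 (by nlinarith)
    have : 0 ≤ 1 - Real.exp (-(2 * k) * (t - s)) := by linarith
    positivity
  set g : ℕ → ℕ → ℝ := fun m i => s + (i : ℝ) * ((t - s) / (m + 1)) with hg
  have hgmono : ∀ m, Monotone (fun i => (g m i).toNNReal) := fun m i j hij => by
    refine Real.toNNReal_mono ?_
    have : (i : ℝ) ≤ j := by exact_mod_cast hij
    have h2 : 0 ≤ (t - s) / ((m : ℝ) + 1) := div_nonneg (by linarith) (by positivity)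
    simp only [hg]
    nlinarith [mul_le_mul_of_nonneg_right this h2]
  have hg0 : ∀ m i, 0 ≤ g m i := fun m i => by
    have h2 : 0 ≤ (t - s) / ((m : ℝ) + 1) := div_nonneg (by linarith) (by positivity)
    simp only [hg]; positivity
  have : IsFiniteMeasure (μ A • gaussianReal 0 V.toNNReal) :=
    Measure.smul_finite _ (measure_ne_top _ _)
  -- Equality for every past event `A` encodes the Gaussian law and the independence of the past
  -- together; it is checked on characteristic functions, as the limit of those of the Riemann sums.
  refine Measure.ext_of_charFun (funext fun u => ?_)
  rw [charFun_apply_real, integral_map hξ.aemeasurable (by fun_prop)]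
  set c : ℕ → ℕ → ℝ := fun m i => u * (Real.exp (-k * (t - g m (i + 1))) * σ) with hc
  set S : ℕ → Ω → ℝ := fun m ω => ∑ i ∈ Finset.range (m + 1),
    c m i * (W (g m (i + 1)).toNNReal ω - W (g m i).toNNReal ω) with hS
  have hWm : ∀ r, Measurable (W r) := fun r => (hW.adapted r).mono (𝓕.le _) le_rfl
  have hSm : ∀ m, Measurable (S m) := fun m =>
    Finset.measurable_fun_sum _ fun i _ => ((hWm _).sub (hWm _)).const_mul _
  have hlim : ∀ᵐ ω ∂(μ.restrict A), Tendsto (fun m => Complex.exp ((S m ω : ℂ) * Complex.I)) atTop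
      (𝓝 (Complex.exp ((u : ℂ) * (ξ ω : ℂ) * Complex.I))) := by
    refine ae_restrict_of_ae ?_
    filter_upwards [hD] with ω ⟨h1, h2, h3⟩
    have h4 := (tendsto_sum_exp_mul_increment (w := fun r => W r.toNNReal ω) hst h1 h2).const_mul u
    rw [← h3] at h4
    have h5 : Tendsto (fun m => S m ω) atTop (𝓝 (u * ξ ω)) := by
      refine h4.congr fun m => ?_
      rw [Finset.mul_sum]
      refine Finset.sum_congr rfl fun i _ => ?_
      simp only [hc, hg]; ring
    have h6 : Continuous (fun x : ℝ => Complex.exp ((x : ℂ) * Complex.I)) := by fun_prop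
    have := (h6.tendsto _).comp h5
    simpa [Function.comp_def] using this
  have hT := tendsto_integral_of_dominated_convergence (μ := μ.restrict A) (fun _ => (1 : ℝ))
    (F := fun m ω => Complex.exp ((S m ω : ℂ) * Complex.I))
    (fun m => by
      have := hSm m
      exact (by fun_prop : Measurable fun ω => Complex.exp
        ((S m ω : ℂ) * Complex.I)).aestronglyMeasurable)
    (integrable_const _)
    (fun m => Eventually.of_forall fun ω => (Complex.norm_exp_ofReal_mul_I _).le) hlim
  have hval : ∀ m, ∫ ω in A, Complex.exp ((S m ω : ℂ) * Complex.I) ∂μ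
      = μ.real A * Complex.exp ((-(∑ i ∈ Finset.range (m + 1),
        c m i ^ 2 * (g m (i + 1) - g m i)) / 2 : ℝ) : ℂ) := by
    intro m
    have h1 := hW.setIntegral_cexp_sum_increments (hgmono m) (c m) (A := A)
      (by rwa [show g m 0 = s by simp [hg]]) (m + 1)
    simp only [Real.coe_toNNReal _ (hg0 m _)] at h1
    exact h1
  have hvar : Tendsto (fun m => ∑ i ∈ Finset.range (m + 1),
      c m i ^ 2 * (g m (i + 1) - g m i)) atTop (𝓝 (u ^ 2 * V)) := by
    refine ((tendsto_sum_sq_exp hk hst σ).const_mul (u ^ 2)).congr fun m => ?_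
    rw [Finset.mul_sum]
    refine Finset.sum_congr rfl fun i _ => ?_
    simp only [hc, hg]; ring
  have h6 : Continuous (fun x : ℝ => (μ.real A : ℂ) * Complex.exp ((-x / 2 : ℝ) : ℂ)) := by
    fun_prop
  have hT2 := (h6.tendsto _).comp hvar
  have hT3 := hT2.congr (fun m => (hval m).symm)
  rw [tendsto_nhds_unique hT hT3, charFun_apply_real, integral_smul_measure,
    ← charFun_apply_real, charFun_gaussianReal, Real.coe_toNNReal V hV0]
  rw [measureReal_def, Complex.real_smul]
  congr 2
  push_cast; ring

/-! ### Energy estimates -/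

/-- The Hamiltonian shifted to be nonnegative. -/
noncomputable def langevinEnergy (υ p q : ℝ) : ℝ := langevinH υ p q + υ ^ 4 / 8

/-- The variance of the stochastic convolution over a time `T`. -/
noncomputable def convolutionVar (υ σ T : ℝ) : ℝ≥0 := (σ ^ 2 * (1 - Real.exp (-υ * T)) / υ).toNNReal

theorem coe_convolutionVar {υ : ℝ} (hυ : 0 < υ) (σ : ℝ) {T : ℝ} (hT : 0 ≤ T) :
    (convolutionVar υ σ T : ℝ) = σ ^ 2 * (1 - Real.exp (-υ * T)) / υ := by
  have : Real.exp (-υ * T) ≤ 1 := Real.exp_le_one_iff.2 (by nlinarith)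
  have : 0 ≤ 1 - Real.exp (-υ * T) := by linarith
  exact Real.coe_toNNReal _ (by positivity)

/-- The difference of the two sides is `(p / 2 + υ q / 2) ^ 2 + (q ^ 2 - υ ^ 2) ^ 2 / 8`; this is
what fixes the shift `υ ^ 4 / 8`. -/
theorem le_langevinEnergy (υ p q : ℝ) : p ^ 2 / 4 + q ^ 4 / 8 ≤ langevinEnergy υ p q := by
  unfold langevinEnergy langevinH
  nlinarith [sq_nonneg (p / 2 + υ * q / 2), sq_nonneg (q ^ 2 - υ ^ 2)]

theorem langevinEnergy_nonneg (υ p q : ℝ) : 0 ≤ langevinEnergy υ p q :=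
  le_trans (by positivity) (le_langevinEnergy υ p q)

/-- In terms of the velocity `p + υ q / 2` of the position, `H` is kinetic energy plus the double
well `q ^ 4 / 4 - υ ^ 2 q ^ 2 / 8`. This velocity is also the coefficient of the noise in the energy
increment. -/
theorem sq_velocity_le_langevinEnergy (υ p q : ℝ) :
    (p + υ / 2 * q) ^ 2 ≤ 2 * langevinEnergy υ p q := by
  unfold langevinEnergy langevinH
  nlinarith [sq_nonneg (q ^ 2 - υ ^ 2 / 4), sq_nonneg (υ ^ 2)]

theorem measurable_langevinEnergy (υ : ℝ) :
    Measurable fun x : ℝ × ℝ => langevinEnergy υ x.1 x.2 := by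
  unfold langevinEnergy langevinH; fun_prop

/-- The only loss is `a ^ 4 ≤ a ^ 2` in the quartic term; everything else is an identity. -/
theorem langevinEnergy_step_le {υ a : ℝ} (ha : 0 ≤ a) (ha1 : a ≤ 1) (p q w : ℝ) :
    langevinEnergy υ (a * p + w) (a * q) ≤ a ^ 2 * langevinEnergy υ p q
      + υ ^ 4 / 8 * (1 - a ^ 2) + (a * (p + υ / 2 * q) * w + w ^ 2 / 2) := by
  have h1 : a ^ 4 * q ^ 4 ≤ a ^ 2 * q ^ 4 := by
    refine mul_le_mul_of_nonneg_right ?_ (by positivity)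
    have : a ^ 2 ≤ 1 := pow_le_one₀ ha ha1
    nlinarith [sq_nonneg a]
  unfold langevinEnergy langevinH
  nlinarith

/-- Bounding the squared noise coefficient by `2 a ^ 2 E` makes the exponents combine, since `1 + θ
v / (1 - θ v) = 1 / (1 - θ v)`. The square root in the Gaussian integral is dropped because `0 < 1 -
θ v ≤ 1`. -/
theorem lintegral_exp_langevinEnergy_step_le {υ a θ : ℝ} {v : ℝ≥0} (ha : 0 ≤ a) (ha1 : a ≤ 1)
    (hθ : 0 ≤ θ) (h : θ * v < 1) (p q : ℝ) :
    ∫⁻ w, ENNReal.ofReal (Real.exp (θ * langevinEnergy υ (a * p + w) (a * q)))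
        ∂(gaussianReal 0 v)
      ≤ ENNReal.ofReal (Real.exp (θ * a ^ 2 / (1 - θ * v) * langevinEnergy υ p q
        + θ * (υ ^ 4 / 8 * (1 - a ^ 2))) / (1 - θ * v)) := by
  have hd : 0 < 1 - θ * v := by linarith
  set E := langevinEnergy υ p q with hE
  set b := a * (p + υ / 2 * q) with hb
  have hb2 : b ^ 2 ≤ 2 * a ^ 2 * E := by
    rw [hb, mul_pow]
    nlinarith [mul_le_mul_of_nonneg_left (sq_velocity_le_langevinEnergy υ p q) (sq_nonneg a)]
  calc ∫⁻ w, ENNReal.ofReal (Real.exp (θ * langevinEnergy υ (a * p + w) (a * q)))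
        ∂(gaussianReal 0 v)
      ≤ ∫⁻ w, ENNReal.ofReal (Real.exp (θ * (a ^ 2 * E + υ ^ 4 / 8 * (1 - a ^ 2)))) *
          ENNReal.ofReal (Real.exp (θ * (b * w + w ^ 2 / 2))) ∂(gaussianReal 0 v) := by
        refine lintegral_mono fun w => ?_
        rw [← ENNReal.ofReal_mul (by positivity), ← Real.exp_add]
        refine ENNReal.ofReal_le_ofReal (Real.exp_le_exp.2 ?_)
        rw [← mul_add]
        exact mul_le_mul_of_nonneg_left (langevinEnergy_step_le ha ha1 p q w) hθ
    _ = ENNReal.ofReal (Real.exp (θ * (a ^ 2 * E + υ ^ 4 / 8 * (1 - a ^ 2)))) *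
        ENNReal.ofReal (Real.exp (θ ^ 2 * b ^ 2 * v / (2 * (1 - θ * v))) / √(1 - θ * v)) := by
        rw [lintegral_const_mul _ (by fun_prop), lintegral_exp_quadratic_gaussianReal v θ b h]
    _ ≤ _ := by
        rw [← ENNReal.ofReal_mul (by positivity), ← mul_div_assoc, ← Real.exp_add]
        refine ENNReal.ofReal_le_ofReal ?_
        have hs : 1 - θ * v ≤ √(1 - θ * v) := by
          refine Real.le_sqrt_of_sq_le ?_
          have : 0 ≤ θ * v := by positivity
          nlinarith
        refine div_le_div₀ (by positivity) (Real.exp_le_exp.2 ?_) hd hs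
        have h1 : θ ^ 2 * b ^ 2 * v / (2 * (1 - θ * v))
            ≤ θ ^ 2 * (2 * a ^ 2 * E) * v / (2 * (1 - θ * v)) := by gcongr
        have h2 : θ * (a ^ 2 * E + υ ^ 4 / 8 * (1 - a ^ 2))
            + θ ^ 2 * (2 * a ^ 2 * E) * v / (2 * (1 - θ * v))
            = θ * a ^ 2 / (1 - θ * v) * E + θ * (υ ^ 4 / 8 * (1 - a ^ 2)) := by
          field_simp
          ring
        linarith

/-- One step, for parameters that stay bounded: the exponential moment contracts. -/
theorem lintegral_exp_langevinEnergy_step_le_of_le {υ σ T θ : ℝ} (hυ : 0 < υ) (hσ : 0 < σ)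
    (hT : 0 ≤ T) (hθ : 0 ≤ θ) (hθ1 : θ ≤ υ / (2 * σ ^ 2)) (p q : ℝ) :
    ∫⁻ w, ENNReal.ofReal (Real.exp (θ * langevinEnergy υ (Real.exp (-(υ / 2) * T) * p + w)
        (Real.exp (-(υ / 2) * T) * q))) ∂(gaussianReal 0 (convolutionVar υ σ T))
      ≤ ENNReal.ofReal (Real.exp (θ * Real.exp (-(υ / 2) * T) * langevinEnergy υ p q
        + θ * ((υ ^ 4 / 8 + 2 * σ ^ 2 / υ) * (1 - Real.exp (-(υ / 2) * T) ^ 2)))) := by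
  set a := Real.exp (-(υ / 2) * T) with ha
  have ha0 : 0 < a := Real.exp_pos _
  have ha1 : a ≤ 1 := Real.exp_le_one_iff.2 (by nlinarith)
  have ha2 : Real.exp (-υ * T) = a ^ 2 := by
    rw [ha, ← Real.exp_nat_mul]; congr 1; push_cast; ring
  set v := convolutionVar υ σ T with hvdef
  have hv : (v : ℝ) = σ ^ 2 * (1 - a ^ 2) / υ := by rw [hvdef, coe_convolutionVar hυ σ hT, ha2]
  have ha3 : a ^ 2 ≤ 1 := pow_le_one₀ ha0.le ha1
  have hθv : θ * v ≤ (1 - a ^ 2) / 2 := by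
    rw [le_div_iff₀ (by positivity)] at hθ1
    rw [hv, mul_div_assoc', div_le_div_iff₀ hυ two_pos]
    nlinarith [mul_le_mul_of_nonneg_right hθ1 (by linarith : 0 ≤ 1 - a ^ 2)]
  have hθv0 : 0 ≤ θ * v := by positivity
  have ha4 : 0 < a ^ 2 := by positivity
  refine (lintegral_exp_langevinEnergy_step_le ha0.le ha1 hθ (by linarith) p q).trans ?_
  refine ENNReal.ofReal_le_ofReal ?_
  have hd : 0 < 1 - θ * v := by linarith
  have hE := langevinEnergy_nonneg υ p q
  have h1 : (1 - θ * v)⁻¹ ≤ Real.exp (θ * (2 * σ ^ 2 / υ * (1 - a ^ 2))) := by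
    have h2 : θ * (2 * σ ^ 2 / υ * (1 - a ^ 2)) = 2 * (θ * v) := by rw [hv]; ring
    rw [h2, inv_le_iff_one_le_mul₀ hd]
    nlinarith [mul_le_mul_of_nonneg_right (Real.add_one_le_exp (2 * (θ * v))) hd.le]
  -- Here `1 - θ v ≥ (1 + a ^ 2) / 2 ≥ a`, so one of the two factors `a` pays for the Gaussian
  -- correction and the other remains as contraction.
  have h3 : θ * a ^ 2 / (1 - θ * v) ≤ θ * a := by
    rw [div_le_iff₀ hd]
    have : a ≤ 1 - θ * v := by nlinarith [sq_nonneg (1 - a)]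
    nlinarith [mul_le_mul_of_nonneg_left this (mul_nonneg hθ ha0.le)]
  calc Real.exp (θ * a ^ 2 / (1 - θ * v) * langevinEnergy υ p q
        + θ * (υ ^ 4 / 8 * (1 - a ^ 2))) / (1 - θ * v)
      ≤ Real.exp (θ * a * langevinEnergy υ p q + θ * (υ ^ 4 / 8 * (1 - a ^ 2)))
        * Real.exp (θ * (2 * σ ^ 2 / υ * (1 - a ^ 2))) := by
        rw [div_eq_mul_inv]
        gcongr
    _ = _ := by rw [← Real.exp_add]; congr 1; ring

/-- One step, with the decreasing parameters of exponential integrability. -/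
theorem lintegral_exp_langevinEnergy_step_le_exp_mul {υ σ T θ : ℝ} (hυ : 0 < υ)
    (hT : 0 ≤ T) (hθ : 0 ≤ θ) (hθ1 : θ ≤ Real.exp (-(σ ^ 2 * T))) (p q : ℝ) :
    ∫⁻ w, ENNReal.ofReal (Real.exp (θ * langevinEnergy υ (Real.exp (-(υ / 2) * T) * p + w)
        (Real.exp (-(υ / 2) * T) * q))) ∂(gaussianReal 0 (convolutionVar υ σ T))
      ≤ ENNReal.ofReal (Real.exp ((υ ^ 5 / 8 + σ ^ 2) * T)) *
        ENNReal.ofReal (Real.exp (θ * Real.exp (σ ^ 2 * T) * langevinEnergy υ p q)) := by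
  set a := Real.exp (-(υ / 2) * T) with ha
  have ha0 : 0 < a := Real.exp_pos _
  have ha1 : a ≤ 1 := Real.exp_le_one_iff.2 (by nlinarith)
  have ha2 : Real.exp (-υ * T) = a ^ 2 := by
    rw [ha, ← Real.exp_nat_mul]; congr 1; push_cast; ring
  set v := convolutionVar υ σ T with hvdef
  have hv : (v : ℝ) = σ ^ 2 * (1 - a ^ 2) / υ := by rw [hvdef, coe_convolutionVar hυ σ hT, ha2]
  have ha3 : a ^ 2 ≤ 1 := pow_le_one₀ ha0.le ha1
  have ha5 : 1 - a ^ 2 ≤ υ * T := by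
    have := Real.add_one_le_exp (-υ * T)
    rw [ha2] at this; linarith
  have hx0 : 0 ≤ σ ^ 2 * T := by positivity
  have hvx : (v : ℝ) ≤ σ ^ 2 * T := by
    rw [hv, div_le_iff₀ hυ]
    nlinarith [mul_le_mul_of_nonneg_left ha5 (sq_nonneg σ)]
  have hθ2 : θ ≤ 1 := hθ1.trans (Real.exp_le_one_iff.2 (by linarith))
  -- With `x = σ ^ 2 T` one has `θ v ≤ x e^{-x}`, and `1 - x e^{-x} ≥ e^{-x}` is `e^x ≥ 1 + x`.
  have hexp : Real.exp (-(σ ^ 2 * T)) ≤ 1 - θ * v := by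
    have h1 : θ * v ≤ Real.exp (-(σ ^ 2 * T)) * (σ ^ 2 * T) :=
      mul_le_mul hθ1 hvx v.2 (Real.exp_pos _).le
    have h2 := Real.add_one_le_exp (σ ^ 2 * T)
    have h3 : Real.exp (-(σ ^ 2 * T)) * Real.exp (σ ^ 2 * T) = 1 := by
      rw [← Real.exp_add]; simp
    nlinarith [Real.exp_pos (-(σ ^ 2 * T))]
  have hd : 0 < 1 - θ * v := (Real.exp_pos _).trans_le hexp
  refine (lintegral_exp_langevinEnergy_step_le ha0.le ha1 hθ (by linarith) p q).trans ?_
  rw [← ENNReal.ofReal_mul (by positivity)]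
  refine ENNReal.ofReal_le_ofReal ?_
  have hE := langevinEnergy_nonneg υ p q
  have hinv : (1 - θ * v)⁻¹ ≤ Real.exp (σ ^ 2 * T) := by
    rw [inv_le_comm₀ hd (Real.exp_pos _), ← Real.exp_neg]; exact hexp
  have h3 : θ * a ^ 2 / (1 - θ * v) ≤ θ * Real.exp (σ ^ 2 * T) := by
    rw [div_eq_mul_inv]
    refine mul_le_mul ?_ hinv (by positivity) hθ
    nlinarith
  have h4 : θ * (υ ^ 4 / 8 * (1 - a ^ 2)) ≤ υ ^ 5 / 8 * T := by
    have h5 : υ ^ 4 / 8 * (1 - a ^ 2) ≤ υ ^ 4 / 8 * (υ * T) :=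
      mul_le_mul_of_nonneg_left ha5 (by positivity)
    have h6 : 0 ≤ υ ^ 4 / 8 * (1 - a ^ 2) := mul_nonneg (by positivity) (by linarith)
    nlinarith
  calc Real.exp (θ * a ^ 2 / (1 - θ * v) * langevinEnergy υ p q
        + θ * (υ ^ 4 / 8 * (1 - a ^ 2))) / (1 - θ * v)
      ≤ Real.exp (θ * Real.exp (σ ^ 2 * T) * langevinEnergy υ p q + υ ^ 5 / 8 * T)
        * Real.exp (σ ^ 2 * T) := by
        rw [div_eq_mul_inv]
        gcongr
    _ = _ := by rw [← Real.exp_add, ← Real.exp_add]; congr 1; ring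

/-! ### Paths of the splitting system -/

/-- `(p, q)` solves the Hamiltonian system on `[a, b]`. -/
def IsHamiltonianPath (υ a b : ℝ) (p q : ℝ → ℝ) : Prop :=
  (∀ t ∈ Icc a b, HasDerivWithinAt p (-(υ / 2) * p t - q t ^ 3) (Icc a b) t) ∧
  ∀ t ∈ Icc a b, HasDerivWithinAt q (p t + υ / 2 * q t) (Icc a b) t

theorem eq_start_of_hasDerivWithinAt_zero {f : ℝ → ℝ} {a b : ℝ}
    (h : ∀ t ∈ Icc a b, HasDerivWithinAt f 0 (Icc a b) t) {t : ℝ} (ht : t ∈ Icc a b) :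
    f t = f a :=
  constant_of_has_deriv_right_zero (fun t ht => (h t ht).continuousWithinAt)
    (fun t ht => (h t (Ico_subset_Icc_self ht)).mono_of_mem_nhdsWithin
      (Icc_mem_nhdsGE_of_mem ht)) t ht

theorem IsHamiltonianPath.langevinH_eq {υ a b : ℝ} {p q : ℝ → ℝ}
    (h : IsHamiltonianPath υ a b p q) {t : ℝ} (ht : t ∈ Icc a b) :
    langevinH υ (p t) (q t) = langevinH υ (p a) (q a) := by
  refine eq_start_of_hasDerivWithinAt_zero (f := fun t => langevinH υ (p t) (q t)) ?_ ht
  intro t ht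
  have hp := h.1 t ht
  have hq := h.2 t ht
  have := (((hp.pow 2).div_const 2).add ((hq.pow 4).div_const 4)).add
    ((hp.const_mul (υ / 2)).mul hq)
  refine this.congr_deriv ?_
  push_cast; ring

theorem IsHamiltonianPath.langevinEnergy_eq {υ a b : ℝ} {p q : ℝ → ℝ}
    (h : IsHamiltonianPath υ a b p q) {t : ℝ} (ht : t ∈ Icc a b) :
    langevinEnergy υ (p t) (q t) = langevinEnergy υ (p a) (q a) := by
  unfold langevinEnergy; rw [h.langevinH_eq ht]

theorem IsSplittingPath.isHamiltonianPath {υ σ τ : ℝ} {w : ℝ≥0 → ℝ} {P₀ Q₀ : ℝ} {P Q : ℕ → ℝ}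
    {barP barQ tildeP tildeQ : ℕ → ℝ → ℝ}
    (h : IsSplittingPath υ σ τ w P₀ Q₀ P Q barP barQ tildeP tildeQ) (n : ℕ) :
    IsHamiltonianPath υ (gridTime τ n) (gridTime τ (n + 1)) (barP n) (barQ n) :=
  ⟨h.barP_ode n, h.barQ_ode n⟩

theorem IsSplittingPath.tildeQ_eq {υ σ τ : ℝ} {w : ℝ≥0 → ℝ} {P₀ Q₀ : ℝ} {P Q : ℕ → ℝ}
    {barP barQ tildeP tildeQ : ℕ → ℝ → ℝ}
    (h : IsSplittingPath υ σ τ w P₀ Q₀ P Q barP barQ tildeP tildeQ) (n : ℕ) {t : ℝ}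
    (ht : t ∈ Icc (gridTime τ n) (gridTime τ (n + 1))) :
    tildeQ n t = Real.exp (-(υ / 2) * (t - gridTime τ n)) * barQ n (gridTime τ (n + 1)) := by
  have h1 := eq_start_of_hasDerivWithinAt_zero
    (f := fun t => tildeQ n t * Real.exp (υ / 2 * (t - gridTime τ n))) (fun t ht => by
      have e1 : HasDerivWithinAt (fun t => Real.exp (υ / 2 * (t - gridTime τ n)))
          (Real.exp (υ / 2 * (t - gridTime τ n)) * (υ / 2 * 1))
          (Icc (gridTime τ n) (gridTime τ (n + 1))) t :=
        (((hasDerivAt_id t).sub_const _).const_mul (υ / 2)).exp.hasDerivWithinAt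
      exact ((h.tildeQ_ode n t ht).mul e1).congr_deriv (by ring)) ht
  simp only [sub_self, mul_zero, Real.exp_zero, mul_one, h.tildeQ_start] at h1
  rw [← h1, mul_left_comm, ← Real.exp_add]
  simp

theorem IsSplittingPath.tildeP_start {υ σ τ : ℝ} {w : ℝ≥0 → ℝ} {P₀ Q₀ : ℝ} {P Q : ℕ → ℝ}
    {barP barQ tildeP tildeQ : ℕ → ℝ → ℝ}
    (h : IsSplittingPath υ σ τ w P₀ Q₀ P Q barP barQ tildeP tildeQ) (n : ℕ)
    (hn : gridTime τ n ≤ gridTime τ (n + 1)) :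
    tildeP n (gridTime τ n) = barP n (gridTime τ (n + 1)) := by
  rw [h.tildeP_sde n _ ⟨le_rfl, hn⟩]; simp

theorem gridTime_nonneg {τ : ℝ} (hτ : 0 ≤ τ) (n : ℕ) : 0 ≤ gridTime τ n := by
  unfold gridTime; positivity

theorem gridTime_succ (τ : ℝ) (n : ℕ) : gridTime τ (n + 1) = gridTime τ n + τ := by
  unfold gridTime; push_cast; ring

theorem gridTime_le_succ {τ : ℝ} (hτ : 0 ≤ τ) (n : ℕ) : gridTime τ n ≤ gridTime τ (n + 1) := by
  rw [gridTime_succ]; linarith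

/-! ### The noise of one step -/

/-- A variable `ξ` of law `γ` that is independent of `m`, paired with an `m`-measurable one. -/
theorem map_prodMk_restrict_eq_prod {Ω β : Type*} {m mΩ : MeasurableSpace Ω} [MeasurableSpace β]
    {μ : Measure Ω} [IsProbabilityMeasure μ] (hm : m ≤ mΩ) {ξ : Ω → ℝ} (hξ : Measurable ξ)
    {γ : Measure ℝ} [IsProbabilityMeasure γ]
    (h : ∀ A, MeasurableSet[m] A → (μ.restrict A).map ξ = μ A • γ)
    {Y : Ω → β} (hY : Measurable[m] Y) {A : Set Ω} (hA : MeasurableSet[m] A) :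
    (μ.restrict A).map (fun ω => (Y ω, ξ ω)) = ((μ.restrict A).map Y).prod γ := by
  have hY' : Measurable Y := hY.mono hm le_rfl
  symm
  refine Measure.prod_eq fun B C hB hC => ?_
  have h1 := congrArg (fun ν => ν C) (h (A ∩ Y ⁻¹' B) (hA.inter (hY hB)))
  simp only [Measure.smul_apply, smul_eq_mul] at h1
  rw [Measure.map_apply hξ hC, Measure.restrict_apply (hξ hC)] at h1
  rw [Measure.map_apply (hY'.prodMk hξ) (hB.prod hC), Measure.map_apply hY' hB,
    Measure.restrict_apply ((hY'.prodMk hξ) (hB.prod hC)), Measure.restrict_apply (hY' hB),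
    inter_comm (Y ⁻¹' B), ← h1]
  congr 1
  ext ω
  simp only [mem_inter_iff, mem_preimage, mem_prod]
  tauto

section Solution

variable {Ω : Type u} {mΩ : MeasurableSpace Ω} {υ σ τ : ℝ} {μ : Measure Ω}
  {𝓕 : Filtration ℝ≥0 mΩ} {W : ℝ≥0 → Ω → ℝ} {P₀ Q₀ : ℝ} {X : SplittingProcess Ω}

/-- The stochastic convolution on the `n`-th interval up to time `t`. -/
noncomputable def SplittingProcess.noise (υ τ : ℝ) (X : SplittingProcess Ω) (n : ℕ) (t : ℝ) (ω : Ω) : ℝ :=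
  X.tildeP n t ω - Real.exp (-(υ / 2) * (t - gridTime τ n)) * X.barP n (gridTime τ (n + 1)) ω

theorem IsSplittingSolution.measurable_barP (h : IsSplittingSolution υ σ τ μ 𝓕 W P₀ Q₀ X) (n : ℕ)
    {t : ℝ} (ht : t ∈ Icc (gridTime τ n) (gridTime τ (n + 1))) : Measurable (X.barP n t) :=
  (h.adapted_barP n t ht).mono (𝓕.le _) le_rfl

theorem IsSplittingSolution.measurable_barQ (h : IsSplittingSolution υ σ τ μ 𝓕 W P₀ Q₀ X) (n : ℕ)
    {t : ℝ} (ht : t ∈ Icc (gridTime τ n) (gridTime τ (n + 1))) : Measurable (X.barQ n t) :=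
  (h.adapted_barQ n t ht).mono (𝓕.le _) le_rfl

theorem IsSplittingSolution.measurable_tildeP (h : IsSplittingSolution υ σ τ μ 𝓕 W P₀ Q₀ X)
    (n : ℕ) {t : ℝ} (ht : t ∈ Icc (gridTime τ n) (gridTime τ (n + 1))) :
    Measurable (X.tildeP n t) :=
  (h.adapted_tildeP n t ht).mono (𝓕.le _) le_rfl

theorem IsSplittingSolution.measurable_tildeQ (h : IsSplittingSolution υ σ τ μ 𝓕 W P₀ Q₀ X)
    (n : ℕ) {t : ℝ} (ht : t ∈ Icc (gridTime τ n) (gridTime τ (n + 1))) :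
    Measurable (X.tildeQ n t) :=
  (h.adapted_tildeQ n t ht).mono (𝓕.le _) le_rfl

theorem IsSplittingSolution.langevinEnergy_bar (h : IsSplittingSolution υ σ τ μ 𝓕 W P₀ Q₀ X)
    (n : ℕ) : ∀ᵐ ω ∂μ, ∀ t ∈ Icc (gridTime τ n) (gridTime τ (n + 1)),
      langevinEnergy υ (X.barP n t ω) (X.barQ n t ω)
        = langevinEnergy υ (X.P n ω) (X.Q n ω) := by
  filter_upwards [h.path] with ω hω t ht
  rw [(hω.isHamiltonianPath n).langevinEnergy_eq ht, hω.barP_start, hω.barQ_start]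

theorem IsSplittingSolution.measurable_noise (h : IsSplittingSolution υ σ τ μ 𝓕 W P₀ Q₀ X)
    (hτ : 0 ≤ τ) (n : ℕ) {t : ℝ} (ht : t ∈ Icc (gridTime τ n) (gridTime τ (n + 1))) :
    Measurable (X.noise υ τ n t) :=
  (h.measurable_tildeP n ht).sub
    ((h.measurable_barP n ⟨gridTime_le_succ hτ n, le_rfl⟩).const_mul _)

variable [IsProbabilityMeasure μ]

theorem IsSplittingSolution.map_restrict_noise (h : IsSplittingSolution υ σ τ μ 𝓕 W P₀ Q₀ X)
    (hW : IsWienerProcess μ 𝓕 W) (hυ : 0 < υ) (hτ : 0 ≤ τ) (n : ℕ) {t : ℝ}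
    (ht : t ∈ Icc (gridTime τ n) (gridTime τ (n + 1))) {A : Set Ω}
    (hA : MeasurableSet[𝓕 (gridTime τ n).toNNReal] A) :
    (μ.restrict A).map (X.noise υ τ n t)
      = μ A • gaussianReal 0 (convolutionVar υ σ (t - gridTime τ n)) := by
  have h1 := hW.map_restrict_stochastic_convolution (k := υ / 2) (σ := σ) (by positivity)
    (gridTime_nonneg hτ n) ht.1 (D := X.tildeP n) (h.measurable_noise hτ n ht) ?_ hA
  · rw [h1, convolutionVar, mul_div_cancel₀ υ (two_ne_zero)]
  · filter_upwards [h.path] with ω hω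
    have hst := hω.tildeP_start n (gridTime_le_succ hτ n)
    have hsub : Icc (gridTime τ n) t ⊆ Icc (gridTime τ n) (gridTime τ (n + 1)) :=
      Icc_subset_Icc_right ht.2
    refine ⟨(hω.tildeP_cont n).mono hsub, fun r hr => ?_, ?_⟩
    · rw [hst]; exact hω.tildeP_sde n r (hsub hr)
    · simp only [SplittingProcess.noise]; rw [hst]

/-- Integrals over one step of the splitting system. -/
theorem IsSplittingSolution.lintegral_tilde (h : IsSplittingSolution υ σ τ μ 𝓕 W P₀ Q₀ X)
    (hW : IsWienerProcess μ 𝓕 W) (hυ : 0 < υ) (hτ : 0 ≤ τ) (n : ℕ) {t : ℝ}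
    (ht : t ∈ Icc (gridTime τ n) (gridTime τ (n + 1))) {f : ℝ × ℝ → ℝ≥0∞} (hf : Measurable f)
    {A : Set Ω} (hA : MeasurableSet[𝓕 (gridTime τ n).toNNReal] A) :
    ∫⁻ ω in A, f (X.tildeP n t ω, X.tildeQ n t ω) ∂μ
      = ∫⁻ ω in A, ∫⁻ w, f (Real.exp (-(υ / 2) * (t - gridTime τ n))
            * X.barP n (gridTime τ (n + 1)) ω + w,
          Real.exp (-(υ / 2) * (t - gridTime τ n)) * X.barQ n (gridTime τ (n + 1)) ω)
        ∂(gaussianReal 0 (convolutionVar υ σ (t - gridTime τ n))) ∂μ := by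
  have hend : gridTime τ (n + 1) ∈ Icc (gridTime τ n) (gridTime τ (n + 1)) :=
    ⟨gridTime_le_succ hτ n, le_rfl⟩
  set a := Real.exp (-(υ / 2) * (t - gridTime τ n)) with ha
  set Y : Ω → ℝ × ℝ := fun ω =>
    (X.barP n (gridTime τ (n + 1)) ω, X.barQ n (gridTime τ (n + 1)) ω) with hYdef
  have hY : Measurable[𝓕 (gridTime τ n).toNNReal] Y :=
    (h.adapted_barP n _ hend).prodMk (h.adapted_barQ n _ hend)
  set F : (ℝ × ℝ) × ℝ → ℝ≥0∞ := fun z => f (a * z.1.1 + z.2, a * z.1.2) with hF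
  have hFm : Measurable F := hf.comp (by fun_prop)
  have hξ := h.measurable_noise hτ n ht
  have hY' : Measurable Y := hY.mono (𝓕.le _) le_rfl
  have e1 : ∫⁻ ω in A, f (X.tildeP n t ω, X.tildeQ n t ω) ∂μ
      = ∫⁻ ω in A, F (Y ω, X.noise υ τ n t ω) ∂μ := by
    refine lintegral_congr_ae (ae_restrict_of_ae ?_)
    filter_upwards [h.path] with ω hω
    simp only [hF, hYdef, SplittingProcess.noise]
    rw [hω.tildeQ_eq n ht, ← ha, add_sub_cancel]
  have e2 := map_prodMk_restrict_eq_prod (𝓕.le _) hξ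
    (fun A hA => h.map_restrict_noise hW hυ hτ n ht hA) hY hA
  rw [e1, ← lintegral_map (μ := μ.restrict A) hFm (hY'.prodMk hξ), e2,
    lintegral_prod _ hFm.aemeasurable, lintegral_map hFm.lintegral_prod_right' hY']

theorem IsSplittingSolution.lintegral_exp_langevinEnergy_tilde_le
    (h : IsSplittingSolution υ σ τ μ 𝓕 W P₀ Q₀ X) (hW : IsWienerProcess μ 𝓕 W) (hυ : 0 < υ)
    (hσ : 0 < σ) (hτ : 0 ≤ τ) (n : ℕ) {t : ℝ}
    (ht : t ∈ Icc (gridTime τ n) (gridTime τ (n + 1))) {θ : ℝ} (hθ : 0 ≤ θ)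
    (hθ1 : θ ≤ υ / (2 * σ ^ 2)) :
    ∫⁻ ω, ENNReal.ofReal (Real.exp (θ * langevinEnergy υ (X.tildeP n t ω) (X.tildeQ n t ω))) ∂μ
      ≤ ∫⁻ ω, ENNReal.ofReal (Real.exp (θ * Real.exp (-(υ / 2) * (t - gridTime τ n))
        * langevinEnergy υ (X.P n ω) (X.Q n ω) + θ * ((υ ^ 4 / 8 + 2 * σ ^ 2 / υ)
          * (1 - Real.exp (-(υ / 2) * (t - gridTime τ n)) ^ 2)))) ∂μ := by
  have hm := measurable_langevinEnergy υ
  have h1 := h.lintegral_tilde hW hυ hτ n ht (A := univ)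
    (f := fun x => ENNReal.ofReal (Real.exp (θ * langevinEnergy υ x.1 x.2))) (by fun_prop)
    MeasurableSet.univ
  simp only [Measure.restrict_univ] at h1
  rw [h1]
  refine lintegral_mono_ae ?_
  filter_upwards [h.langevinEnergy_bar n] with ω hω
  rw [← hω _ ⟨gridTime_le_succ hτ n, le_rfl⟩]
  exact lintegral_exp_langevinEnergy_step_le_of_le hυ hσ (by linarith [ht.1]) hθ hθ1 _ _

/-- Exponential moments of the energy, uniformly in time, for small parameters. -/
theorem IsSplittingSolution.lintegral_exp_langevinEnergy_le
    (h : IsSplittingSolution υ σ τ μ 𝓕 W P₀ Q₀ X) (hW : IsWienerProcess μ 𝓕 W) (hυ : 0 < υ)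
    (hσ : 0 < σ) (hτ : 0 ≤ τ) (n : ℕ) {θ : ℝ} (hθ : 0 ≤ θ) (hθ1 : θ ≤ υ / (2 * σ ^ 2)) :
    ∫⁻ ω, ENNReal.ofReal (Real.exp (θ * langevinEnergy υ (X.P n ω) (X.Q n ω))) ∂μ
      ≤ ENNReal.ofReal (Real.exp (θ * (langevinEnergy υ P₀ Q₀
        + 2 * (υ ^ 4 / 8 + 2 * σ ^ 2 / υ)))) ∧
    ∀ t ∈ Icc (gridTime τ n) (gridTime τ (n + 1)),
      ∫⁻ ω, ENNReal.ofReal (Real.exp (θ * langevinEnergy υ (X.tildeP n t ω) (X.tildeQ n t ω))) ∂μ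
      ≤ ENNReal.ofReal (Real.exp (θ * (langevinEnergy υ P₀ Q₀
        + 2 * (υ ^ 4 / 8 + 2 * σ ^ 2 / υ)))) := by
  set C := υ ^ 4 / 8 + 2 * σ ^ 2 / υ with hC
  have hC0 : 0 ≤ C := by positivity
  have hE0 := langevinEnergy_nonneg υ P₀ Q₀
  -- The induction hypothesis must hold for all admissible parameters at once, because one step
  -- replaces `θ` by the smaller `θ a`.
  have key : ∀ n, (∀ θ, 0 ≤ θ → θ ≤ υ / (2 * σ ^ 2) →
      ∫⁻ ω, ENNReal.ofReal (Real.exp (θ * langevinEnergy υ (X.P n ω) (X.Q n ω))) ∂μ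
        ≤ ENNReal.ofReal (Real.exp (θ * (langevinEnergy υ P₀ Q₀ + 2 * C)))) →
      ∀ θ, 0 ≤ θ → θ ≤ υ / (2 * σ ^ 2) → ∀ t ∈ Icc (gridTime τ n) (gridTime τ (n + 1)),
      ∫⁻ ω, ENNReal.ofReal (Real.exp (θ * langevinEnergy υ (X.tildeP n t ω) (X.tildeQ n t ω))) ∂μ
        ≤ ENNReal.ofReal (Real.exp (θ * (langevinEnergy υ P₀ Q₀ + 2 * C))) := by
    intro n ih θ hθ hθ1 t ht
    refine (h.lintegral_exp_langevinEnergy_tilde_le hW hυ hσ hτ n ht hθ hθ1).trans ?_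
    rw [← hC]
    set a := Real.exp (-(υ / 2) * (t - gridTime τ n)) with ha
    have ha0 : 0 < a := Real.exp_pos _
    have ha1 : a ≤ 1 := Real.exp_le_one_iff.2 (by nlinarith [ht.1])
    have hPm : Measurable (X.P n) := (h.adapted_P n).mono (𝓕.le _) le_rfl
    have hQm : Measurable (X.Q n) := (h.adapted_Q n).mono (𝓕.le _) le_rfl
    have hEm : Measurable fun ω => langevinEnergy υ (X.P n ω) (X.Q n ω) :=
      (measurable_langevinEnergy υ).comp (hPm.prodMk hQm)
    have e1 : ∀ ω, ENNReal.ofReal (Real.exp (θ * a * langevinEnergy υ (X.P n ω) (X.Q n ω)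
        + θ * (C * (1 - a ^ 2))))
        = ENNReal.ofReal (Real.exp (θ * (C * (1 - a ^ 2)))) *
          ENNReal.ofReal (Real.exp (θ * a * langevinEnergy υ (X.P n ω) (X.Q n ω))) := by
      intro ω
      rw [← ENNReal.ofReal_mul (by positivity), ← Real.exp_add, add_comm]
    rw [lintegral_congr e1, lintegral_const_mul _ (by fun_prop)]
    have hle : θ * a ≤ θ := by nlinarith
    refine (mul_le_mul_right (ih (θ * a) (by positivity) (hle.trans hθ1)) _).trans ?_
    rw [← ENNReal.ofReal_mul (by positivity), ← Real.exp_add]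
    refine ENNReal.ofReal_le_ofReal (Real.exp_le_exp.2 ?_)
    rw [mul_assoc, ← mul_add]
    refine mul_le_mul_of_nonneg_left ?_ hθ
    -- The factor `2` in `2 * C` is chosen for this: `2 a C + C (1 - a ^ 2) = 2 C - C (1 - a) ^ 2 ≤
    -- 2 C`.
    nlinarith [mul_nonneg hC0 (sq_nonneg (1 - a))]
  have main : ∀ n, ∀ θ, 0 ≤ θ → θ ≤ υ / (2 * σ ^ 2) →
      ∫⁻ ω, ENNReal.ofReal (Real.exp (θ * langevinEnergy υ (X.P n ω) (X.Q n ω))) ∂μ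
        ≤ ENNReal.ofReal (Real.exp (θ * (langevinEnergy υ P₀ Q₀ + 2 * C))) := by
    intro n
    induction n with
    | zero =>
      intro θ hθ _
      calc ∫⁻ ω, ENNReal.ofReal (Real.exp (θ * langevinEnergy υ (X.P 0 ω) (X.Q 0 ω))) ∂μ
          = ∫⁻ _, ENNReal.ofReal (Real.exp (θ * langevinEnergy υ P₀ Q₀)) ∂μ := by
            refine lintegral_congr_ae ?_
            filter_upwards [h.path] with ω hω
            rw [hω.initP, hω.initQ]
        _ = ENNReal.ofReal (Real.exp (θ * langevinEnergy υ P₀ Q₀)) := by simp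
        _ ≤ _ := by
          refine ENNReal.ofReal_le_ofReal (Real.exp_le_exp.2 ?_)
          refine mul_le_mul_of_nonneg_left ?_ hθ
          linarith
    | succ n ih =>
      intro θ hθ hθ1
      refine le_trans (le_of_eq ?_) (key n ih θ hθ hθ1 (gridTime τ (n + 1))
        ⟨gridTime_le_succ hτ n, le_rfl⟩)
      refine lintegral_congr_ae ?_
      filter_upwards [h.path] with ω hω
      rw [hω.stepP, hω.stepQ]
  exact ⟨main n θ hθ hθ1, key n (main n) θ hθ hθ1⟩

/-- The parameters `exp(-σ ^ 2 t_n)` decrease by exactly the factor `exp(-σ ^ 2 τ)` that a step can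
cost, so the induction needs no smallness of `σ` or `τ`. -/
theorem IsSplittingSolution.lintegral_exp_langevinEnergy_div_le
    (h : IsSplittingSolution υ σ τ μ 𝓕 W P₀ Q₀ X) (hW : IsWienerProcess μ 𝓕 W) (hυ : 0 < υ)
    (hτ : 0 ≤ τ) (n : ℕ) :
    ∫⁻ ω, ENNReal.ofReal (Real.exp (Real.exp (-(σ ^ 2 * gridTime τ n))
        * langevinEnergy υ (X.P n ω) (X.Q n ω))) ∂μ
      ≤ ENNReal.ofReal (Real.exp (langevinEnergy υ P₀ Q₀
        + (υ ^ 5 / 8 + σ ^ 2) * gridTime τ n)) := by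
  induction n with
  | zero =>
    calc _ = ∫⁻ _, ENNReal.ofReal (Real.exp (langevinEnergy υ P₀ Q₀)) ∂μ := by
            refine lintegral_congr_ae ?_
            filter_upwards [h.path] with ω hω
            simp [hω.initP, hω.initQ, gridTime]
      _ ≤ _ := by simp [gridTime]
  | succ n ih =>
    have hend : gridTime τ (n + 1) ∈ Icc (gridTime τ n) (gridTime τ (n + 1)) :=
      ⟨gridTime_le_succ hτ n, le_rfl⟩
    have hPm : Measurable (X.P n) := (h.adapted_P n).mono (𝓕.le _) le_rfl
    have hQm : Measurable (X.Q n) := (h.adapted_Q n).mono (𝓕.le _) le_rfl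
    have hEm : Measurable fun ω => langevinEnergy υ (X.P n ω) (X.Q n ω) :=
      (measurable_langevinEnergy υ).comp (hPm.prodMk hQm)
    have hm := measurable_langevinEnergy υ
    set θ := Real.exp (-(σ ^ 2 * gridTime τ (n + 1))) with hθ
    have hθn : θ * Real.exp (σ ^ 2 * τ) = Real.exp (-(σ ^ 2 * gridTime τ n)) := by
      rw [hθ, ← Real.exp_add, gridTime_succ]; congr 1; ring
    have hθ1 : θ ≤ Real.exp (-(σ ^ 2 * τ)) := by
      refine Real.exp_le_exp.2 ?_
      have := mul_nonneg (sq_nonneg σ) (gridTime_nonneg hτ n)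
      rw [gridTime_succ]; nlinarith
    have e0 : gridTime τ (n + 1) - gridTime τ n = τ := by rw [gridTime_succ]; ring
    have h1 := h.lintegral_tilde hW hυ hτ n hend (A := univ)
      (f := fun x => ENNReal.ofReal (Real.exp (θ * langevinEnergy υ x.1 x.2))) (by fun_prop)
      MeasurableSet.univ
    simp only [Measure.restrict_univ, e0] at h1
    calc _ = ∫⁻ ω, ENNReal.ofReal (Real.exp (θ * langevinEnergy υ (X.tildeP n (gridTime τ (n + 1)) ω)
            (X.tildeQ n (gridTime τ (n + 1)) ω))) ∂μ := by
          refine lintegral_congr_ae ?_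
          filter_upwards [h.path] with ω hω
          rw [hω.stepP, hω.stepQ]
      _ ≤ ∫⁻ ω, ENNReal.ofReal (Real.exp ((υ ^ 5 / 8 + σ ^ 2) * τ)) * ENNReal.ofReal (Real.exp
            (Real.exp (-(σ ^ 2 * gridTime τ n)) * langevinEnergy υ (X.P n ω) (X.Q n ω))) ∂μ := by
          rw [h1]
          refine lintegral_mono_ae ?_
          filter_upwards [h.langevinEnergy_bar n] with ω hω
          rw [← hω _ hend, ← hθn]
          exact lintegral_exp_langevinEnergy_step_le_exp_mul hυ hτ (Real.exp_pos _).le hθ1 _ _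
      _ ≤ _ := by
          rw [lintegral_const_mul _ (by fun_prop)]
          refine (mul_le_mul_right ih _).trans ?_
          rw [← ENNReal.ofReal_mul (by positivity), ← Real.exp_add]
          refine ENNReal.ofReal_le_ofReal (Real.exp_le_exp.2 ?_)
          rw [gridTime_succ]; linarith

end Solution

/-! ### Moments and exponential integrability -/

/-- Powers of `θ y ≥ 1` are bounded by the `⌈p⌉`-th term of the exponential series. The explicit
factor `θ ^ (-p)` matters, as `θ` will depend on the initial energy. -/
theorem rpow_le_mul_exp {p : ℝ} (hp : 0 ≤ p) {θ y : ℝ} (hθ : 0 < θ) (hy : 0 ≤ y) :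
    y ^ p ≤ θ ^ (-p) * (1 + (⌈p⌉₊.factorial : ℝ)) * Real.exp (θ * y) := by
  have hz : 0 ≤ θ * y := by positivity
  have h1 : (θ * y) ^ p ≤ (1 + (⌈p⌉₊.factorial : ℝ)) * Real.exp (θ * y) := by
    have he : (1 : ℝ) ≤ Real.exp (θ * y) := Real.one_le_exp hz
    have hf : (0 : ℝ) < (⌈p⌉₊.factorial : ℝ) := by positivity
    rcases le_total (θ * y) 1 with h | h
    · have := Real.rpow_le_one hz h hp
      nlinarith
    · have h2 : (θ * y) ^ p ≤ (θ * y) ^ (⌈p⌉₊ : ℝ) :=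
        Real.rpow_le_rpow_of_exponent_le h (Nat.le_ceil p)
      rw [Real.rpow_natCast] at h2
      have h3 := Real.pow_div_factorial_le_exp (θ * y) hz ⌈p⌉₊
      rw [div_le_iff₀ hf] at h3
      nlinarith
  have h4 : y ^ p = θ ^ (-p) * (θ * y) ^ p := by
    rw [Real.mul_rpow hθ.le hy, ← mul_assoc, ← Real.rpow_add hθ]; simp
  rw [h4, mul_assoc]
  exact mul_le_mul_of_nonneg_left h1 (by positivity)

theorem integrable_and_integral_le_of_lintegral_le {Ω : Type*} {mΩ : MeasurableSpace Ω}
    {μ : Measure Ω} {f : Ω → ℝ} (hf : Measurable f) (hf0 : ∀ ω, 0 ≤ f ω) {c : ℝ} (hc : 0 ≤ c)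
    (h : ∫⁻ ω, ENNReal.ofReal (f ω) ∂μ ≤ ENNReal.ofReal c) :
    Integrable f μ ∧ ∫ ω, f ω ∂μ ≤ c := by
  refine ⟨(lintegral_ofReal_ne_top_iff_integrable hf.aestronglyMeasurable
    (Eventually.of_forall hf0)).1 (h.trans_lt ENNReal.ofReal_lt_top).ne, ?_⟩
  rw [integral_eq_lintegral_of_nonneg_ae (Eventually.of_forall hf0) hf.aestronglyMeasurable]
  exact ENNReal.toReal_le_of_le_ofReal hc h

theorem rpow_abs_add_rpow_abs_le (υ : ℝ) {r : ℝ} (hr : 0 ≤ r) (p q : ℝ) :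
    |p| ^ (2 * r) + |q| ^ (4 * r) ≤ 2 * 8 ^ r * langevinEnergy υ p q ^ r := by
  have hE := le_langevinEnergy υ p q
  have h1 : |p| ^ (2 * r) ≤ (8 * langevinEnergy υ p q) ^ r := by
    rw [Real.rpow_mul (abs_nonneg p)]
    refine Real.rpow_le_rpow (by positivity) ?_ hr
    norm_cast
    rw [sq_abs]
    nlinarith [sq_nonneg p, sq_nonneg (q ^ 2)]
  have h2 : |q| ^ (4 * r) ≤ (8 * langevinEnergy υ p q) ^ r := by
    rw [Real.rpow_mul (abs_nonneg q)]
    refine Real.rpow_le_rpow (by positivity) ?_ hr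
    have : |q| ^ (4 : ℝ) = q ^ 4 := by
      have : |q| ^ (4 : ℝ) = |q| ^ (4 : ℕ) := by norm_cast
      rw [this, Even.pow_abs (by decide)]
    rw [this]
    nlinarith [sq_nonneg p, sq_nonneg (q ^ 2)]
  rw [Real.mul_rpow (by norm_num) (langevinEnergy_nonneg υ p q)] at h1 h2
  linarith

set_option maxHeartbeats 1000000 in
-- Exponential moments imply polynomial ones, and no separate recursion for powers of the energy is
-- needed. The bound is homogeneous of the right degree only because the parameter `θ` is adapted to
-- the initial energy.
theorem IsSplittingSolution.moments_le {υ σ : ℝ} (hυ : 0 < υ) (hσ : 0 < σ) (r : ℝ) (hr : 1 ≤ r) :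
    ∃ C : ℝ, 0 < C ∧ ∀ τ ∈ Ioo (0 : ℝ) 1,
      ∀ {Ω : Type u} {mΩ : MeasurableSpace Ω} (μ : Measure Ω) [IsProbabilityMeasure μ]
        (𝓕 : Filtration ℝ≥0 mΩ) (W : ℝ≥0 → Ω → ℝ), IsWienerProcess μ 𝓕 W →
      ∀ (P₀ Q₀ : ℝ) (X : SplittingProcess Ω), IsSplittingSolution υ σ τ μ 𝓕 W P₀ Q₀ X →
      ∀ n : ℕ, ∀ t ∈ Ico (gridTime τ n) (gridTime τ (n + 1)),
        Integrable (fun ω => |X.barP n t ω| ^ (2 * r) + |X.barQ n t ω| ^ (4 * r)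
          + |X.tildeP n t ω| ^ (2 * r) + |X.tildeQ n t ω| ^ (4 * r)) μ ∧
        ∫ ω, (|X.barP n t ω| ^ (2 * r) + |X.barQ n t ω| ^ (4 * r)
          + |X.tildeP n t ω| ^ (2 * r) + |X.tildeQ n t ω| ^ (4 * r)) ∂μ
          ≤ C * (1 + |langevinH υ P₀ Q₀| ^ r) := by
  have hr0 : 0 ≤ r := by linarith
  set θ₀ := υ / (2 * σ ^ 2) with hθ₀
  have hθ₀0 : 0 < θ₀ := by positivity
  set D := υ ^ 4 / 8 + 2 * σ ^ 2 / υ with hD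
  have hD0 : 0 < D := by positivity
  set K : ℝ := 1 + (⌈r⌉₊.factorial : ℝ) with hK
  have hK0 : 0 < K := by positivity
  set B : ℝ := 2 * 8 ^ r * K with hB
  set c₁ : ℝ := 1 + υ ^ 4 / 8 with hc₁
  have hc₁1 : 1 ≤ c₁ := by rw [hc₁]; linarith [show 0 ≤ υ ^ 4 / 8 by positivity]
  refine ⟨B * (2 * Real.exp (θ₀ * (1 + 2 * D))) * (θ₀ ^ (-r) * (2 ^ r * c₁ ^ r)), by positivity, ?_⟩
  intro τ hτ Ω mΩ μ _ 𝓕 W hW P₀ Q₀ X hX n t ht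
  have ht' := Ico_subset_Icc_self ht
  set E₀ := langevinEnergy υ P₀ Q₀ with hE₀
  have hE₀0 : 0 ≤ E₀ := langevinEnergy_nonneg υ P₀ Q₀
  -- With this choice the exponential moment is bounded by a constant free of `E₀`, while the
  -- prefactor `θ ^ (-r)` grows like `(1 + E₀) ^ r`.
  set θ := θ₀ / (1 + E₀) with hθ
  have hθ0 : 0 < θ := by positivity
  have hθ1 : θ ≤ θ₀ := div_le_self hθ₀0.le (by linarith)
  have hbP := hX.measurable_barP n ht'
  have hbQ := hX.measurable_barQ n ht'
  have htP := hX.measurable_tildeP n ht'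
  have htQ := hX.measurable_tildeQ n ht'
  have hmE := measurable_langevinEnergy υ
  have hEb : Measurable fun ω => langevinEnergy υ (X.barP n t ω) (X.barQ n t ω) :=
    hmE.comp (hbP.prodMk hbQ)
  have hEt : Measurable fun ω => langevinEnergy υ (X.tildeP n t ω) (X.tildeQ n t ω) :=
    hmE.comp (htP.prodMk htQ)
  obtain ⟨h1, h2⟩ := hX.lintegral_exp_langevinEnergy_le hW hυ hσ hτ.1.le n hθ0.le hθ1
  have h2 := h2 t ht'
  have h3 : ∫⁻ ω, ENNReal.ofReal (Real.exp (θ * langevinEnergy υ (X.barP n t ω)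
      (X.barQ n t ω))) ∂μ ≤ ENNReal.ofReal (Real.exp (θ * (E₀ + 2 * D))) := by
    refine le_trans (le_of_eq (lintegral_congr_ae ?_)) h1
    filter_upwards [hX.langevinEnergy_bar n] with ω hω
    rw [hω t ht']
  have hθE : θ * (E₀ + 2 * D) ≤ θ₀ * (1 + 2 * D) := by
    rw [hθ, div_mul_eq_mul_div, div_le_iff₀ (by positivity), mul_assoc]
    refine mul_le_mul_of_nonneg_left ?_ hθ₀0.le
    nlinarith [mul_nonneg hD0.le hE₀0]
  have hexp := ENNReal.ofReal_le_ofReal (Real.exp_le_exp.2 hθE)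
  have hpt : ∀ ω, |X.barP n t ω| ^ (2 * r) + |X.barQ n t ω| ^ (4 * r)
      + |X.tildeP n t ω| ^ (2 * r) + |X.tildeQ n t ω| ^ (4 * r)
      ≤ B * θ ^ (-r) * (Real.exp (θ * langevinEnergy υ (X.barP n t ω) (X.barQ n t ω))
        + Real.exp (θ * langevinEnergy υ (X.tildeP n t ω) (X.tildeQ n t ω))) := by
    intro ω
    have a1 := rpow_abs_add_rpow_abs_le υ hr0 (X.barP n t ω) (X.barQ n t ω)
    have a2 := rpow_abs_add_rpow_abs_le υ hr0 (X.tildeP n t ω) (X.tildeQ n t ω)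
    have a3 := rpow_le_mul_exp hr0 hθ0 (langevinEnergy_nonneg υ (X.barP n t ω) (X.barQ n t ω))
    have a4 := rpow_le_mul_exp hr0 hθ0
      (langevinEnergy_nonneg υ (X.tildeP n t ω) (X.tildeQ n t ω))
    have h8 : (0 : ℝ) ≤ 2 * 8 ^ r := by positivity
    have a5 := mul_le_mul_of_nonneg_left a3 h8
    have a6 := mul_le_mul_of_nonneg_left a4 h8
    rw [hB]
    linarith
  have hconst : θ ^ (-r) ≤ θ₀ ^ (-r) * (2 ^ r * c₁ ^ r) * (1 + |langevinH υ P₀ Q₀| ^ r) := by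
    have b1 : θ ^ (-r) = θ₀ ^ (-r) * (1 + E₀) ^ r := by
      rw [hθ, Real.div_rpow hθ₀0.le (by positivity), Real.rpow_neg (by positivity : 0 ≤ 1 + E₀),
        div_inv_eq_mul]
    set h := |langevinH υ P₀ Q₀| with hh
    have hh0 : 0 ≤ h := abs_nonneg _
    have b2 : 1 + E₀ ≤ c₁ + h := by
      have := le_abs_self (langevinH υ P₀ Q₀)
      rw [hE₀, langevinEnergy, hc₁, hh]; linarith
    have b3 : (1 + E₀) ^ r ≤ 2 ^ r * c₁ ^ r * (1 + h ^ r) := by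
      have b4 : (1 : ℝ) ≤ c₁ ^ r := Real.one_le_rpow hc₁1 hr0
      have b5 : 0 ≤ h ^ r := by positivity
      have b6 : 1 + E₀ ≤ 2 * max c₁ h := by linarith [le_max_left c₁ h, le_max_right c₁ h]
      refine (Real.rpow_le_rpow (by positivity) b6 hr0).trans ?_
      rw [Real.mul_rpow two_pos.le (by positivity), mul_assoc]
      refine mul_le_mul_of_nonneg_left ?_ (by positivity)
      rcases max_choice c₁ h with b7 | b7 <;> rw [b7] <;> nlinarith
    rw [b1, mul_assoc]
    exact mul_le_mul_of_nonneg_left b3 (by positivity)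
  have hres : ∫⁻ ω, ENNReal.ofReal (|X.barP n t ω| ^ (2 * r) + |X.barQ n t ω| ^ (4 * r)
      + |X.tildeP n t ω| ^ (2 * r) + |X.tildeQ n t ω| ^ (4 * r)) ∂μ
      ≤ ENNReal.ofReal (B * θ ^ (-r) * (2 * Real.exp (θ₀ * (1 + 2 * D)))) := by
    calc _ ≤ ∫⁻ ω, ENNReal.ofReal (B * θ ^ (-r)) *
          (ENNReal.ofReal (Real.exp (θ * langevinEnergy υ (X.barP n t ω) (X.barQ n t ω)))
          + ENNReal.ofReal (Real.exp (θ * langevinEnergy υ (X.tildeP n t ω)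
            (X.tildeQ n t ω)))) ∂μ := by
          refine lintegral_mono fun ω => ?_
          rw [← ENNReal.ofReal_add (by positivity) (by positivity),
            ← ENNReal.ofReal_mul (by positivity)]
          exact ENNReal.ofReal_le_ofReal (hpt ω)
      _ ≤ ENNReal.ofReal (B * θ ^ (-r)) * (ENNReal.ofReal (Real.exp (θ₀ * (1 + 2 * D)))
          + ENNReal.ofReal (Real.exp (θ₀ * (1 + 2 * D)))) := by
          rw [lintegral_const_mul _ (by fun_prop), lintegral_add_left (by fun_prop)]
          gcongr
          · exact h3.trans hexp
          · exact h2.trans hexp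
      _ = _ := by
          rw [← ENNReal.ofReal_add (by positivity) (by positivity),
            ← ENNReal.ofReal_mul (by positivity), ← two_mul]
  obtain ⟨g1, g2⟩ := integrable_and_integral_le_of_lintegral_le
    (by fun_prop) (fun ω => by positivity) (by positivity) hres
  refine ⟨g1, g2.trans ?_⟩
  have := mul_le_mul_of_nonneg_left hconst
    (show 0 ≤ B * (2 * Real.exp (θ₀ * (1 + 2 * D))) by positivity)
  linarith

theorem IsSplittingSolution.exp_langevinH_le {υ σ : ℝ} (hυ : 0 < υ) (hσ : 0 < σ) :
    ∃ C : ℝ, 0 < C ∧ ∀ τ ∈ Ioo (0 : ℝ) 1,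
      ∀ {Ω : Type u} {mΩ : MeasurableSpace Ω} (μ : Measure Ω) [IsProbabilityMeasure μ]
        (𝓕 : Filtration ℝ≥0 mΩ) (W : ℝ≥0 → Ω → ℝ), IsWienerProcess μ 𝓕 W →
      ∀ (P₀ Q₀ : ℝ) (X : SplittingProcess Ω), IsSplittingSolution υ σ τ μ 𝓕 W P₀ Q₀ X →
      ∀ n : ℕ,
        Integrable (fun ω => Real.exp
          (langevinH υ (X.P n ω) (X.Q n ω) / Real.exp (σ ^ 2 * gridTime τ n))) μ ∧
        ∫ ω, Real.exp
          (langevinH υ (X.P n ω) (X.Q n ω) / Real.exp (σ ^ 2 * gridTime τ n)) ∂μ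
          ≤ Real.exp (langevinH υ P₀ Q₀ + C * gridTime τ n) := by
  -- The last summand pays for returning from the energy to `H`: the shifts differ by `(1 - e^{-σ ^
  -- 2 t_n}) υ ^ 4 / 8 ≤ σ ^ 2 t_n υ ^ 4 / 8`.
  refine ⟨υ ^ 5 / 8 + σ ^ 2 + υ ^ 4 / 8 * σ ^ 2, by positivity, ?_⟩
  intro τ hτ Ω mΩ μ _ 𝓕 W hW P₀ Q₀ X hX n
  have hPm : Measurable (X.P n) := (hX.adapted_P n).mono (𝓕.le _) le_rfl
  have hQm : Measurable (X.Q n) := (hX.adapted_Q n).mono (𝓕.le _) le_rfl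
  have hEm : Measurable fun ω => langevinEnergy υ (X.P n ω) (X.Q n ω) :=
    (measurable_langevinEnergy υ).comp (hPm.prodMk hQm)
  have hHm : Measurable fun ω => langevinH υ (X.P n ω) (X.Q n ω) := by
    have : ∀ ω, langevinH υ (X.P n ω) (X.Q n ω)
        = langevinEnergy υ (X.P n ω) (X.Q n ω) - υ ^ 4 / 8 := fun ω => by
      simp [langevinEnergy]
    simp only [this]
    exact hEm.sub_const _
  have ht := gridTime_nonneg hτ.1.le n
  have h1 := hX.lintegral_exp_langevinEnergy_div_le hW hυ hτ.1.le n
  set θ := Real.exp (-(σ ^ 2 * gridTime τ n)) with hθ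
  have hpt : ∀ ω, Real.exp (langevinH υ (X.P n ω) (X.Q n ω) / Real.exp (σ ^ 2 * gridTime τ n))
      = Real.exp (-(θ * (υ ^ 4 / 8)))
        * Real.exp (θ * langevinEnergy υ (X.P n ω) (X.Q n ω)) := by
    intro ω
    rw [← Real.exp_add, div_eq_mul_inv, ← Real.exp_neg, langevinEnergy]
    congr 1; ring
  refine integrable_and_integral_le_of_lintegral_le (by fun_prop) (fun ω => by positivity)
    (by positivity) ?_
  have h2 : ∀ ω, ENNReal.ofReal (Real.exp (langevinH υ (X.P n ω) (X.Q n ω)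
      / Real.exp (σ ^ 2 * gridTime τ n))) = ENNReal.ofReal (Real.exp (-(θ * (υ ^ 4 / 8))))
      * ENNReal.ofReal (Real.exp (θ * langevinEnergy υ (X.P n ω) (X.Q n ω))) := fun ω => by
    rw [hpt, ENNReal.ofReal_mul (by positivity)]
  rw [lintegral_congr h2, lintegral_const_mul _ (by fun_prop)]
  refine (mul_le_mul_right h1 _).trans ?_
  rw [← ENNReal.ofReal_mul (by positivity), ← Real.exp_add]
  refine ENNReal.ofReal_le_ofReal (Real.exp_le_exp.2 ?_)
  have h3 := Real.add_one_le_exp (-(σ ^ 2 * gridTime τ n))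
  have h4 : 0 ≤ υ ^ 4 / 8 := by positivity
  have h5 := mul_le_mul_of_nonneg_left h3 h4
  rw [langevinEnergy]
  nlinarith

/-! ### Harris' theorem -/

section Harris

variable {α : Type*} [MeasurableSpace α]

instance isMarkovKernel_pow (κ : Kernel α α) [IsMarkovKernel κ] (n : ℕ) :
    IsMarkovKernel (κ ^ n) := by
  induction n with
  | zero => rw [pow_zero]; exact inferInstanceAs (IsMarkovKernel Kernel.id)
  | succ n ih => rw [pow_succ]; exact inferInstanceAs (IsMarkovKernel ((κ ^ n) ∘ₖ κ))

theorem integrable_of_abs_le {μ : Measure α} [IsFiniteMeasure μ] {φ : α → ℝ} (hφ : Measurable φ)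
    {M : ℝ} (hM : ∀ x, |φ x| ≤ M) : Integrable φ μ :=
  Integrable.of_bound hφ.aestronglyMeasurable M (Eventually.of_forall hM)

theorem abs_integral_le_of_abs_le {μ : Measure α} [IsProbabilityMeasure μ] {φ : α → ℝ}
    {M : ℝ} (hM : ∀ x, |φ x| ≤ M) : |∫ x, φ x ∂μ| ≤ M := by
  have := norm_integral_le_of_norm_le_const (μ := μ) (f := φ) (Eventually.of_forall hM)
  simpa using this

theorem measurable_integral_kernel {κ : Kernel α α} [IsMarkovKernel κ] {φ : α → ℝ}
    (hφ : Measurable φ) : Measurable fun x => ∫ y, φ y ∂(κ x) :=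
  (hφ.stronglyMeasurable.integral_kernel (κ := κ)).measurable

theorem integral_pow_add (κ : Kernel α α) [IsMarkovKernel κ] {φ : α → ℝ} (hφ : Measurable φ)
    {M : ℝ} (hM : ∀ x, |φ x| ≤ M) (m n : ℕ) (x : α) :
    ∫ y, φ y ∂((κ ^ (m + n)) x) = ∫ z, ∫ y, φ y ∂((κ ^ m) z) ∂((κ ^ n) x) := by
  rw [Kernel.pow_add]
  exact Kernel.integral_comp (integrable_of_abs_le hφ hM)

theorem lintegral_pow_succ (κ : Kernel α α) [IsMarkovKernel κ] {f : α → ℝ≥0∞} (hf : Measurable f)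
    (n : ℕ) (x : α) :
    ∫⁻ y, f y ∂((κ ^ (n + 1)) x) = ∫⁻ z, ∫⁻ y, f y ∂(κ z) ∂((κ ^ n) x) := by
  rw [pow_succ']
  exact Kernel.lintegral_comp _ _ _ hf

theorem lintegral_pow_le_of_drift {κ : Kernel α α} [IsMarkovKernel κ] {V : α → ℝ}
    (hV : Measurable V) (hV0 : ∀ x, 0 ≤ V x) {γ K : ℝ} (hγ0 : 0 ≤ γ) (hγ1 : γ < 1) (hK : 0 ≤ K)
    (hd : ∀ x, ∫⁻ y, ENNReal.ofReal (V y) ∂(κ x) ≤ ENNReal.ofReal (γ * V x + K)) (n : ℕ) (x : α) :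
    ∫⁻ y, ENNReal.ofReal (V y) ∂((κ ^ n) x) ≤ ENNReal.ofReal (γ ^ n * V x + K / (1 - γ)) := by
  have h1 : 0 < 1 - γ := by linarith
  induction n with
  | zero =>
    rw [pow_zero]
    change ∫⁻ y, ENNReal.ofReal (V y) ∂(Kernel.id x) ≤ _
    rw [Kernel.id_apply, lintegral_dirac' _ (by fun_prop)]
    refine ENNReal.ofReal_le_ofReal ?_
    have : 0 ≤ K / (1 - γ) := by positivity
    simpa
  | succ n ih =>
    rw [lintegral_pow_succ κ (by fun_prop)]
    calc _ ≤ ∫⁻ z, (ENNReal.ofReal γ * ENNReal.ofReal (V z) + ENNReal.ofReal K) ∂((κ ^ n) x) := by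
          refine lintegral_mono fun z => (hd z).trans (le_of_eq ?_)
          rw [ENNReal.ofReal_add (mul_nonneg hγ0 (hV0 z)) hK, ENNReal.ofReal_mul hγ0]
      _ = ENNReal.ofReal γ * ∫⁻ z, ENNReal.ofReal (V z) ∂((κ ^ n) x) + ENNReal.ofReal K := by
          rw [lintegral_add_right _ measurable_const, lintegral_const_mul _ (by fun_prop)]
          simp
      _ ≤ ENNReal.ofReal γ * ENNReal.ofReal (γ ^ n * V x + K / (1 - γ)) + ENNReal.ofReal K := by
          gcongr
      _ = _ := by
          have h2 : 0 ≤ γ ^ n * V x + K / (1 - γ) := by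
            have := hV0 x
            positivity
          rw [← ENNReal.ofReal_mul hγ0, ← ENNReal.ofReal_add (by positivity) hK]
          congr 1
          field_simp
          ring

set_option maxHeartbeats 400000 in
/-- The contraction estimate of Hairer and Mattingly: a drift and a minorization condition make a
Markov kernel contract a weighted oscillation seminorm. -/
theorem exists_contraction_of_drift_of_minorization {η : Kernel α α} [IsMarkovKernel η]
    {V : α → ℝ} (hV : Measurable V) (hV0 : ∀ x, 0 ≤ V x) {γ γ₀ K R c : ℝ} (hγ0 : 0 ≤ γ)
    (hγ1 : γ < γ₀) (hγ₀ : γ₀ < 1) (hK : 0 ≤ K) (hR0 : 0 < R) (hR : 2 * K ≤ (γ₀ - γ) * R)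
    (hc : 0 < c) (hc1 : c ≤ 1)
    (hd : ∀ x, ∫⁻ y, ENNReal.ofReal (V y) ∂(η x) ≤ ENNReal.ofReal (γ * V x + K))
    {ν : Measure α} [IsProbabilityMeasure ν]
    (hν : ∀ x, V x ≤ R → ENNReal.ofReal c • ν ≤ η x) :
    ∃ a β : ℝ, 0 ≤ a ∧ a < 1 ∧ 0 < β ∧ ∀ (φ : α → ℝ) (M L : ℝ), Measurable φ → (∀ x, |φ x| ≤ M) →
      0 ≤ L → (∀ x y, |φ x - φ y| ≤ L * (2 + β * V x + β * V y)) →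
      ∀ x y, |(∫ z, φ z ∂(η x)) - ∫ z, φ z ∂(η y)| ≤ a * L * (2 + β * V x + β * V y) := by
  -- The weight `β` is small enough that the drift constant `2 β K` uses at most half of the gain `2
  -- c` from minorization.
  set β : ℝ := c / (2 * (K + 1)) with hβ
  have hβ0 : 0 < β := by positivity
  have hβK : 2 * (β * K) ≤ c := by
    rw [hβ, div_mul_eq_mul_div, mul_div_assoc', div_le_iff₀ (by positivity)]
    nlinarith
  -- The smallest factor with `2 + γ₀ β S ≤ a₁ (2 + β S)` for all `S ≥ R`; equality holds at `S =
  -- R`.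
  set a₁ : ℝ := (2 + β * R * γ₀) / (2 + β * R) with ha₁
  have hden : 0 < 2 + β * R := by positivity
  have ha₁' : a₁ * (2 + β * R) = 2 + β * R * γ₀ := by rw [ha₁]; field_simp
  have hβR : 0 ≤ β * R := by positivity
  have ha₁γ : γ₀ ≤ a₁ := by
    rw [ha₁, le_div_iff₀ hden]; nlinarith
  have ha₁1 : a₁ < 1 := by
    rw [ha₁, div_lt_one hden]
    nlinarith [mul_pos hβ0 hR0]
  set a : ℝ := max (1 - c / 2) a₁ with ha
  have hac : 1 - c / 2 ≤ a := le_max_left _ _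
  have haa : a₁ ≤ a := le_max_right _ _
  have ha0 : 0 ≤ a := by linarith
  refine ⟨a, β, ha0, max_lt (by linarith) ha₁1, hβ0, ?_⟩
  intro φ M L hφ hM hL hosc
  have key : ∀ x y, (∫ z, φ z ∂(η x)) - ∫ z, φ z ∂(η y) ≤ a * L * (2 + β * V x + β * V y) := by
    intro x y
    have hne : Nonempty α := ⟨x⟩
    have hbdd : BddAbove (range fun x => φ x - L * (1 + β * V x)) := by
      refine ⟨φ y + L * (1 + β * V y), ?_⟩
      rintro _ ⟨x, rfl⟩
      have := (abs_le.1 (hosc x y)).2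
      change φ x - L * (1 + β * V x) ≤ _
      linarith
    -- Subtracting this constant converts the oscillation bound into the one-point bound `|φ - s| ≤
    -- L (1 + β V)`.
    set s : ℝ := ⨆ x, (φ x - L * (1 + β * V x)) with hs
    have hs1 : ∀ x, φ x - s ≤ L * (1 + β * V x) := fun x => by
      have : φ x - L * (1 + β * V x) ≤ s := le_ciSup hbdd x
      linarith
    have hs2 : ∀ y, -(L * (1 + β * V y)) ≤ φ y - s := fun y => by
      have : s ≤ φ y + L * (1 + β * V y) := by
        refine ciSup_le fun x => ?_
        have := (abs_le.1 (hosc x y)).2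
        linarith
      linarith
    have hVi : ∀ x, Integrable V (η x) ∧ ∫ z, V z ∂(η x) ≤ γ * V x + K := fun x =>
      integrable_and_integral_le_of_lintegral_le hV hV0 (by have := hV0 x; positivity) (hd x)
    have hφi : ∀ x, Integrable φ (η x) := fun x => integrable_of_abs_le hφ hM
    set W : α → ℝ := fun z => L * (1 + β * V z) with hW
    have hWi : ∀ x, Integrable W (η x) := fun x =>
      ((integrable_const (1 : ℝ)).add ((hVi x).1.const_mul β)).const_mul L
    have hψi : ∀ x, Integrable (fun z => φ z - s) (η x) := fun x =>
      (hφi x).sub (integrable_const s)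
    have hWint : ∀ x, ∫ z, W z ∂(η x) ≤ L * (1 + β * (γ * V x + K)) := fun x => by
      have e1 : ∫ z, W z ∂(η x) = L * (1 + β * ∫ z, V z ∂(η x)) := by
        simp only [hW]
        rw [integral_const_mul, integral_add (integrable_const _) ((hVi x).1.const_mul β),
          integral_const_mul]
        simp
      rw [e1]
      have := (hVi x).2
      gcongr
    have hdiff : (∫ z, φ z ∂(η x)) - ∫ z, φ z ∂(η y)
        = (∫ z, W z ∂(η x)) + (∫ z, W z ∂(η y))
          - (∫ z, (W z - (φ z - s)) ∂(η x)) - ∫ z, (W z + (φ z - s)) ∂(η y) := by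
      rw [integral_sub (hWi x) (hψi x), integral_add (hWi y) (hψi y),
        integral_sub (hφi x) (integrable_const s), integral_sub (hφi y) (integrable_const s)]
      simp
    have hn1 : ∀ z, 0 ≤ W z - (φ z - s) := fun z => by have := hs1 z; simp only [hW]; linarith
    have hn2 : ∀ z, 0 ≤ W z + (φ z - s) := fun z => by have := hs2 z; simp only [hW]; linarith
    have hVx := hV0 x
    have hVy := hV0 y
    have hWx := hWint x
    have hWy := hWint y
    -- For large `V x + V y` the drift alone contracts. Otherwise both points lie in the small set,
    -- and the nonnegative functions `W ∓ (φ - s)` each have a share `c ν` in their integral; in the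
    -- sum `φ` cancels and at least `2 c L` is gained.
    rcases le_or_gt R (V x + V y) with hS | hS
    · have i1 : 0 ≤ ∫ z, (W z - (φ z - s)) ∂(η x) := integral_nonneg hn1
      have i2 : 0 ≤ ∫ z, (W z + (φ z - s)) ∂(η y) := integral_nonneg hn2
      have i3 : 2 + β * γ * (V x + V y) + 2 * (β * K) ≤ a * (2 + β * (V x + V y)) := by
        have j1 : 2 * K ≤ (γ₀ - γ) * (V x + V y) := by nlinarith
        have j2 : β * (2 * K) ≤ β * ((γ₀ - γ) * (V x + V y)) := by gcongr
        have j3 : 2 + γ₀ * β * (V x + V y) ≤ a₁ * (2 + β * (V x + V y)) := by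
          have : γ₀ * (β * (V x + V y - R)) ≤ a₁ * (β * (V x + V y - R)) :=
            mul_le_mul_of_nonneg_right ha₁γ (mul_nonneg hβ0.le (by linarith))
          nlinarith
        have j4 : a₁ * (2 + β * (V x + V y)) ≤ a * (2 + β * (V x + V y)) := by gcongr
        nlinarith
      have i4 := mul_le_mul_of_nonneg_left i3 hL
      rw [hdiff]
      linarith
    · have hx := hν x (by linarith)
      have hy := hν y (by linarith)
      have hcne : ENNReal.ofReal c ≠ 0 := by simpa using hc
      have hWν : Integrable W ν := by
        have := (hWi x).mono_measure hx
        rwa [integrable_smul_measure hcne ENNReal.ofReal_ne_top] at this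
      have hψν : Integrable (fun z => φ z - s) ν :=
        (integrable_of_abs_le hφ hM).sub (integrable_const s)
      have i1 : c * ∫ z, (W z - (φ z - s)) ∂ν ≤ ∫ z, (W z - (φ z - s)) ∂(η x) := by
        have := integral_mono_measure hx (Eventually.of_forall hn1)
          ((hWi x).sub (hψi x))
        rwa [integral_smul_measure, ENNReal.toReal_ofReal hc.le, smul_eq_mul] at this
      have i2 : c * ∫ z, (W z + (φ z - s)) ∂ν ≤ ∫ z, (W z + (φ z - s)) ∂(η y) := by
        have := integral_mono_measure hy (Eventually.of_forall hn2)
          ((hWi y).add (hψi y))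
        rwa [integral_smul_measure, ENNReal.toReal_ofReal hc.le, smul_eq_mul] at this
      rw [integral_sub hWν hψν] at i1
      rw [integral_add hWν hψν] at i2
      have i5 : L ≤ ∫ z, W z ∂ν := by
        have : ∫ _, L ∂ν ≤ ∫ z, W z ∂ν := integral_mono (integrable_const _) hWν fun z => by
          have := mul_nonneg hL (mul_nonneg hβ0.le (hV0 z))
          simp only [hW]; linarith
        simpa using this
      have i6 : c * L ≤ c * ∫ z, W z ∂ν := by gcongr
      have i3 : 2 + β * γ * (V x + V y) + 2 * (β * K) - 2 * c ≤ a * (2 + β * (V x + V y)) := by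
        have : γ * (β * (V x + V y)) ≤ a * (β * (V x + V y)) :=
          mul_le_mul_of_nonneg_right (by linarith) (by positivity)
        nlinarith
      have i4 := mul_le_mul_of_nonneg_left i3 hL
      rw [hdiff]
      linarith
  intro x y
  rw [abs_le]
  have h1 := key x y
  have h2 := key y x
  constructor <;> linarith

/-- A sequence of probability measures that converges setwise, uniformly over all measurable
sets, has a probability measure as its limit. -/
theorem exists_probabilityMeasure_of_uniform_cauchy {μ : ℕ → Measure α}
    [∀ n, IsProbabilityMeasure (μ n)] {e : ℕ → ℝ} (he : Tendsto e atTop (𝓝 0))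
    (h : ∀ m k A, MeasurableSet A → |(μ (m + k)).real A - (μ m).real A| ≤ e m) :
    ∃ π : Measure α, IsProbabilityMeasure π ∧
      ∀ A, MeasurableSet A → Tendsto (fun n => (μ n).real A) atTop (𝓝 (π.real A)) := by
  have hlim : ∀ A, ∃ l, MeasurableSet A → Tendsto (fun n => (μ n).real A) atTop (𝓝 l) := by
    intro A
    by_cases hA : MeasurableSet A
    · obtain ⟨l, hl⟩ := cauchySeq_tendsto_of_complete (u := fun n => (μ n).real A)
        (cauchySeq_of_le_tendsto_0 (fun n => 2 * e n) (fun n m N hn hm => by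
          obtain ⟨k, rfl⟩ := Nat.exists_eq_add_of_le hn
          obtain ⟨k', rfl⟩ := Nat.exists_eq_add_of_le hm
          have h1 := abs_le.1 (h N k A hA)
          have h2 := abs_le.1 (h N k' A hA)
          rw [Real.dist_eq, abs_le]
          constructor <;> linarith) (by simpa using he.const_mul 2))
      exact ⟨l, fun _ => hl⟩
    · exact ⟨0, fun h => absurd h hA⟩
  choose L hL using hlim
  have hLe : ∀ m A, MeasurableSet A → |(μ m).real A - L A| ≤ e m := by
    intro m A hA
    have h1 : Tendsto (fun k => |(μ (m + k)).real A - (μ m).real A|) atTop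
        (𝓝 |L A - (μ m).real A|) := by
      have h2 := (hL A hA).comp (tendsto_add_atTop_nat m)
      have h3 : Tendsto (fun k => (μ (m + k)).real A) atTop (𝓝 (L A)) :=
        h2.congr fun k => by simp [add_comm]
      exact (h3.sub_const _).abs
    rw [abs_sub_comm]
    exact le_of_tendsto h1 (Eventually.of_forall fun k => h m k A hA)
  have hL0 : ∀ A, MeasurableSet A → 0 ≤ L A := fun A hA =>
    ge_of_tendsto (hL A hA) (Eventually.of_forall fun n => measureReal_nonneg)
  have hLempty : L ∅ = 0 := by
    have := hL ∅ MeasurableSet.empty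
    simpa using tendsto_nhds_unique this (by simp)
  have hLuniv : L univ = 1 := by
    have := hL univ MeasurableSet.univ
    simp only [probReal_univ] at this
    exact tendsto_nhds_unique this tendsto_const_nhds
  have hsum : ∀ f : ℕ → Set α, (∀ i, MeasurableSet (f i)) → Pairwise (Function.onFun Disjoint f) →
      HasSum (fun i => L (f i)) (L (⋃ i, f i)) := by
    intro f hf hdisj
    rw [hasSum_iff_tendsto_nat_of_nonneg (fun i => hL0 _ (hf i))]
    have hpart : ∀ m n, ∑ i ∈ Finset.range n, (μ m).real (f i)
        = (μ m).real (⋃ i ∈ Finset.range n, f i) := fun m n =>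
      (measureReal_biUnion_finset (fun i _ j _ hij => hdisj hij) (fun i _ => hf i)).symm
    have hLpart : ∀ n, ∑ i ∈ Finset.range n, L (f i) = L (⋃ i ∈ Finset.range n, f i) := by
      intro n
      have h1 : Tendsto (fun m => ∑ i ∈ Finset.range n, (μ m).real (f i)) atTop
          (𝓝 (∑ i ∈ Finset.range n, L (f i))) :=
        tendsto_finsetSum _ fun i _ => hL _ (hf i)
      refine tendsto_nhds_unique h1 ?_
      simp only [hpart]
      exact hL _ (Finset.measurableSet_biUnion _ fun i _ => hf i)
    -- Countable additivity survives the limit since the partial sums are measures of finite unions,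
    -- on which the convergence is uniform; this allows exchanging the two limits.
    have hunif : TendstoUniformly (fun m n => ∑ i ∈ Finset.range n, (μ m).real (f i))
        (fun n => ∑ i ∈ Finset.range n, L (f i)) atTop := by
      rw [Metric.tendstoUniformly_iff]
      intro ε hε
      filter_upwards [he.eventually (gt_mem_nhds hε)] with m hm n
      rw [hpart, hLpart, dist_comm, Real.dist_eq]
      exact (hLe m _ (Finset.measurableSet_biUnion _ fun i _ => hf i)).trans_lt hm
    refine hunif.tendsto_of_eventually_tendsto (Eventually.of_forall fun m => ?_)
      (hL _ (MeasurableSet.iUnion hf))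
    have h2 : HasSum (fun i => (μ m) (f i)) ((μ m) (⋃ i, f i)) := by
      rw [measure_iUnion hdisj hf]; exact ENNReal.summable.hasSum
    have h3 := (ENNReal.tendsto_toReal (measure_ne_top (μ m) (⋃ i, f i))).comp
      h2.tendsto_sum_nat
    refine h3.congr fun n => ?_
    simp only [Function.comp, measureReal_def]
    rw [ENNReal.toReal_sum fun i _ => measure_ne_top _ _]
  set π : Measure α := Measure.ofMeasurable (fun A _ => ENNReal.ofReal (L A))
    (by simp [hLempty]) (fun f hf hdisj => by
      have h1 := hsum f hf hdisj
      rw [← h1.tsum_eq, ENNReal.ofReal_tsum_of_nonneg (fun i => hL0 _ (hf i)) h1.summable]) with hπ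
  have hπA : ∀ A, MeasurableSet A → π A = ENNReal.ofReal (L A) := fun A hA =>
    Measure.ofMeasurable_apply A hA
  refine ⟨π, ⟨by rw [hπA _ MeasurableSet.univ, hLuniv]; simp⟩, fun A hA => ?_⟩
  rw [measureReal_def, hπA A hA, ENNReal.toReal_ofReal (hL0 A hA)]
  exact hL A hA

/-- The layer-cake formula reduces the integral to measures of superlevel sets, where setwise
convergence applies pointwise in the level. -/
theorem tendsto_lintegral_of_setwise {μ : ℕ → Measure α} [∀ n, IsProbabilityMeasure (μ n)]
    {π : Measure α} [IsProbabilityMeasure π]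
    (h : ∀ A, MeasurableSet A → Tendsto (fun n => (μ n).real A) atTop (𝓝 (π.real A)))
    {f : α → ℝ} (hf : Measurable f) (hf0 : ∀ x, 0 ≤ f x) (hf1 : ∀ x, f x ≤ 1) :
    Tendsto (fun n => ∫⁻ x, ENNReal.ofReal (f x) ∂(μ n)) atTop
      (𝓝 (∫⁻ x, ENNReal.ofReal (f x) ∂π)) := by
  have hcake : ∀ ρ : Measure α, ∫⁻ x, ENNReal.ofReal (f x) ∂ρ
      = ∫⁻ t in Ioi 0, ρ {x | t ≤ f x} := fun ρ =>
    lintegral_eq_lintegral_meas_le ρ (Eventually.of_forall hf0) hf.aemeasurable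
  simp only [hcake]
  have hanti : ∀ ρ : Measure α, Measurable fun t : ℝ => ρ {x | t ≤ f x} := fun ρ =>
    Antitone.measurable fun s t hst => measure_mono fun x (hx : t ≤ f x) => hst.trans hx
  refine tendsto_lintegral_of_dominated_convergence (indicator (Iic 1) 1)
    (fun n => hanti (μ n)) (fun n => Eventually.of_forall fun t => ?_) ?_
    (Eventually.of_forall fun t => ?_)
  · by_cases ht : t ≤ 1
    · rw [indicator_of_mem (by simpa using ht)]; exact prob_le_one
    · have : {x | t ≤ f x} = ∅ := by
        ext x; simp only [mem_ofPred_eq, mem_empty_iff_false, iff_false, not_le]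
        linarith [hf1 x]
      change μ n {x | t ≤ f x} ≤ _
      rw [this]; simp
  · rw [lintegral_indicator measurableSet_Iic, Measure.restrict_restrict measurableSet_Iic]
    simp only [Pi.one_apply, lintegral_one, Measure.restrict_apply_univ]
    rw [inter_comm, Ioi_inter_Iic]
    simp
  · have h1 := h {x | t ≤ f x} (measurableSet_le measurable_const hf)
    exact (ENNReal.tendsto_toReal_iff (fun n => measure_ne_top _ _) (measure_ne_top _ _)).1 h1

end Harris

/-! ### Invariant measures and convergence to them. -/

section Harris

variable {α : Type*} [MeasurableSpace α]

theorem invariant_pow {κ : Kernel α α} [IsMarkovKernel κ] {π : Measure α}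
    (h : κ.Invariant π) (n : ℕ) : (κ ^ n).Invariant π := by
  induction n with
  | zero => rw [pow_zero]; exact Measure.id_comp
  | succ n ih => rw [pow_succ]; exact Kernel.Invariant.comp ih h

theorem integral_pow_invariant {κ : Kernel α α} [IsMarkovKernel κ] {π : Measure α}
    [IsProbabilityMeasure π] (h : κ.Invariant π) {φ : α → ℝ} (hφ : Integrable φ π) (n : ℕ) :
    ∫ x, ∫ y, φ y ∂((κ ^ n) x) ∂π = ∫ y, φ y ∂π := by
  have h1 : (κ ^ n) ∘ₘ π = π := invariant_pow h n
  have h2 : ((κ ^ n) ∘ₖ (Kernel.const Unit π)) () = π := by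
    rw [← Measure.comp_eq_comp_const_apply, h1]
  have h3 := Kernel.integral_comp (η := κ ^ n) (κ := Kernel.const Unit π) (a := ()) (f := φ)
    (by rwa [h2])
  rw [h2] at h3
  simpa using h3.symm

/-- By invariance `π(φ) = π(κ ^ n φ)`, so the difference from `κ ^ n φ (x)` is a `π`-average of
oscillations. These are bounded by `2`, so dominated convergence suffices and no integrability of
the Lyapunov function under `π` is required. Applied to two invariant measures it yields uniqueness.
-/
theorem tendsto_integral_pow_of_oscillation {κ : Kernel α α} [IsMarkovKernel κ] {π : Measure α}
    [IsProbabilityMeasure π] (h : κ.Invariant π) {φ : α → ℝ} (hφ : Measurable φ)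
    (hφ1 : ∀ x, |φ x| ≤ 1) {x : α}
    (hosc : ∀ y, Tendsto (fun n => (∫ z, φ z ∂((κ ^ n) y)) - ∫ z, φ z ∂((κ ^ n) x)) atTop (𝓝 0)) :
    Tendsto (fun n => ∫ z, φ z ∂((κ ^ n) x)) atTop (𝓝 (∫ z, φ z ∂π)) := by
  have hb : ∀ n y, |∫ z, φ z ∂((κ ^ n) y)| ≤ 1 := fun n y => abs_integral_le_of_abs_le hφ1
  have hm : ∀ n, Measurable fun y => ∫ z, φ z ∂((κ ^ n) y) := fun n => measurable_integral_kernel hφ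
  have h1 := tendsto_integral_of_dominated_convergence (μ := π) (fun _ => (2 : ℝ))
    (F := fun n y => (∫ z, φ z ∂((κ ^ n) y)) - ∫ z, φ z ∂((κ ^ n) x)) (f := fun _ => 0)
    (fun n => ((hm n).sub_const _).aestronglyMeasurable) (integrable_const _)
    (fun n => Eventually.of_forall fun y => by
      have h2 := abs_le.1 (hb n y)
      have h3 := abs_le.1 (hb n x)
      rw [Real.norm_eq_abs, abs_le]
      constructor <;> linarith) (Eventually.of_forall hosc)
  have h2 : ∀ n, ∫ y, ((∫ z, φ z ∂((κ ^ n) y)) - ∫ z, φ z ∂((κ ^ n) x)) ∂π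
      = (∫ z, φ z ∂π) - ∫ z, φ z ∂((κ ^ n) x) := fun n => by
    rw [integral_sub (integrable_of_abs_le (hm n) (hb n)) (integrable_const _),
      integral_pow_invariant h (integrable_of_abs_le hφ hφ1)]
    simp
  simp only [h2, integral_zero] at h1
  have h3 := h1.const_sub (∫ z, φ z ∂π)
  simpa using h3

/-- **Harris' theorem**: a drift condition, and minorization on all sublevel sets of the Lyapunov
function, give a unique invariant probability measure, to which the chain converges. -/
theorem exists_unique_invariant_of_drift_of_minorization [Nonempty α] {κ : Kernel α α}
    [IsMarkovKernel κ] {V : α → ℝ} (hV : Measurable V) (hV0 : ∀ x, 0 ≤ V x) {γ K : ℝ}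
    (hγ0 : 0 ≤ γ) (hγ1 : γ < 1) (hK : 0 ≤ K)
    (hd : ∀ x, ∫⁻ y, ENNReal.ofReal (V y) ∂(κ x) ≤ ENNReal.ofReal (γ * V x + K))
    (hmin : ∀ R : ℝ, ∃ N : ℕ, 0 < N ∧ ∃ c : ℝ, 0 < c ∧ c ≤ 1 ∧ ∃ ν : Measure α,
      IsProbabilityMeasure ν ∧ ∀ x, V x ≤ R → ENNReal.ofReal c • ν ≤ (κ ^ N) x) :
    ∃ π : Measure α, IsProbabilityMeasure π ∧ κ.Invariant π ∧
      (∀ π' : Measure α, IsProbabilityMeasure π' → κ.Invariant π' → π' = π) ∧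
      ∀ φ : α → ℝ, Measurable φ → (∀ x, |φ x| ≤ 1) → ∀ x,
        Tendsto (fun n => ∫ y, φ y ∂((κ ^ n) x)) atTop (𝓝 (∫ y, φ y ∂π)) := by
  have hγ : 0 < 1 - γ := by linarith
  set K' : ℝ := K / (1 - γ) with hK'
  have hK'0 : 0 ≤ K' := by positivity
  set γ₀ : ℝ := (1 + γ) / 2 with hγ₀
  have hγγ₀ : 0 < γ₀ - γ := by rw [hγ₀]; linarith
  -- `R` must be fixed before the number of steps `N`, which depends on it. This is possible because
  -- `γ` and `K'` serve as drift constants for `κ ^ N` with every `N ≥ 1`.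
  set R : ℝ := 2 * K' / (γ₀ - γ) + 1 with hR
  have hR0 : 0 < R := by positivity
  have hRK : 2 * K' ≤ (γ₀ - γ) * R := by
    rw [hR, mul_add, mul_div_cancel₀ _ hγγ₀.ne']; linarith
  obtain ⟨N, hN, c, hc, hc1, ν, hνp, hν⟩ := hmin R
  have hdrift := lintegral_pow_le_of_drift hV hV0 hγ0 hγ1 hK hd
  have hdN : ∀ x, ∫⁻ y, ENNReal.ofReal (V y) ∂((κ ^ N) x) ≤ ENNReal.ofReal (γ * V x + K') := by
    intro x
    refine (hdrift N x).trans (ENNReal.ofReal_le_ofReal ?_)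
    have : γ ^ N ≤ γ := pow_le_of_le_one hγ0 hγ1.le hN.ne'
    have := mul_le_mul_of_nonneg_right this (hV0 x)
    linarith
  obtain ⟨a, β, ha0, ha1, hβ, hcontr⟩ := exists_contraction_of_drift_of_minorization
    (η := κ ^ N) hV hV0 hγ0 (by linarith : γ < γ₀) (by rw [hγ₀]; linarith) hK'0 hR0 hRK hc hc1
    hdN hν
  have hb : ∀ φ : α → ℝ, (∀ x, |φ x| ≤ 1) → ∀ n y, |∫ z, φ z ∂((κ ^ n) y)| ≤ 1 :=
    fun φ hφ1 n y => abs_integral_le_of_abs_le hφ1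
  have hosc1 : ∀ φ : α → ℝ, Measurable φ → (∀ x, |φ x| ≤ 1) → ∀ n x y,
      |(∫ z, φ z ∂((κ ^ (n * N)) x)) - ∫ z, φ z ∂((κ ^ (n * N)) y)|
        ≤ a ^ n * (2 + β * V x + β * V y) := by
    intro φ hφ hφ1 n
    induction n with
    | zero =>
      intro x y
      have h1 := abs_le.1 (hb φ hφ1 (0 * N) x)
      have h2 := abs_le.1 (hb φ hφ1 (0 * N) y)
      have h3 := mul_nonneg hβ.le (hV0 x)
      have h4 := mul_nonneg hβ.le (hV0 y)
      rw [pow_zero, abs_le]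
      constructor <;> linarith
    | succ n ih =>
      intro x y
      rw [Nat.succ_mul, integral_pow_add κ hφ hφ1, integral_pow_add κ hφ hφ1]
      refine (hcontr _ 1 (a ^ n) (measurable_integral_kernel hφ) (hb φ hφ1 _) (by positivity)
        ih x y).trans (le_of_eq ?_)
      ring
  have hosc : ∀ φ : α → ℝ, Measurable φ → (∀ x, |φ x| ≤ 1) → ∀ n x y,
      |(∫ z, φ z ∂((κ ^ n) x)) - ∫ z, φ z ∂((κ ^ n) y)|
        ≤ a ^ (n / N) * (2 + β * V x + β * V y) := by
    intro φ hφ hφ1 n x y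
    -- The remaining `n % N` steps are applied to `φ` first; they preserve the bound by `1`.
    have h1 : n = n % N + n / N * N := by rw [mul_comm]; exact (Nat.mod_add_div n N).symm
    have h2 : ∀ x, ∫ z, φ z ∂((κ ^ n) x)
        = ∫ z, ∫ y, φ y ∂((κ ^ (n % N)) z) ∂((κ ^ (n / N * N)) x) := fun x => by
      conv_lhs => rw [h1]
      exact integral_pow_add κ hφ hφ1 _ _ x
    rw [h2, h2]
    exact hosc1 _ (measurable_integral_kernel hφ) (hb φ hφ1 _) (n / N) x y
  have hpow : Tendsto (fun n : ℕ => a ^ (n / N)) atTop (𝓝 0) :=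
    (tendsto_pow_atTop_nhds_zero_of_lt_one ha0 ha1).comp (Nat.tendsto_div_const_atTop hN.ne')
  have hosc0 : ∀ φ : α → ℝ, Measurable φ → (∀ x, |φ x| ≤ 1) → ∀ x y,
      Tendsto (fun n => (∫ z, φ z ∂((κ ^ n) y)) - ∫ z, φ z ∂((κ ^ n) x)) atTop (𝓝 0) := by
    intro φ hφ hφ1 x y
    refine squeeze_zero_norm (hosc φ hφ hφ1 · y x) ?_
    simpa using hpow.mul_const (2 + β * V y + β * V x)
  have hcauchy : ∀ φ : α → ℝ, Measurable φ → (∀ x, |φ x| ≤ 1) → ∀ m k x,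
      |(∫ z, φ z ∂((κ ^ (m + k)) x)) - ∫ z, φ z ∂((κ ^ m) x)|
        ≤ a ^ (m / N) * (2 + β * (V x + K') + β * V x) := by
    intro φ hφ hφ1 m k x
    -- `κ ^ (m + k)` at `x` averages `κ ^ m` over the law after `k` steps, where `V` has a mean
    -- bounded independently of `k`. The resulting Cauchy rate is the same for all `φ` bounded by
    -- `1`, hence uniform over measurable sets.
    have hk : ∫⁻ y, ENNReal.ofReal (V y) ∂((κ ^ k) x) ≤ ENNReal.ofReal (V x + K') := by
      refine (hdrift k x).trans (ENNReal.ofReal_le_ofReal ?_)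
      have : γ ^ k ≤ 1 := pow_le_one₀ hγ0 hγ1.le
      have := mul_le_mul_of_nonneg_right this (hV0 x)
      linarith
    obtain ⟨hVi, hVle⟩ := integrable_and_integral_le_of_lintegral_le hV hV0
      (by have := hV0 x; positivity) hk
    have hmm : Measurable fun y => ∫ z, φ z ∂((κ ^ m) y) := measurable_integral_kernel hφ
    have h1 : (∫ z, φ z ∂((κ ^ (m + k)) x)) - ∫ z, φ z ∂((κ ^ m) x)
        = ∫ y, ((∫ z, φ z ∂((κ ^ m) y)) - ∫ z, φ z ∂((κ ^ m) x)) ∂((κ ^ k) x) := by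
      rw [integral_pow_add κ hφ hφ1,
        integral_sub (integrable_of_abs_le hmm (hb φ hφ1 m)) (integrable_const _)]
      simp
    have hint : Integrable (fun y => a ^ (m / N) * (2 + β * V y + β * V x)) ((κ ^ k) x) :=
      (((integrable_const (2 : ℝ)).add (hVi.const_mul β)).add
        (integrable_const (β * V x))).const_mul _
    rw [h1, ← Real.norm_eq_abs]
    refine (norm_integral_le_of_norm_le hint
      (Eventually.of_forall fun y => hosc φ hφ hφ1 m y x)).trans ?_
    have e2 : ∫ y, (2 + β * V y + β * V x) ∂((κ ^ k) x)
        = 2 + β * (∫ y, V y ∂((κ ^ k) x)) + β * V x := by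
      have i1 : Integrable (fun y => β * V y) ((κ ^ k) x) := hVi.const_mul β
      have i2 : Integrable (fun y => 2 + β * V y) ((κ ^ k) x) := (integrable_const (2 : ℝ)).add i1
      rw [integral_add i2 (integrable_const _), integral_add (integrable_const _) i1,
        integral_const_mul]
      simp
    rw [integral_const_mul, e2]
    gcongr
  obtain ⟨x₀⟩ := ‹Nonempty α›
  have hind : ∀ A : Set α, MeasurableSet A → ∀ n x,
      ∫ z, A.indicator (fun _ => (1 : ℝ)) z ∂((κ ^ n) x) = ((κ ^ n) x).real A := fun A hA n x => by
    rw [integral_indicator hA]; simp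
  have hind1 : ∀ (A : Set α) x, |A.indicator (fun _ => (1 : ℝ)) x| ≤ 1 := fun A x => by
    by_cases hx : x ∈ A <;> simp [hx]
  have hindm : ∀ A : Set α, MeasurableSet A → Measurable (A.indicator (fun _ => (1 : ℝ))) :=
    fun A hA => measurable_const.indicator hA
  obtain ⟨π, hπp, hπ⟩ := exists_probabilityMeasure_of_uniform_cauchy (μ := fun n => (κ ^ n) x₀)
    (e := fun m => a ^ (m / N) * (2 + β * (V x₀ + K') + β * V x₀))
    (by simpa using hpow.mul_const _) (fun m k A hA => by
      have := hcauchy _ (hindm A hA) (hind1 A) m k x₀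
      rwa [hind A hA, hind A hA] at this)
  have hinv : κ.Invariant π := by
    ext A hA
    rw [Measure.bind_apply hA κ.aemeasurable]
    have h1 := tendsto_lintegral_of_setwise hπ (f := fun x => (κ x).real A)
      ((κ.measurable_coe hA).ennreal_toReal) (fun x => measureReal_nonneg)
      (fun x => measureReal_le_one)
    have h2 : ∀ x, ENNReal.ofReal ((κ x).real A) = κ x A := fun x =>
      ENNReal.ofReal_toReal (measure_ne_top _ _)
    simp only [h2, ← Kernel.pow_succ_apply_eq_lintegral κ _ _ hA] at h1
    have h3 := (hπ A hA).comp (tendsto_add_atTop_nat 1)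
    have h4 := (ENNReal.tendsto_toReal_iff (fun n => measure_ne_top _ _) (measure_ne_top _ _)).1 h3
    exact tendsto_nhds_unique h1 h4
  refine ⟨π, hπp, hinv, fun π' hπ' hinv' => ?_, fun φ hφ hφ1 x =>
    tendsto_integral_pow_of_oscillation hinv hφ hφ1 (hosc0 φ hφ hφ1 x)⟩
  ext A hA
  have h1 := tendsto_integral_pow_of_oscillation hinv' (hindm A hA) (hind1 A)
    (hosc0 _ (hindm A hA) (hind1 A) x₀)
  have h2 := tendsto_integral_pow_of_oscillation hinv (hindm A hA) (hind1 A)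
    (hosc0 _ (hindm A hA) (hind1 A) x₀)
  have h3 := tendsto_nhds_unique h1 h2
  rw [integral_indicator hA, integral_indicator hA] at h3
  simp only [integral_const, smul_eq_mul, mul_one, measureReal_restrict_apply_univ] at h3
  exact (measureReal_eq_measureReal_iff (measure_ne_top _ _) (measure_ne_top _ _)).1 h3

end Harris

/-! ### The mean ergodic theorem for a mixing kernel -/

section MeanErgodic

variable {α : Type*} [MeasurableSpace α]

theorem eLpNorm_two_sq_eq_lintegral {μ : Measure α} (f : α → ℝ) :
    eLpNorm f 2 μ ^ (2 : ℝ) = ∫⁻ x, ‖f x‖ₑ ^ (2 : ℝ) ∂μ := by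
  have := eLpNorm_nnreal_pow_eq_lintegral (μ := μ) (f := f) (p := 2) (by norm_num)
  simpa using this

/-- An `L²(π)` function is determined only up to `π`-null sets, while a single `η x` may charge such
sets. Invariance makes a `π`-null set `η x`-null for `π`-almost every `x`. -/
theorem ae_aestronglyMeasurable_of_invariant {η : Kernel α α} {π : Measure α}
    (h : η.Invariant π) {g : α → ℝ} (hg : AEStronglyMeasurable g π) :
    ∀ᵐ x ∂π, AEStronglyMeasurable g (η x) := by
  have h1 : ∀ᵐ z ∂(η ∘ₘ π), g z = hg.mk g z := by rw [h.def]; exact hg.ae_eq_mk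
  filter_upwards [Measure.ae_ae_of_ae_comp h1] with x hx
  exact ⟨hg.mk g, hg.stronglyMeasurable_mk, hx⟩

theorem aestronglyMeasurable_integral_of_invariant {η : Kernel α α} [IsMarkovKernel η]
    {π : Measure α} (h : η.Invariant π) {g : α → ℝ} (hg : AEStronglyMeasurable g π) :
    AEStronglyMeasurable (fun x => ∫ y, g y ∂(η x)) π := by
  have h1 : ∀ᵐ z ∂(η ∘ₘ π), g z = hg.mk g z := by rw [h.def]; exact hg.ae_eq_mk
  refine ⟨fun x => ∫ y, hg.mk g y ∂(η x), hg.stronglyMeasurable_mk.integral_kernel, ?_⟩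
  filter_upwards [Measure.ae_ae_of_ae_comp h1] with x hx using integral_congr_ae hx

/-- A Markov kernel is a contraction of `L²` of an invariant measure. -/
theorem eLpNorm_integral_kernel_le {η : Kernel α α} [IsMarkovKernel η] {π : Measure α}
    (h : η.Invariant π) {g : α → ℝ} (hg : AEStronglyMeasurable g π) :
    eLpNorm (fun x => ∫ y, g y ∂(η x)) 2 π ≤ eLpNorm g 2 π := by
  rw [← ENNReal.rpow_le_rpow_iff (two_pos : (0 : ℝ) < 2), eLpNorm_two_sq_eq_lintegral,
    eLpNorm_two_sq_eq_lintegral]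
  have hg' : AEMeasurable (fun x => ‖g x‖ₑ ^ (2 : ℝ)) (π.bind η) := by
    rw [h.def]; exact hg.enorm.pow_const _
  conv_rhs => rw [← h.def]
  rw [Measure.lintegral_bind η.aemeasurable hg']
  refine lintegral_mono_ae ?_
  filter_upwards [ae_aestronglyMeasurable_of_invariant h hg] with x hx
  rw [← eLpNorm_two_sq_eq_lintegral]
  refine ENNReal.rpow_le_rpow ?_ two_pos.le
  refine (enorm_integral_le_lintegral_enorm _).trans ?_
  rw [← eLpNorm_one_eq_lintegral_enorm]
  -- Jensen's inequality, as comparison of `L¹` and `L²` norms under the probability measure `η x`.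
  exact eLpNorm_le_eLpNorm_of_exponent_le (by norm_num) hx

theorem eLpNorm_tendsto_zero_of_bounded {π : Measure α} [IsProbabilityMeasure π]
    {f : ℕ → α → ℝ} (hf : ∀ n, Measurable (f n)) {M : ℝ} (hM : ∀ n x, |f n x| ≤ M)
    (h : ∀ x, Tendsto (fun n => f n x) atTop (𝓝 0)) :
    Tendsto (fun n => eLpNorm (f n) 2 π) atTop (𝓝 0) := by
  have h1 : Tendsto (fun n => ∫⁻ x, ‖f n x‖ₑ ^ (2 : ℝ) ∂π) atTop (𝓝 (∫⁻ _, 0 ∂π)) := by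
    refine tendsto_lintegral_of_dominated_convergence (fun _ => ENNReal.ofReal M ^ (2 : ℝ))
      (fun n => (hf n).enorm.pow_const _) (fun n => Eventually.of_forall fun x => ?_) ?_
      (Eventually.of_forall fun x => ?_)
    · refine ENNReal.rpow_le_rpow ?_ two_pos.le
      rw [← ofReal_norm]
      exact ENNReal.ofReal_le_ofReal (hM n x)
    · rw [lintegral_const]; simp
    · have h2 : Tendsto (fun n => ‖f n x‖ₑ) atTop (𝓝 0) := by
        have := (continuous_enorm.tendsto (0 : ℝ)).comp (h x)
        simpa [Function.comp_def] using this
      have := (ENNReal.continuous_rpow_const (y := 2)).tendsto 0 |>.comp h2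
      simpa [Function.comp_def] using this
  rw [lintegral_zero] at h1
  have h3 := (ENNReal.continuous_rpow_const (y := 2⁻¹)).tendsto 0 |>.comp h1
  rw [ENNReal.zero_rpow_of_pos (by norm_num)] at h3
  refine h3.congr fun n => ?_
  simp only [Function.comp]
  rw [← eLpNorm_two_sq_eq_lintegral, ← ENNReal.rpow_mul]
  simp

/-- Simple functions are bounded, so they converge pointwise and hence in `L²(π)`. For general `g`
the error of a simple approximation is not enlarged by `κ ^ n`, nor by taking its mean: three terms
of size `ε / 3`. -/
theorem tendsto_eLpNorm_pow_sub_of_mixing {κ : Kernel α α} [IsMarkovKernel κ] {π : Measure α}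
    [IsProbabilityMeasure π] (h : κ.Invariant π)
    (hmix : ∀ φ : α → ℝ, Measurable φ → (∀ x, |φ x| ≤ 1) → ∀ x,
      Tendsto (fun n => ∫ y, φ y ∂((κ ^ n) x)) atTop (𝓝 (∫ y, φ y ∂π)))
    {g : α → ℝ} (hg : MemLp g 2 π) :
    Tendsto (fun n => eLpNorm (fun x => (∫ y, g y ∂((κ ^ n) x)) - ∫ y, g y ∂π) 2 π)
      atTop (𝓝 0) := by
  rw [ENNReal.tendsto_nhds_zero]
  intro ε hε
  have hε3 : ε / 3 ≠ 0 := (ENNReal.div_pos hε.ne' (by norm_num)).ne'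
  obtain ⟨s, hs, hsm⟩ := hg.exists_simpleFunc_eLpNorm_sub_lt (by norm_num) hε3
  obtain ⟨M, hM⟩ : ∃ M : ℝ, ∀ x, |s x| ≤ M := by
    obtain ⟨C, hC⟩ := s.exists_forall_norm_le
    exact ⟨C, fun x => hC x⟩
  have hsmeas : Measurable s := s.measurable
  have hgi : Integrable g π := hg.integrable (by norm_num)
  have hsi : Integrable s π := integrable_of_abs_le hsmeas hM
  have hmixs : ∀ x, Tendsto (fun n => ∫ y, s y ∂((κ ^ n) x)) atTop (𝓝 (∫ y, s y ∂π)) := by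
    intro x
    have hM' : 0 < |M| + 1 := by positivity
    have h1 := (hmix (fun y => s y / (|M| + 1)) (hsmeas.div_const _) (fun y => by
      rw [abs_div, abs_of_pos hM', div_le_one hM']
      linarith [hM y, le_abs_self M]) x).mul_const (|M| + 1)
    simp only [integral_div, div_mul_cancel₀ _ hM'.ne'] at h1
    exact h1
  have hs0 : Tendsto (fun n => eLpNorm (fun x => (∫ y, s y ∂((κ ^ n) x)) - ∫ y, s y ∂π) 2 π)
      atTop (𝓝 0) := by
    refine eLpNorm_tendsto_zero_of_bounded (M := M + M)
      (fun n => (measurable_integral_kernel hsmeas).sub_const _) (fun n x => ?_) (fun x => ?_)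
    · exact (abs_sub _ _).trans (add_le_add (abs_integral_le_of_abs_le hM)
        (abs_integral_le_of_abs_le hM))
    · simpa using (hmixs x).sub_const (∫ y, s y ∂π)
  filter_upwards [ENNReal.tendsto_nhds_zero.1 hs0 (ε / 3) (pos_iff_ne_zero.2 hε3)] with n hn
  have hinvn := invariant_pow h n
  have hgs : AEStronglyMeasurable (g - ⇑s) π := hg.1.sub hsmeas.aestronglyMeasurable
  have hae : (fun x => (∫ y, g y ∂((κ ^ n) x)) - ∫ y, g y ∂π) =ᵐ[π]
      (fun x => ∫ y, (g - ⇑s) y ∂((κ ^ n) x)) + ((fun x => (∫ y, s y ∂((κ ^ n) x)) - ∫ y, s y ∂π)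
        + fun _ => -∫ y, (g - ⇑s) y ∂π) := by
    have h1 : Integrable g (π.bind (κ ^ n : Kernel α α)) := by rw [hinvn.def]; exact hgi
    filter_upwards [Measure.ae_integrable_of_integrable_comp (κ := κ ^ n) h1] with x hx
    simp only [Pi.add_apply, Pi.sub_apply]
    rw [integral_sub hx (integrable_of_abs_le hsmeas hM), integral_sub hgi hsi]
    ring
  rw [eLpNorm_congr_ae hae]
  have hm1 := aestronglyMeasurable_integral_of_invariant hinvn hgs
  have hm2 : AEStronglyMeasurable (fun x => (∫ y, s y ∂((κ ^ n) x)) - ∫ y, s y ∂π) π :=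
    ((measurable_integral_kernel hsmeas).sub_const _).aestronglyMeasurable
  have h3 : eLpNorm (fun _ : α => -∫ y, (g - ⇑s) y ∂π) 2 π ≤ ε / 3 := by
    rw [eLpNorm_const _ (by norm_num) (NeZero.ne π)]
    simp only [measure_univ, ENNReal.one_rpow, mul_one, enorm_neg]
    refine (enorm_integral_le_lintegral_enorm _).trans ?_
    rw [← eLpNorm_one_eq_lintegral_enorm]
    exact (eLpNorm_le_eLpNorm_of_exponent_le (by norm_num) hgs).trans hs.le
  calc _ ≤ ε / 3 + (ε / 3 + ε / 3) := by
        refine (eLpNorm_add_le hm1 (hm2.add aestronglyMeasurable_const) (by norm_num)).trans ?_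
        gcongr
        · exact (eLpNorm_integral_kernel_le hinvn hgs).trans hs.le
        · exact (eLpNorm_add_le hm2 aestronglyMeasurable_const (by norm_num)).trans
            (add_le_add hn h3)
    _ = ε := by rw [← add_assoc]; exact ENNReal.add_thirds ε

theorem tendsto_eLpNorm_average_sub_of_mixing {κ : Kernel α α} [IsMarkovKernel κ] {π : Measure α}
    [IsProbabilityMeasure π] (h : κ.Invariant π)
    (hmix : ∀ φ : α → ℝ, Measurable φ → (∀ x, |φ x| ≤ 1) → ∀ x,
      Tendsto (fun n => ∫ y, φ y ∂((κ ^ n) x)) atTop (𝓝 (∫ y, φ y ∂π)))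
    {g : α → ℝ} (hg : MemLp g 2 π) :
    Tendsto (fun N : ℕ => eLpNorm (fun x => (N : ℝ)⁻¹ * (∑ n ∈ Finset.range N,
      ∫ y, g y ∂((κ ^ n) x)) - ∫ y, g y ∂π) 2 π) atTop (𝓝 0) := by
  set c := ∫ y, g y ∂π with hc
  set F : ℕ → α → ℝ := fun n x => (∫ y, g y ∂((κ ^ n) x)) - c with hF
  have hFm : ∀ n, AEStronglyMeasurable (F n) π := fun n =>
    (aestronglyMeasurable_integral_of_invariant (invariant_pow h n) hg.1).sub
      aestronglyMeasurable_const
  have hFtop : ∀ n, eLpNorm (F n) 2 π ≠ ∞ := fun n => by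
    refine (MemLp.sub (f := fun x => ∫ y, g y ∂((κ ^ n) x)) (g := fun _ => c) ⟨?_, ?_⟩
      (memLp_const c)).2.ne
    · exact aestronglyMeasurable_integral_of_invariant (invariant_pow h n) hg.1
    · exact (eLpNorm_integral_kernel_le (invariant_pow h n) hg.1).trans_lt hg.2
  have h0 := tendsto_eLpNorm_pow_sub_of_mixing h hmix hg
  have h1 : Tendsto (fun n => (eLpNorm (F n) 2 π).toReal) atTop (𝓝 0) := by
    have := (ENNReal.tendsto_toReal ENNReal.zero_ne_top).comp h0
    simpa [Function.comp_def] using this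
  have h2 := ENNReal.tendsto_ofReal h1.cesaro
  rw [ENNReal.ofReal_zero] at h2
  refine tendsto_of_tendsto_of_tendsto_of_le_of_le' tendsto_const_nhds h2
    (Eventually.of_forall fun _ => zero_le) ?_
  filter_upwards [eventually_gt_atTop 0] with N hN
  have hN' : (N : ℝ) ≠ 0 := by positivity
  have h3 : (fun x => (N : ℝ)⁻¹ * (∑ n ∈ Finset.range N, ∫ y, g y ∂((κ ^ n) x)) - c)
      = (N : ℝ)⁻¹ • ∑ n ∈ Finset.range N, F n := by
    ext x
    simp only [Pi.smul_apply, Finset.sum_apply, hF, Finset.sum_sub_distrib, Finset.sum_const,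
      Finset.card_range, nsmul_eq_mul, smul_eq_mul]
    field_simp
  rw [h3, eLpNorm_const_smul, ENNReal.ofReal_mul (by positivity),
    ENNReal.ofReal_sum_of_nonneg (fun i _ => ENNReal.toReal_nonneg)]
  have h4 : ‖(N : ℝ)⁻¹‖ₑ = ENNReal.ofReal (N : ℝ)⁻¹ := by
    rw [← ofReal_norm, Real.norm_of_nonneg (by positivity)]
  rw [h4]
  gcongr
  refine (eLpNorm_sum_le (fun n _ => hFm n) (by norm_num)).trans (le_of_eq ?_)
  exact Finset.sum_congr rfl fun n _ => (ENNReal.ofReal_toReal (hFtop n)).symm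

end MeanErgodic

/-! ### The Hamiltonian flow -/

theorem abs_le_of_langevinEnergy_le {υ E p q : ℝ} (h : langevinEnergy υ p q ≤ E) :
    |p| ≤ 2 * (1 + E) ∧ |q| ≤ 2 * (1 + E) := by
  have h1 := le_langevinEnergy υ p q
  have hE : 0 ≤ E := (langevinEnergy_nonneg υ p q).trans h
  have hp : p ^ 2 ≤ (2 * (1 + E)) ^ 2 := by nlinarith [sq_nonneg (q ^ 2)]
  have hq : (q ^ 2) ^ 2 ≤ ((2 * (1 + E)) ^ 2) ^ 2 := by
    have h2 : q ^ 4 ≤ 8 * E := by nlinarith [sq_nonneg p]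
    have h3 : 1 ≤ (1 + E) ^ 2 := by nlinarith
    have h4 : (1 + E) ^ 2 ≤ ((1 + E) ^ 2) ^ 2 := by nlinarith
    nlinarith
  exact ⟨abs_le_of_sq_le_sq hp (by positivity),
    abs_le_of_sq_le_sq (abs_le_of_sq_le_sq' hq (by positivity)).2 (by positivity)⟩

/-- The Hamiltonian vector field. -/
noncomputable def hamiltonianField (υ : ℝ) (z : ℝ × ℝ) : ℝ × ℝ :=
  (-(υ / 2) * z.1 - z.2 ^ 3, z.1 + υ / 2 * z.2)

theorem lipschitzOnWith_hamiltonianField {υ B : ℝ} (hυ : 0 ≤ υ) (hB : 0 ≤ B) :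
    LipschitzOnWith (υ / 2 + 3 * B ^ 2 + 1).toNNReal (hamiltonianField υ) {z | |z.2| ≤ B} := by
  refine LipschitzOnWith.of_dist_le_mul fun x hx y hy => ?_
  rw [Real.coe_toNNReal _ (by positivity)]
  set d := dist x y with hd
  have hd0 : 0 ≤ d := dist_nonneg
  have h1 : |x.1 - y.1| ≤ d := by rw [← Real.dist_eq]; exact le_max_left _ _
  have h2 : |x.2 - y.2| ≤ d := by rw [← Real.dist_eq]; exact le_max_right _ _
  have hx' : |x.2| ≤ B := hx
  have hy' : |y.2| ≤ B := hy
  have hcube : |x.2 ^ 3 - y.2 ^ 3| ≤ 3 * B ^ 2 * d := by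
    have e1 : x.2 ^ 3 - y.2 ^ 3 = (x.2 ^ 2 + x.2 * y.2 + y.2 ^ 2) * (x.2 - y.2) := by ring
    rw [e1, abs_mul]
    refine mul_le_mul ?_ h2 (abs_nonneg _) (by positivity)
    have ex : x.2 ^ 2 ≤ B ^ 2 := sq_le_sq.2 (by rwa [abs_of_nonneg hB])
    have ey : y.2 ^ 2 ≤ B ^ 2 := sq_le_sq.2 (by rwa [abs_of_nonneg hB])
    rw [abs_le]
    constructor <;> nlinarith [sq_nonneg (x.2 + y.2), sq_nonneg (x.2 - y.2)]
  have hυd : υ / 2 * |x.1 - y.1| ≤ υ / 2 * d := mul_le_mul_of_nonneg_left h1 (by positivity)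
  have hυd2 : υ / 2 * |x.2 - y.2| ≤ υ / 2 * d := mul_le_mul_of_nonneg_left h2 (by positivity)
  have hBd : 0 ≤ 3 * B ^ 2 * d := by positivity
  rw [Prod.dist_eq, max_le_iff]
  constructor
  · rw [Real.dist_eq]
    have e1 : (hamiltonianField υ x).1 - (hamiltonianField υ y).1
        = -(υ / 2 * (x.1 - y.1)) - (x.2 ^ 3 - y.2 ^ 3) := by simp only [hamiltonianField]; ring
    rw [e1]
    refine (abs_sub _ _).trans ?_
    rw [abs_neg, abs_mul, abs_of_nonneg (by positivity : 0 ≤ υ / 2)]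
    linarith
  · rw [Real.dist_eq]
    have e1 : (hamiltonianField υ x).2 - (hamiltonianField υ y).2
        = (x.1 - y.1) + υ / 2 * (x.2 - y.2) := by simp only [hamiltonianField]; ring
    rw [e1]
    refine (abs_add_le _ _).trans ?_
    rw [abs_mul, abs_of_nonneg (by positivity : 0 ≤ υ / 2)]
    linarith

/-- The Lipschitz constant of the Hamiltonian field on an energy sublevel set. -/
noncomputable def energyLipschitz (υ E : ℝ) : ℝ := υ / 2 + 3 * (2 * (1 + E)) ^ 2 + 1

/-- The cubic field is only locally Lipschitz, but energy conservation confines both paths to `|q| ≤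
2 (1 + E)`, where Grönwall's inequality applies. Uniqueness and continuity of the flow follow from
it. -/
theorem IsHamiltonianPath.dist_le {υ τ E : ℝ} {p q p' q' : ℝ → ℝ} (hυ : 0 ≤ υ)
    (h : IsHamiltonianPath υ 0 τ p q) (h' : IsHamiltonianPath υ 0 τ p' q')
    (hE : langevinEnergy υ (p 0) (q 0) ≤ E) (hE' : langevinEnergy υ (p' 0) (q' 0) ≤ E)
    {t : ℝ} (ht : t ∈ Icc 0 τ) :
    dist (p t, q t) (p' t, q' t)
      ≤ dist (p 0, q 0) (p' 0, q' 0) * Real.exp (energyLipschitz υ E * t) := by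
  have hE0 : 0 ≤ E := (langevinEnergy_nonneg υ _ _).trans hE
  have key : ∀ {p q : ℝ → ℝ}, IsHamiltonianPath υ 0 τ p q → langevinEnergy υ (p 0) (q 0) ≤ E →
      ContinuousOn (fun t => (p t, q t)) (Icc 0 τ) ∧
      (∀ t ∈ Ico 0 τ, HasDerivWithinAt (fun t => (p t, q t)) (hamiltonianField υ (p t, q t))
        (Ici t) t) ∧ ∀ t ∈ Ico 0 τ, (p t, q t) ∈ {z : ℝ × ℝ | |z.2| ≤ 2 * (1 + E)} := by
    intro p q h hE
    refine ⟨fun t ht => ((h.1 t ht).continuousWithinAt).prodMk ((h.2 t ht).continuousWithinAt),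
      fun t ht => ?_, fun t ht => ?_⟩
    · have ht' := Ico_subset_Icc_self ht
      exact ((h.1 t ht').prodMk (h.2 t ht')).mono_of_mem_nhdsWithin (Icc_mem_nhdsGE_of_mem ht)
    · refine (abs_le_of_langevinEnergy_le (υ := υ) (p := p t) ?_).2
      rw [h.langevinEnergy_eq (Ico_subset_Icc_self ht)]; exact hE
  obtain ⟨c1, d1, m1⟩ := key h hE
  obtain ⟨c2, d2, m2⟩ := key h' hE'
  have := dist_le_of_trajectories_ODE_of_mem (v := fun _ => hamiltonianField υ)
    (s := fun _ => {z : ℝ × ℝ | |z.2| ≤ 2 * (1 + E)})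
    (fun t _ => lipschitzOnWith_hamiltonianField hυ (by positivity)) c1 d1 m1 c2 d2 m2 le_rfl t ht
  rwa [Real.coe_toNNReal _ (by positivity), sub_zero] at this

theorem isHamiltonianPath_zero (υ a b : ℝ) :
    IsHamiltonianPath υ a b (fun _ => 0) (fun _ => 0) := by
  constructor <;> intro t _ <;> simpa using hasDerivWithinAt_const t _ (0 : ℝ)

theorem IsHamiltonianPath.shift {υ b τ : ℝ} {p q : ℝ → ℝ}
    (h : IsHamiltonianPath υ b (b + τ) p q) :
    IsHamiltonianPath υ 0 τ (fun t => p (b + t)) (fun t => q (b + t)) := by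
  have hmaps : MapsTo (fun t : ℝ => b + t) (Icc 0 τ) (Icc b (b + τ)) := fun t ht =>
    ⟨by linarith [ht.1], by linarith [ht.2]⟩
  have hd : ∀ t, HasDerivWithinAt (fun t : ℝ => b + t) 1 (Icc 0 τ) t := fun t =>
    ((hasDerivAt_id t).const_add b).hasDerivWithinAt
  constructor
  · intro t ht
    simpa [Function.comp_def] using (h.1 (b + t) (hmaps ht)).comp t (hd t) hmaps
  · intro t ht
    simpa [Function.comp_def] using (h.2 (b + t) (hmaps ht)).comp t (hd t) hmaps

/-- `Φ` is the time-`τ` map of the Hamiltonian system. -/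
def IsHamiltonianFlow (υ τ : ℝ) (Φ : ℝ × ℝ → ℝ × ℝ) : Prop :=
  ∀ x : ℝ × ℝ, ∃ p q : ℝ → ℝ, IsHamiltonianPath υ 0 τ p q ∧ p 0 = x.1 ∧ q 0 = x.2 ∧
    Φ x = (p τ, q τ)

namespace IsHamiltonianFlow

variable {υ τ : ℝ} {Φ : ℝ × ℝ → ℝ × ℝ}

theorem dist_le (hΦ : IsHamiltonianFlow υ τ Φ) (hυ : 0 ≤ υ) (hτ : 0 ≤ τ) {E : ℝ} {x y : ℝ × ℝ}
    (hx : langevinEnergy υ x.1 x.2 ≤ E) (hy : langevinEnergy υ y.1 y.2 ≤ E) :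
    dist (Φ x) (Φ y) ≤ dist x y * Real.exp (energyLipschitz υ E * τ) := by
  obtain ⟨p, q, h, hp, hq, e⟩ := hΦ x
  obtain ⟨p', q', h', hp', hq', e'⟩ := hΦ y
  have := h.dist_le hυ h' (E := E) (by rwa [hp, hq]) (by rwa [hp', hq']) ⟨hτ, le_rfl⟩
  rw [e, e']
  rwa [hp, hq, hp', hq'] at this

theorem apply_eq (hΦ : IsHamiltonianFlow υ τ Φ) (hυ : 0 ≤ υ) (hτ : 0 ≤ τ) {p q : ℝ → ℝ}
    (h : IsHamiltonianPath υ 0 τ p q) : Φ (p 0, q 0) = (p τ, q τ) := by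
  obtain ⟨p', q', h', hp', hq', e'⟩ := hΦ (p 0, q 0)
  have := h.dist_le hυ h' le_rfl (by rw [hp', hq']) ⟨hτ, le_rfl⟩
  rw [hp', hq', dist_self, zero_mul] at this
  rw [e']
  exact (dist_le_zero.1 this).symm

theorem langevinEnergy_eq (hΦ : IsHamiltonianFlow υ τ Φ) (hτ : 0 ≤ τ) (x : ℝ × ℝ) :
    langevinEnergy υ (Φ x).1 (Φ x).2 = langevinEnergy υ x.1 x.2 := by
  obtain ⟨p, q, h, hp, hq, e⟩ := hΦ x
  rw [e, ← hp, ← hq]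
  exact h.langevinEnergy_eq ⟨hτ, le_rfl⟩

theorem continuous (hΦ : IsHamiltonianFlow υ τ Φ) (hυ : 0 ≤ υ) (hτ : 0 ≤ τ) :
    Continuous Φ := by
  rw [continuous_iff_continuousAt]
  intro x
  have hc : Continuous fun y : ℝ × ℝ => langevinEnergy υ y.1 y.2 := by
    unfold langevinEnergy langevinH; fun_prop
  set E := langevinEnergy υ x.1 x.2 + 1 with hE
  have hev : ∀ᶠ y in 𝓝 x, langevinEnergy υ y.1 y.2 < E :=
    hc.continuousAt.eventually_lt_const (by rw [hE]; linarith)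
  rw [ContinuousAt, tendsto_iff_dist_tendsto_zero]
  have hlim : Tendsto (fun y => dist y x * Real.exp (energyLipschitz υ E * τ)) (𝓝 x) (𝓝 0) := by
    have : Tendsto (fun y => dist y x) (𝓝 x) (𝓝 0) := by
      have h2 : Continuous fun y => dist y x := by fun_prop
      simpa using h2.tendsto x
    simpa using this.mul_const (Real.exp (energyLipschitz υ E * τ))
  refine squeeze_zero' (Eventually.of_forall fun _ => dist_nonneg) ?_ hlim
  filter_upwards [hev] with y hy
  exact hΦ.dist_le hυ hτ hy.le (by rw [hE]; linarith)

theorem apply_zero (hΦ : IsHamiltonianFlow υ τ Φ) (hυ : 0 ≤ υ) (hτ : 0 ≤ τ) :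
    Φ (0, 0) = (0, 0) :=
  hΦ.apply_eq hυ hτ (isHamiltonianPath_zero υ 0 τ)

/-- As long as `|q| ≤ υ / 2`, a path that starts at `q = 0` with nonzero momentum moves away. -/
theorem exists_position_ne_zero (hΦ : IsHamiltonianFlow υ τ Φ) (hυ : 0 < υ) (hτ : 0 < τ) :
    ∃ p : ℝ, 0 < p ∧ (Φ (p, 0)).2 ≠ 0 := by
  set E : ℝ := 1 / 2 + υ ^ 4 / 8 with hE
  set L := energyLipschitz υ E with hL
  have hL0 : 0 ≤ L := by rw [hL, energyLipschitz, hE]; positivity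
  -- Comparison with the zero solution keeps `|q| ≤ υ / 2` up to time `τ` for this momentum; the
  -- bound by `1` places the path in the energy sublevel whose Lipschitz constant is `L`.
  set p₀ : ℝ := min 1 (υ / 2 * Real.exp (-(L * τ))) with hp₀
  have hp0 : 0 < p₀ := lt_min one_pos (by positivity)
  have hp1 : p₀ ≤ 1 := min_le_left _ _
  have hp2 : p₀ ≤ υ / 2 * Real.exp (-(L * τ)) := min_le_right _ _
  refine ⟨p₀, hp0, fun hzero => ?_⟩
  obtain ⟨p, q, h, hp, hq, e⟩ := hΦ (p₀, 0)
  simp only at hp hq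
  have hqτ : q τ = 0 := by rw [e] at hzero; exact hzero
  have hen1 : langevinEnergy υ (p 0) (q 0) ≤ E := by
    rw [hp, hq, langevinEnergy, langevinH, hE]; nlinarith
  have hen0 : langevinEnergy υ 0 0 ≤ E := by
    rw [langevinEnergy, langevinH, hE]; simp
  have hsmall : ∀ t ∈ Icc 0 τ, |q t| ≤ υ / 2 := by
    intro t ht
    have h1 := h.dist_le hυ.le (isHamiltonianPath_zero υ 0 τ) hen1 hen0 ht
    have h2 : dist (p 0, q 0) ((0 : ℝ), (0 : ℝ)) = p₀ := by
      rw [hp, hq, Prod.dist_eq]; simp [hp0.le, abs_of_pos hp0]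
    rw [h2, ← hL] at h1
    have h3 : |q t| ≤ dist (p t, q t) ((0 : ℝ), (0 : ℝ)) := by
      rw [Prod.dist_eq]; simp
    have h4 : Real.exp (L * t) ≤ Real.exp (L * τ) :=
      Real.exp_le_exp.2 (mul_le_mul_of_nonneg_left ht.2 hL0)
    calc |q t| ≤ p₀ * Real.exp (L * t) := h3.trans h1
      _ ≤ υ / 2 * Real.exp (-(L * τ)) * Real.exp (L * τ) := by gcongr
      _ = υ / 2 := by rw [mul_assoc, ← Real.exp_add]; simp
  have hmono : ∀ {f f' : ℝ → ℝ}, (∀ t ∈ Icc 0 τ, HasDerivWithinAt f (f' t) (Icc 0 τ) t) →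
      (∀ t ∈ Icc 0 τ, 0 ≤ f' t) → MonotoneOn f (Icc 0 τ) := by
    intro f f' hf hf'
    refine monotoneOn_of_hasDerivWithinAt_nonneg (f' := f') (convex_Icc 0 τ)
      (fun t ht => (hf t ht).continuousWithinAt) (fun t ht => ?_) (fun t ht => ?_)
    · exact (hf t (interior_subset ht)).mono interior_subset
    · exact hf' t (interior_subset ht)
  -- Near the unstable equilibrium `q · q'` is nondecreasing and starts at `0`, so `q ^ 2` is
  -- nondecreasing. A return to `0` at time `τ` would force `q = 0` throughout, against `q'(0) = p₀
  -- > 0`.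
  have hqv : MonotoneOn (fun t => q t * (p t + υ / 2 * q t)) (Icc 0 τ) := by
    refine hmono (f' := fun t => (p t + υ / 2 * q t) ^ 2 + q t ^ 2 * ((υ / 2) ^ 2 - q t ^ 2))
      (fun t ht => ?_) (fun t ht => ?_)
    · have := (h.2 t ht).mul ((h.1 t ht).add ((h.2 t ht).const_mul (υ / 2)))
      refine this.congr_deriv ?_
      simp only [Pi.add_apply]
      ring
    · have h1 : q t ^ 2 ≤ (υ / 2) ^ 2 :=
        sq_le_sq.2 (by rw [abs_of_pos (by positivity : 0 < υ / 2)]; exact hsmall t ht)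
      have := mul_nonneg (sq_nonneg (q t)) (sub_nonneg.2 h1)
      positivity
  have h0mem : (0 : ℝ) ∈ Icc 0 τ := ⟨le_rfl, hτ.le⟩
  have hqv0 : ∀ t ∈ Icc 0 τ, 0 ≤ q t * (p t + υ / 2 * q t) := fun t ht => by
    have := hqv h0mem ht ht.1
    simpa [hq] using this
  have hsq : MonotoneOn (fun t => q t ^ 2) (Icc 0 τ) := by
    refine hmono (f' := fun t => 2 * (q t * (p t + υ / 2 * q t))) (fun t ht => ?_) (fun t ht => ?_)
    · refine ((h.2 t ht).pow 2).congr_deriv ?_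
      push_cast; ring
    · have := hqv0 t ht; positivity
  have hq0 : ∀ t ∈ Icc 0 τ, q t = 0 := fun t ht => by
    have h1 := hsq ht ⟨hτ.le, le_rfl⟩ ht.2
    simp only [hqτ] at h1
    nlinarith [sq_nonneg (q t)]
  have hd1 : HasDerivWithinAt q p₀ (Icc 0 τ) 0 := by
    have := h.2 0 h0mem
    rwa [hp, hq, mul_zero, add_zero] at this
  have hd2 : HasDerivWithinAt q 0 (Icc 0 τ) 0 :=
    (hasDerivWithinAt_const 0 _ (0 : ℝ)).congr hq0 (hq0 0 h0mem)
  have := (uniqueDiffOn_Icc hτ 0 h0mem).eq_deriv _ hd1 hd2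
  linarith

/-- The homoclinic orbit of the double well. -/
theorem isHamiltonianPath_homoclinic {A : ℝ} (hA : A ^ 2 = υ ^ 2 / 2) (y : ℝ) (a b : ℝ) :
    IsHamiltonianPath υ a b
      (fun t => -(2 * υ * A) * ((y * Real.exp (-(υ / 2) * t))
        / (1 + (y * Real.exp (-(υ / 2) * t)) ^ 2) ^ 2))
      (fun t => 2 * A * ((y * Real.exp (-(υ / 2) * t))
        / (1 + (y * Real.exp (-(υ / 2) * t)) ^ 2))) := by
  have hz : ∀ t : ℝ, HasDerivAt (fun t => y * Real.exp (-(υ / 2) * t))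
      (-(υ / 2) * (y * Real.exp (-(υ / 2) * t))) t := fun t => by
    have h1 := (((hasDerivAt_id t).const_mul (-(υ / 2))).exp).const_mul y
    refine h1.congr_deriv ?_
    simp only [id]
    ring
  have hne : ∀ z : ℝ, 1 + z ^ 2 ≠ 0 := fun z => by positivity
  constructor
  · intro t _
    have hn := hne (y * Real.exp (-(υ / 2) * t))
    have h1 := ((hz t).div ((((hz t).pow 2).const_add 1).pow 2) (pow_ne_zero 2 hn)).const_mul
      (-(2 * υ * A))
    refine h1.hasDerivWithinAt.congr_deriv ?_
    simp only [Pi.pow_apply]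
    generalize y * Real.exp (-(υ / 2) * t) = z at hn
    have hA3 : A ^ 3 = A * (υ ^ 2 / 2) := by rw [← hA]; ring
    have e : (2 * A * (z / (1 + z ^ 2))) ^ 3 = 8 * A ^ 3 * (z / (1 + z ^ 2)) ^ 3 := by ring
    rw [e, hA3]
    field_simp
    push_cast
    ring
  · intro t _
    have hn := hne (y * Real.exp (-(υ / 2) * t))
    have h1 := ((hz t).div (((hz t).pow 2).const_add 1) hn).const_mul (2 * A)
    refine h1.hasDerivWithinAt.congr_deriv ?_
    simp only [Pi.pow_apply]
    generalize y * Real.exp (-(υ / 2) * t) = z at hn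
    field_simp
    push_cast
    ring

/-- With a suitable momentum the position does not move away from the origin. -/
theorem exists_abs_position_le (hΦ : IsHamiltonianFlow υ τ Φ) (hυ : 0 < υ) (hτ : 0 < τ) (q : ℝ) :
    ∃ p : ℝ, |(Φ (p, q)).2| ≤ |q| := by
  rcases le_total (υ / 2) |q| with hq | hq
  -- Zero velocity: all energy is potential, and the double well `q ^ 4 / 4 - υ ^ 2 q ^ 2 / 8`
  -- increases in `|q|` beyond `υ / 2`, so larger `|q|` is unreachable.
  · refine ⟨-(υ / 2) * q, ?_⟩
    have h1 := hΦ.langevinEnergy_eq hτ.le (-(υ / 2) * q, q)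
    set z := Φ (-(υ / 2) * q, q) with hz
    simp only [langevinEnergy, langevinH] at h1
    have h2 : (υ / 2) ^ 2 ≤ q ^ 2 := sq_le_sq.2 (by rwa [abs_of_pos (by positivity : 0 < υ / 2)])
    refine sq_le_sq.1 ?_
    by_contra hlt
    push Not at hlt
    have h3 : 0 < (z.2 ^ 2 - q ^ 2) * (z.2 ^ 2 + q ^ 2 - υ ^ 2 / 2) :=
      mul_pos (by linarith) (by nlinarith)
    nlinarith [sq_nonneg (z.1 + υ / 2 * z.2)]
  -- Inside the wells one starts on the homoclinic orbit, which runs into the origin. Its position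
  -- `2 A y / (1 + y ^ 2)` takes all values in `[0, A]` for `y ∈ [0, 1]`, and `A ≥ υ / 2`; along the
  -- flow `y` decreases, and so does the position.
  · set A : ℝ := υ / √2 with hA
    have hA0 : 0 < A := by positivity
    have hA2 : A ^ 2 = υ ^ 2 / 2 := by rw [hA, div_pow, Real.sq_sqrt two_pos.le]
    have hqA : |q| ≤ A := by
      refine hq.trans (abs_le_of_sq_le_sq' ?_ hA0.le).2
      rw [hA2]; nlinarith
    have hcont : ContinuousOn (fun y : ℝ => 2 * A * (y / (1 + y ^ 2))) (Icc 0 1) := by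
      refine Continuous.continuousOn ?_
      refine continuous_const.mul (continuous_id.div (by fun_prop) fun y => ?_)
      positivity
    have hIVT := intermediate_value_Icc zero_le_one hcont
    have hmem : |q| ∈ Icc (2 * A * (0 / (1 + 0 ^ 2))) (2 * A * (1 / (1 + 1 ^ 2))) := by
      constructor
      · simp
      · norm_num; linarith
    obtain ⟨y, hy, hyq⟩ := hIVT hmem
    simp only at hyq
    -- The orbit equation fixes only the square of the amplitude, so the sign `s` selects the well
    -- that contains `q`.
    obtain ⟨s, hs, hsq⟩ : ∃ s : ℝ, s ^ 2 = 1 ∧ s * |q| = q := by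
      rcases le_total 0 q with h | h
      · exact ⟨1, by norm_num, by rw [abs_of_nonneg h, one_mul]⟩
      · exact ⟨-1, by norm_num, by rw [abs_of_nonpos h]; ring⟩
    have hsA : (s * A) ^ 2 = υ ^ 2 / 2 := by rw [mul_pow, hs, hA2, one_mul]
    have h1 := hΦ.apply_eq hυ.le hτ.le (isHamiltonianPath_homoclinic hsA y 0 τ)
    simp only [mul_zero, Real.exp_zero, mul_one] at h1
    have h2 : 2 * (s * A) * (y / (1 + y ^ 2)) = q := by rw [← hsq, ← hyq]; ring
    rw [h2] at h1
    refine ⟨-(2 * υ * (s * A)) * (y / (1 + y ^ 2) ^ 2), ?_⟩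
    rw [h1]
    simp only
    set y₁ := y * Real.exp (-(υ / 2) * τ) with hy₁
    have hy₁0 : 0 ≤ y₁ := mul_nonneg hy.1 (Real.exp_pos _).le
    have hy₁y : y₁ ≤ y := mul_le_of_le_one_right hy.1 (Real.exp_le_one_iff.2 (by nlinarith))
    have h3 : y₁ / (1 + y₁ ^ 2) ≤ y / (1 + y ^ 2) := by
      rw [div_le_div_iff₀ (by positivity) (by positivity)]
      nlinarith [mul_nonneg (sub_nonneg.2 hy₁y)
        (sub_nonneg.2 (mul_le_one₀ hy.2 hy₁0 (hy₁y.trans hy.2)))]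
    have hsabs : |s| = 1 := by
      rw [← Real.sqrt_sq_eq_abs, hs, Real.sqrt_one]
    rw [← hyq, abs_mul, abs_mul, abs_mul, hsabs, one_mul, abs_of_pos hA0, abs_two,
      abs_of_nonneg (by positivity)]
    exact mul_le_mul_of_nonneg_left h3 (by positivity)

end IsHamiltonianFlow

/-! ### The kernel of the splitting chain and its minorization -/

/-- The density of the Gaussian law with mean `b` and variance `v` is bounded below on `[-R, R]`,
uniformly in `b ∈ [-R, R]`. -/
theorem exists_lintegral_gaussianReal_ge {v : ℝ≥0} (hv : v ≠ 0) (R : ℝ) :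
    ∃ m : ℝ, 0 < m ∧ ∀ b : ℝ, |b| ≤ R → ∀ f : ℝ → ℝ≥0∞, Measurable f →
      ENNReal.ofReal m * ∫⁻ z in Icc (-R) R, f z ≤ ∫⁻ w, f (b + w) ∂gaussianReal 0 v := by
  have hv0 : (0 : ℝ) < v := NNReal.coe_pos.2 (pos_iff_ne_zero.2 hv)
  refine ⟨(√(2 * Real.pi * v))⁻¹ * Real.exp (-(2 * R) ^ 2 / (2 * v)), by positivity,
    fun b hb f hf => ?_⟩
  have h1 : ∫⁻ w, f (b + w) ∂gaussianReal 0 v = ∫⁻ w, f w ∂gaussianReal b v := by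
    rw [← lintegral_map hf (measurable_const_add b), gaussianReal_map_const_add, zero_add]
  rw [h1, gaussianReal_of_var_ne_zero _ hv,
    lintegral_withDensity_eq_lintegral_mul _ (measurable_gaussianPDF b v) hf,
    ← lintegral_const_mul _ hf]
  refine (setLIntegral_mono' measurableSet_Icc fun z hz => ?_).trans (setLIntegral_le_lintegral _ _)
  refine mul_le_mul' (ENNReal.ofReal_le_ofReal ?_) le_rfl
  rw [gaussianPDFReal]
  refine mul_le_mul_of_nonneg_left (Real.exp_le_exp.2 ?_) (by positivity)
  refine div_le_div_of_nonneg_right (neg_le_neg ?_) (by positivity)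
  rw [abs_le] at hb
  exact sq_le_sq' (by linarith [hz.1, hz.2]) (by linarith [hz.1, hz.2])

/-- A `K`-Lipschitz map enlarges one-dimensional Hausdorff measure by at most the factor `K`. Thus
the image of Lebesgue measure has density at least `1 / K` on whatever is covered, without any
derivative or injectivity of the map. -/
theorem lintegral_le_of_lipschitzOnWith {f : ℝ → ℝ} {K : ℝ≥0} {s J : Set ℝ}
    (hf : LipschitzOnWith K f s) (hfm : Measurable f) (hJ : J ⊆ f '' s)
    {g : ℝ → ℝ≥0∞} (hg : Measurable g) :
    ∫⁻ y in J, g y ≤ K * ∫⁻ x in s, g (f x) := by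
  have h : volume.restrict J ≤ (K : ℝ≥0∞) • (volume.restrict s).map f := by
    refine Measure.le_iff.2 fun A hA => ?_
    rw [Measure.restrict_apply hA, Measure.smul_apply, Measure.map_apply hfm hA,
      Measure.restrict_apply (hfm hA), smul_eq_mul]
    have h1 : A ∩ J ⊆ f '' (f ⁻¹' A ∩ s) := by
      rintro y ⟨hyA, hyJ⟩
      obtain ⟨x, hx, rfl⟩ := hJ hyJ
      exact ⟨x, ⟨hyA, hx⟩, rfl⟩
    refine (measure_mono h1).trans ?_
    have h2 := (hf.mono (inter_subset_right : f ⁻¹' A ∩ s ⊆ s)).hausdorffMeasure_image_le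
      zero_le_one
    simpa only [hausdorffMeasure_real, ENNReal.rpow_one] using h2
  refine (lintegral_mono' h le_rfl).trans ?_
  rw [lintegral_smul_measure, lintegral_map hg hfm, smul_eq_mul]

/-- The one-step kernel of the splitting chain: apply the Hamiltonian flow, contract by `a`, and
add a Gaussian variable of variance `v` to the momentum. -/
noncomputable def splittingKernel (a : ℝ) (v : ℝ≥0) (Φ : ℝ × ℝ → ℝ × ℝ) (hΦ : Measurable Φ) :
    Kernel (ℝ × ℝ) (ℝ × ℝ) :=
  ((Kernel.deterministic Φ hΦ) ×ₖ (Kernel.const _ (gaussianReal 0 v))).map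
    fun z => (a * z.1.1 + z.2, a * z.1.2)

section Kernel

variable {a : ℝ} {v : ℝ≥0} {Φ : ℝ × ℝ → ℝ × ℝ} {hΦ : Measurable Φ}

instance isMarkovKernel_splittingKernel : IsMarkovKernel (splittingKernel a v Φ hΦ) :=
  Kernel.IsMarkovKernel.map _ (by fun_prop)

theorem lintegral_splittingKernel (x : ℝ × ℝ) {f : ℝ × ℝ → ℝ≥0∞} (hf : Measurable f) :
    ∫⁻ y, f y ∂(splittingKernel a v Φ hΦ x)
      = ∫⁻ w, f (a * (Φ x).1 + w, a * (Φ x).2) ∂gaussianReal 0 v := by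
  have hg : Measurable fun z : (ℝ × ℝ) × ℝ => (a * z.1.1 + z.2, a * z.1.2) := by fun_prop
  rw [splittingKernel, Kernel.map_apply _ hg, lintegral_map hf hg, Kernel.prod_apply,
    Kernel.deterministic_apply, Kernel.const_apply,
    lintegral_prod (fun z : (ℝ × ℝ) × ℝ => f (a * z.1.1 + z.2, a * z.1.2))
      (hf.comp hg).aemeasurable, lintegral_dirac' _ ?_]
  exact Measurable.lintegral_prod_right' (hf.comp hg)

/-- The energy step inequality is integrated: the linear noise term has mean zero and the quadratic
one contributes `v / 2`. -/
theorem lintegral_langevinEnergy_splittingKernel_le {υ τ : ℝ} (hf : IsHamiltonianFlow υ τ Φ)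
    (hτ : 0 ≤ τ) (ha : 0 ≤ a) (ha1 : a ≤ 1) (x : ℝ × ℝ) :
    ∫⁻ y, ENNReal.ofReal (langevinEnergy υ y.1 y.2) ∂(splittingKernel a v Φ hΦ x)
      ≤ ENNReal.ofReal (a ^ 2 * langevinEnergy υ x.1 x.2 + (υ ^ 4 / 8 * (1 - a ^ 2) + v / 2)) := by
  rw [lintegral_splittingKernel x (measurable_langevinEnergy υ).ennreal_ofReal]
  set b := a ^ 2 * langevinEnergy υ x.1 x.2 + υ ^ 4 / 8 * (1 - a ^ 2) with hb
  set d := a * ((Φ x).1 + υ / 2 * (Φ x).2)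
  have hi1 : Integrable (fun w : ℝ => w) (gaussianReal 0 v) := by
    simpa using integrable_pow_gaussianReal v 1
  have hi2 := integrable_pow_gaussianReal v 2
  have hi3 : Integrable (fun w : ℝ => d * w + w ^ 2 / 2) (gaussianReal 0 v) :=
    (hi1.const_mul d).add (hi2.div_const 2)
  have hint : Integrable (fun w : ℝ => b + (d * w + w ^ 2 / 2)) (gaussianReal 0 v) :=
    (integrable_const b).add hi3
  have hle : ∀ w : ℝ, langevinEnergy υ (a * (Φ x).1 + w) (a * (Φ x).2)
      ≤ b + (d * w + w ^ 2 / 2) := fun w => by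
    rw [hb, ← hf.langevinEnergy_eq hτ x]
    exact langevinEnergy_step_le ha ha1 _ _ _
  calc _ ≤ ∫⁻ w, ENNReal.ofReal (b + (d * w + w ^ 2 / 2)) ∂gaussianReal 0 v :=
        lintegral_mono fun w => ENNReal.ofReal_le_ofReal (hle w)
    _ = ENNReal.ofReal (∫ w, (b + (d * w + w ^ 2 / 2)) ∂gaussianReal 0 v) :=
        (ofReal_integral_eq_lintegral_ofReal hint
          (ae_of_all _ fun w => (langevinEnergy_nonneg υ _ _).trans (hle w))).symm
    _ = _ := by
        congr 1
        rw [integral_add (integrable_const b) hi3,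
          integral_add (hi1.const_mul d) (hi2.div_const 2), integral_const_mul, integral_div,
          integral_sq_gaussianReal, integral_id_gaussianReal]
        simp [hb]; ring

theorem exists_lintegral_splittingKernel_ge (hv : v ≠ 0) (R : ℝ) :
    ∃ m : ℝ, 0 < m ∧ ∀ x, |a * (Φ x).1| ≤ R → ∀ f : ℝ × ℝ → ℝ≥0∞, Measurable f →
      ENNReal.ofReal m * ∫⁻ z in Icc (-R) R, f (z, a * (Φ x).2)
        ≤ ∫⁻ y, f y ∂(splittingKernel a v Φ hΦ x) := by
  obtain ⟨m, hm, h⟩ := exists_lintegral_gaussianReal_ge hv R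
  refine ⟨m, hm, fun x hx f hf => ?_⟩
  rw [lintegral_splittingKernel x hf]
  exact h _ hx (fun z => f (z, a * (Φ x).2)) (by fun_prop)

end Kernel

/-- Locally uniformly near `x`, the measure `κ y` dominates a positive multiple of `ν`. -/
def IsMinorizedNear {α : Type*} [TopologicalSpace α] [MeasurableSpace α] (κ : Kernel α α)
    (ν : Measure α) (x : α) : Prop :=
  ∃ c : ℝ, 0 < c ∧ ∀ᶠ y in 𝓝 x, ENNReal.ofReal c • ν ≤ κ y

theorem exists_forall_le_of_isMinorizedNear {α : Type*} [TopologicalSpace α] [MeasurableSpace α]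
    {κ : Kernel α α} {ν : Measure α} {K : Set α} (hK : IsCompact K)
    (h : ∀ x ∈ K, IsMinorizedNear κ ν x) :
    ∃ c : ℝ, 0 < c ∧ ∀ x ∈ K, ENNReal.ofReal c • ν ≤ κ x := by
  refine hK.induction_on (p := fun s => ∃ c : ℝ, 0 < c ∧ ∀ x ∈ s, ENNReal.ofReal c • ν ≤ κ x)
    ⟨1, one_pos, by simp⟩ ?_ ?_ ?_
  · rintro s t hst ⟨c, hc, h⟩
    exact ⟨c, hc, fun x hx => h x (hst hx)⟩
  · rintro s t ⟨c, hc, hs⟩ ⟨d, hd, ht⟩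
    have key : ∀ {e : ℝ}, min c d ≤ e → ENNReal.ofReal (min c d) • ν ≤ ENNReal.ofReal e • ν :=
      fun he => Measure.le_iff.2 fun A _ => mul_le_mul' (ENNReal.ofReal_le_ofReal he) le_rfl
    refine ⟨min c d, lt_min hc hd, fun x hx => ?_⟩
    rcases hx with hx | hx
    · exact (key (min_le_left _ _)).trans (hs x hx)
    · exact (key (min_le_right _ _)).trans (ht x hx)
  · intro x hx
    obtain ⟨c, hc, h⟩ := h x hx
    exact ⟨_, mem_nhdsWithin_of_mem_nhds h, c, hc, fun y hy => hy⟩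

/-! ### Minorization on energy sublevel sets. -/

section Minorization

variable {υ τ a : ℝ} {v : ℝ≥0} {Φ : ℝ × ℝ → ℝ × ℝ} {hΦm : Measurable Φ}

theorem eventually_abs_fst_le (hc : Continuous Φ) (a : ℝ) (x₀ : ℝ × ℝ) :
    ∀ᶠ x in 𝓝 x₀, |a * (Φ x).1| ≤ |a * (Φ x₀).1| + 1 := by
  have h : Continuous fun x => |a * (Φ x).1| := by fun_prop
  exact (h.continuousAt.eventually (gt_mem_nhds (lt_add_one _))).mono fun x hx => hx.le

/-- Propagation of a local minorization through one step of the splitting chain. -/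
theorem IsMinorizedNear.pow_succ_splittingKernel (hc : Continuous Φ) (hv : v ≠ 0)
    {ν : Measure (ℝ × ℝ)} {k : ℕ} {x₀ : ℝ × ℝ} {p₁ : ℝ}
    (h : IsMinorizedNear ((splittingKernel a v Φ hΦm) ^ k) ν (p₁, a * (Φ x₀).2)) :
    IsMinorizedNear ((splittingKernel a v Φ hΦm) ^ (k + 1)) ν x₀ := by
  set κ := splittingKernel a v Φ hΦm
  obtain ⟨c, hc0, h⟩ := h
  obtain ⟨η, hη, hball⟩ := Metric.eventually_nhds_iff.1 h
  have hη2 : 0 < η / 2 := half_pos hη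
  obtain ⟨m, hm, hge⟩ := exists_lintegral_splittingKernel_ge (a := a) (Φ := Φ) (hΦ := hΦm) hv
    (max (|a * (Φ x₀).1| + 1) (|p₁| + η / 2))
  set R := max (|a * (Φ x₀).1| + 1) (|p₁| + η / 2)
  refine ⟨m * (η * c), by positivity, ?_⟩
  have hev : ∀ᶠ x in 𝓝 x₀, dist (a * (Φ x).2) (a * (Φ x₀).2) < η := by
    have h2 : Continuous fun x => a * (Φ x).2 := by fun_prop
    exact Metric.continuousAt_iff'.1 h2.continuousAt η hη
  filter_upwards [eventually_abs_fst_le hc a x₀, hev] with x hx1 hx2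
  refine Measure.le_iff.2 fun A hA => ?_
  have hmeas : Measurable fun y => (κ ^ k) y A := Kernel.measurable_coe _ hA
  have hpow : (κ ^ (k + 1)) x A = ∫⁻ y, (κ ^ k) y A ∂(κ x) := by
    rw [pow_succ]
    exact Kernel.comp_apply' _ _ _ hA
  rw [hpow]
  refine le_trans ?_ (hge x (hx1.trans (le_max_left _ _)) _ hmeas)
  have hsub : Icc (p₁ - η / 2) (p₁ + η / 2) ⊆ Icc (-R) R := by
    have h1 : |p₁| + η / 2 ≤ R := le_max_right _ _
    have h2 := neg_abs_le p₁
    have h3 := le_abs_self p₁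
    exact Icc_subset_Icc (by linarith) (by linarith)
  -- The Gaussian charges every momentum window, in particular one about `p₁`; the position is close
  -- to its value for `x₀` by continuity of the flow. Hence a positive share of the mass lands where
  -- the hypothesis holds.
  have hlow : ∀ z ∈ Icc (p₁ - η / 2) (p₁ + η / 2),
      ENNReal.ofReal c * ν A ≤ (κ ^ k) (z, a * (Φ x).2) A := fun z hz => by
    have hd : dist (z, a * (Φ x).2) (p₁, a * (Φ x₀).2) < η := by
      rw [Prod.dist_eq]
      refine max_lt ?_ hx2
      rw [Real.dist_eq, abs_lt]
      constructor <;> linarith [hz.1, hz.2]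
    exact hball hd A
  rw [Measure.smul_apply, smul_eq_mul, ENNReal.ofReal_mul hm.le, mul_assoc]
  refine mul_le_mul' le_rfl ?_
  calc ENNReal.ofReal (η * c) * ν A
      = ∫⁻ _ in Icc (p₁ - η / 2) (p₁ + η / 2), ENNReal.ofReal c * ν A := by
        rw [setLIntegral_const, Real.volume_Icc, ENNReal.ofReal_mul hη.le,
          show p₁ + η / 2 - (p₁ - η / 2) = η by ring]
        ring
    _ ≤ ∫⁻ z in Icc (p₁ - η / 2) (p₁ + η / 2), (κ ^ k) (z, a * (Φ x).2) A :=
        setLIntegral_mono' measurableSet_Icc hlow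
    _ ≤ _ := lintegral_mono_set hsub

/-- For positions `q` near `0` the terminal position, as a function of the initial momentum, covers
a fixed interval. -/
theorem IsHamiltonianFlow.exists_interval_subset_image (hΦ : IsHamiltonianFlow υ τ Φ)
    (hυ : 0 < υ) (hτ : 0 < τ) (ha : a ≠ 0) :
    ∃ P > 0, ∃ ε > 0, ∃ α β : ℝ, α < β ∧ ∀ q, |q| ≤ ε →
      Icc α β ⊆ (fun z => a * (Φ (z, q)).2) '' Icc 0 P := by
  obtain ⟨P, hP, hne⟩ := hΦ.exists_position_ne_zero hυ hτ
  have hcont := hΦ.continuous hυ.le hτ.le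
  set r := a * (Φ (P, 0)).2 with hr
  have hr0 : 0 < |r| / 3 := by have := abs_pos.2 (mul_ne_zero ha hne); positivity
  have hev : ∀ p : ℝ, ∃ ε > 0, ∀ q, |q| < ε →
      |a * (Φ (p, q)).2 - a * (Φ (p, 0)).2| < |r| / 3 := fun p => by
    have h : Continuous fun q => a * (Φ (p, q)).2 := by fun_prop
    obtain ⟨ε, hε, h⟩ := Metric.continuousAt_iff.1 (h.continuousAt (x := 0)) _ hr0
    exact ⟨ε, hε, fun q hq => by simpa [Real.dist_eq] using @h q (by simpa using hq)⟩
  obtain ⟨ε₁, hε₁, h₁⟩ := hev 0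
  obtain ⟨ε₂, hε₂, h₂⟩ := hev P
  have h0 : Φ (0, 0) = (0, 0) := hΦ.apply_zero hυ.le hτ.le
  rw [h0] at h₁
  simp only [mul_zero, sub_zero] at h₁
  rw [← hr] at h₂
  -- For `q = 0` the endpoints `z = 0` and `z = P` are sent to `0` and `r`. Moving `q` shifts each
  -- by less than `|r| / 3`, so the middle third remains covered by the intermediate value theorem.
  refine ⟨P, hP, min ε₁ ε₂ / 2, by positivity, min (r / 3) (2 * r / 3), max (r / 3) (2 * r / 3),
    ?_, fun q hq => ?_⟩
  · rw [min_lt_max]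
    intro h
    have : r = 0 := by linarith
    rw [this] at hr0; simp at hr0
  · have hmin : 0 < min ε₁ ε₂ := lt_min hε₁ hε₂
    have hq₁ := h₁ q (by linarith [min_le_left ε₁ ε₂])
    have hq₂ := h₂ q (by linarith [min_le_right ε₁ ε₂])
    have h : Continuous fun z => a * (Φ (z, q)).2 := by fun_prop
    have hIVT := intermediate_value_uIcc (h.continuousOn (s := uIcc 0 P))
    rw [uIcc_of_le hP.le] at hIVT
    refine Subset.trans ?_ hIVT
    refine fun y hy => ?_
    rw [abs_lt] at hq₁ hq₂
    rcases le_total 0 r with hr' | hr'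
    · rw [abs_of_nonneg hr'] at hq₁ hq₂
      rw [min_eq_left (by linarith), max_eq_right (by linarith)] at hy
      exact mem_uIcc.2 (Or.inl ⟨by linarith [hy.1], by linarith [hy.2]⟩)
    · rw [abs_of_nonpos hr'] at hq₁ hq₂
      rw [min_eq_right (by linarith), max_eq_left (by linarith)] at hy
      exact mem_uIcc.2 (Or.inr ⟨by linarith [hy.1], by linarith [hy.2]⟩)

theorem IsHamiltonianFlow.exists_bound_of_abs_le (hΦ : IsHamiltonianFlow υ τ Φ) (hυ : 0 ≤ υ)
    (hτ : 0 ≤ τ) (P ε : ℝ) :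
    (∃ B : ℝ, ∀ z ∈ Icc 0 P, ∀ q, |q| ≤ ε → |a * (Φ (z, q)).1| ≤ B) ∧
    ∃ M : ℝ≥0, 0 < M ∧ ∀ q, |q| ≤ ε →
      LipschitzOnWith M (fun z => a * (Φ (z, q)).2) (Icc 0 P) := by
  have hcont := hΦ.continuous hυ hτ
  have hK : IsCompact (Icc 0 P ×ˢ Icc (-ε) ε) := isCompact_Icc.prod isCompact_Icc
  constructor
  · have h : Continuous fun x => a * (Φ x).1 := by fun_prop
    obtain ⟨B, hB⟩ := hK.exists_bound_of_continuousOn h.continuousOn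
    exact ⟨B, fun z hz q hq => hB (z, q) ⟨hz, abs_le.1 hq⟩⟩
  · have h : Continuous fun x : ℝ × ℝ => langevinEnergy υ x.1 x.2 := by
      unfold langevinEnergy langevinH; fun_prop
    obtain ⟨E, hE⟩ := hK.exists_bound_of_continuousOn h.continuousOn
    have hE' : ∀ z ∈ Icc 0 P, ∀ q, |q| ≤ ε → langevinEnergy υ z q ≤ E := fun z hz q hq =>
      (le_abs_self _).trans (hE (z, q) ⟨hz, abs_le.1 hq⟩)
    refine ⟨(|a| * Real.exp (energyLipschitz υ E * τ) + 1).toNNReal,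
      Real.toNNReal_pos.2 (by positivity), fun q hq => LipschitzOnWith.of_dist_le_mul
        fun z hz z' hz' => ?_⟩
    rw [Real.coe_toNNReal _ (by positivity)]
    have h1 := hΦ.dist_le hυ hτ (x := (z, q)) (y := (z', q)) (hE' z hz q hq) (hE' z' hz' q hq)
    have h2 : dist (z, q) (z', q) = dist z z' := by simp [Prod.dist_eq]
    have h3 : dist (Φ (z, q)).2 (Φ (z', q)).2 ≤ dist (Φ (z, q)) (Φ (z', q)) := le_max_right _ _
    rw [h2] at h1
    rw [Real.dist_eq, ← mul_sub, abs_mul, ← Real.dist_eq]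
    calc _ ≤ |a| * (dist z z' * Real.exp (energyLipschitz υ E * τ)) :=
          mul_le_mul_of_nonneg_left (h3.trans h1) (abs_nonneg a)
      _ ≤ _ := by nlinarith [dist_nonneg (x := z) (y := z')]

/-- Two steps of the splitting chain spread mass over a rectangle, if the position after the first
step is close to `0`. -/
theorem IsHamiltonianFlow.exists_isMinorizedNear_sq (hΦ : IsHamiltonianFlow υ τ Φ)
    (hυ : 0 < υ) (hτ : 0 < τ) (ha : a ≠ 0) (hv : v ≠ 0) :
    ∃ ε > 0, ∃ α β : ℝ, α < β ∧ ∀ x₀, |a * (Φ x₀).2| < ε →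
      IsMinorizedNear ((splittingKernel a v Φ hΦm) ^ 2)
        ((volume.restrict (Icc 0 1)).prod (volume.restrict (Icc α β))) x₀ := by
  obtain ⟨P, hP, ε, hε, α, β, hαβ, himg⟩ := hΦ.exists_interval_subset_image hυ hτ ha
  obtain ⟨⟨B, hB⟩, M, hM, hLip⟩ := hΦ.exists_bound_of_abs_le (a := a) hυ.le hτ.le P ε
  have hcont := hΦ.continuous hυ.le hτ.le
  refine ⟨ε, hε, α, β, hαβ, fun x₀ hx₀ => ?_⟩
  set κ := splittingKernel a v Φ hΦm
  obtain ⟨m, hm, hge⟩ := exists_lintegral_splittingKernel_ge (a := a) (Φ := Φ) (hΦ := hΦm) hv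
    (max (|a * (Φ x₀).1| + 1) P)
  set R := max (|a * (Φ x₀).1| + 1) P
  obtain ⟨m', hm', hge'⟩ := exists_lintegral_splittingKernel_ge (a := a) (Φ := Φ) (hΦ := hΦm) hv
    (max B 1)
  set R' := max B 1
  refine ⟨m * (m' * (M : ℝ)⁻¹), by positivity, ?_⟩
  have hev : ∀ᶠ x in 𝓝 x₀, |a * (Φ x).2| < ε := by
    have h2 : Continuous fun x => |a * (Φ x).2| := by fun_prop
    exact h2.continuousAt.eventually (gt_mem_nhds hx₀)
  filter_upwards [eventually_abs_fst_le hcont a x₀, hev] with x hx1 hx2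
  refine Measure.le_iff.2 fun A hA => ?_
  have hpow : (κ ^ 2) x A = ∫⁻ y, κ y A ∂(κ x) := by
    rw [pow_two]
    exact Kernel.comp_apply' _ _ _ hA
  set q := a * (Φ x).2
  set f := fun z => a * (Φ (z, q)).2
  have hf : Measurable f := by
    have : Continuous f := by fun_prop
    exact this.measurable
  set g := fun y : ℝ => ∫⁻ z in Icc (0 : ℝ) 1, A.indicator 1 (z, y) with hg
  have hind : Measurable (A.indicator (1 : ℝ × ℝ → ℝ≥0∞)) := measurable_one.indicator hA
  have hgm : Measurable g := Measurable.lintegral_prod_left' hind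
  have hν : ((volume.restrict (Icc (0 : ℝ) 1)).prod (volume.restrict (Icc α β))) A
      = ∫⁻ y in Icc α β, g y := by
    rw [← lintegral_indicator_one hA, lintegral_prod_symm _ hind.aemeasurable]
  -- After the second step the position is `f z`, a function of the first momentum `z`, while fresh
  -- noise spreads the new momentum over `[0, 1]`.
  have hstep : ∀ z ∈ Icc 0 P, ENNReal.ofReal m' * g (f z) ≤ κ (z, q) A := fun z hz => by
    have h1 := hge' (z, q) ((hB z hz q hx2.le).trans (le_max_left _ _)) _ hind
    rw [lintegral_indicator_one hA] at h1
    refine le_trans (mul_le_mul' le_rfl (lintegral_mono_set (Icc_subset_Icc ?_ ?_))) h1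
    · have := le_max_right B 1
      linarith
    · exact le_max_right _ _
  have hcov := lintegral_le_of_lipschitzOnWith (hLip q hx2.le) hf (himg q hx2.le) hgm
  have hM' : ENNReal.ofReal ((M : ℝ)⁻¹) = (M : ℝ≥0∞)⁻¹ := by
    rw [ENNReal.ofReal_inv_of_pos (NNReal.coe_pos.2 hM), ENNReal.ofReal_coe_nnreal]
  have hcov' : ENNReal.ofReal ((M : ℝ)⁻¹) * ∫⁻ y in Icc α β, g y ≤ ∫⁻ z in Icc 0 P, g (f z) := by
    rw [hM']
    refine (mul_le_mul' le_rfl hcov).trans (le_of_eq ?_)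
    rw [← mul_assoc, ENNReal.inv_mul_cancel (by exact_mod_cast hM.ne') ENNReal.coe_ne_top, one_mul]
  rw [hpow, Measure.smul_apply, smul_eq_mul, hν, ENNReal.ofReal_mul hm.le, mul_assoc]
  refine le_trans (mul_le_mul' le_rfl ?_)
    (hge x (hx1.trans (le_max_left _ _)) _ (Kernel.measurable_coe _ hA))
  rw [ENNReal.ofReal_mul hm'.le, mul_assoc]
  calc _ ≤ ENNReal.ofReal m' * ∫⁻ z in Icc 0 P, g (f z) := mul_le_mul' le_rfl hcov'
    _ = ∫⁻ z in Icc 0 P, ENNReal.ofReal m' * g (f z) :=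
        (lintegral_const_mul _ (hgm.comp hf)).symm
    _ ≤ ∫⁻ z in Icc 0 P, κ (z, q) A := setLIntegral_mono' measurableSet_Icc hstep
    _ ≤ _ := lintegral_mono_set (Icc_subset_Icc (by
        have : P ≤ R := le_max_right _ _
        linarith) (le_max_right _ _))

/-- Each additional step steers the momentum to a value from which the flow does not push the
position outwards; damping then gains one factor `a`. -/
theorem IsHamiltonianFlow.isMinorizedNear_pow (hΦ : IsHamiltonianFlow υ τ Φ)
    (hυ : 0 < υ) (hτ : 0 < τ) (ha : 0 < a) (hv : v ≠ 0) {ε : ℝ} {ν : Measure (ℝ × ℝ)}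
    (h : ∀ x₀, |a * (Φ x₀).2| < ε →
      IsMinorizedNear ((splittingKernel a v Φ hΦm) ^ 2) ν x₀) (j : ℕ) :
    ∀ x₀, a ^ j * |a * (Φ x₀).2| < ε →
      IsMinorizedNear ((splittingKernel a v Φ hΦm) ^ (j + 2)) ν x₀ := by
  induction j with
  | zero => simpa using h
  | succ j ih =>
    intro x₀ hx₀
    obtain ⟨p₁, hp₁⟩ := hΦ.exists_abs_position_le hυ hτ (a * (Φ x₀).2)
    refine IsMinorizedNear.pow_succ_splittingKernel (hΦ.continuous hυ.le hτ.le) hv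
      (p₁ := p₁) (ih _ ?_)
    rw [abs_mul, abs_of_pos ha]
    refine lt_of_le_of_lt ?_ hx₀
    rw [pow_succ, mul_assoc]
    gcongr

/-- Sublevel sets of the energy are small sets of the splitting chain. -/
theorem IsHamiltonianFlow.exists_minorization (hΦ : IsHamiltonianFlow υ τ Φ)
    (hυ : 0 < υ) (hτ : 0 < τ) (ha : 0 < a) (ha1 : a < 1) (hv : v ≠ 0) (R : ℝ) :
    ∃ N, 0 < N ∧ ∃ c : ℝ, 0 < c ∧ c ≤ 1 ∧ ∃ ν : Measure (ℝ × ℝ), IsProbabilityMeasure ν ∧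
      ∀ x, langevinEnergy υ x.1 x.2 ≤ R →
        ENNReal.ofReal c • ν ≤ ((splittingKernel a v Φ hΦm) ^ N) x := by
  obtain ⟨ε, hε, α, β, hαβ, hmin⟩ := hΦ.exists_isMinorizedNear_sq (hΦm := hΦm) hυ hτ ha.ne' hv
  set ν₀ : Measure (ℝ × ℝ) := (volume.restrict (Icc 0 1)).prod (volume.restrict (Icc α β))
  have hν₀ : ν₀ univ = ENNReal.ofReal (β - α) := by
    rw [← univ_prod_univ, Measure.prod_prod]
    simp
  have hV : Continuous fun x : ℝ × ℝ => langevinEnergy υ x.1 x.2 := by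
    unfold langevinEnergy langevinH; fun_prop
  have hK : IsCompact {x : ℝ × ℝ | langevinEnergy υ x.1 x.2 ≤ R} := by
    refine Metric.isCompact_of_isClosed_isBounded (isClosed_le hV continuous_const) ?_
    refine (Metric.isBounded_closedBall (x := (0 : ℝ × ℝ)) (r := 2 * (1 + R))).subset fun x hx => ?_
    have h := abs_le_of_langevinEnergy_le hx
    rw [mem_closedBall_zero_iff, Prod.norm_def]
    exact max_le h.1 h.2
  -- The energy bounds the positions on the whole sublevel set, so one number of steps serves all
  -- its points.
  obtain ⟨j, hj⟩ : ∃ j : ℕ, a ^ j * (2 * (1 + |R|)) < ε := by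
    have h1 : 0 < 2 * (1 + |R|) := by positivity
    obtain ⟨j, hj⟩ := exists_pow_lt_of_lt_one (div_pos hε h1) ha1
    exact ⟨j, (lt_div_iff₀ h1).1 hj⟩
  obtain ⟨c, hc, hle⟩ := exists_forall_le_of_isMinorizedNear hK
    (κ := (splittingKernel a v Φ hΦm) ^ (j + 2)) (ν := ν₀) fun x hx => by
      refine hΦ.isMinorizedNear_pow hυ hτ ha hv hmin j x (lt_of_le_of_lt ?_ hj)
      have h1 : langevinEnergy υ (Φ x).1 (Φ x).2 ≤ R := (hΦ.langevinEnergy_eq hτ.le x).trans_le hx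
      have h2 := (abs_le_of_langevinEnergy_le h1).2
      rw [abs_mul, abs_of_pos ha]
      refine mul_le_mul_of_nonneg_left ?_ (by positivity)
      refine (mul_le_of_le_one_left (abs_nonneg _) ha1.le).trans (h2.trans ?_)
      linarith [le_abs_self R]
  have hβα : 0 < β - α := sub_pos.2 hαβ
  have hne : ν₀ univ ≠ 0 := by rw [hν₀]; simpa using hαβ
  have hnt : ν₀ univ ≠ ∞ := by rw [hν₀]; exact ENNReal.ofReal_ne_top
  refine ⟨j + 2, by omega, min 1 (c * (β - α)), by positivity, min_le_left _ _,
    (ν₀ univ)⁻¹ • ν₀, ⟨?_⟩, fun x hx => ?_⟩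
  · rw [Measure.smul_apply, smul_eq_mul, ENNReal.inv_mul_cancel hne hnt]
  · refine le_trans ?_ (hle x hx)
    refine Measure.le_iff.2 fun A _ => ?_
    simp only [Measure.smul_apply, smul_eq_mul]
    rw [← mul_assoc]
    refine mul_le_mul' ?_ le_rfl
    calc _ ≤ ENNReal.ofReal (c * (β - α)) * (ν₀ univ)⁻¹ :=
          mul_le_mul' (ENNReal.ofReal_le_ofReal (min_le_right _ _)) le_rfl
      _ = ENNReal.ofReal c := by
          rw [ENNReal.ofReal_mul hc.le, ← hν₀, mul_assoc, ENNReal.mul_inv_cancel hne hnt, mul_one]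

/-- The splitting chain has a unique invariant probability measure, and it is mixing. -/
theorem IsHamiltonianFlow.exists_unique_invariant (hΦ : IsHamiltonianFlow υ τ Φ)
    (hυ : 0 < υ) (hτ : 0 < τ) (ha : 0 < a) (ha1 : a < 1) (hv : v ≠ 0) :
    ∃ π : Measure (ℝ × ℝ), IsProbabilityMeasure π ∧ (splittingKernel a v Φ hΦm).Invariant π ∧
      (∀ π' : Measure (ℝ × ℝ), IsProbabilityMeasure π' →
        (splittingKernel a v Φ hΦm).Invariant π' → π' = π) ∧
      ∀ φ : ℝ × ℝ → ℝ, Measurable φ → (∀ x, |φ x| ≤ 1) → ∀ x,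
        Tendsto (fun n => ∫ y, φ y ∂(((splittingKernel a v Φ hΦm) ^ n) x)) atTop
          (𝓝 (∫ y, φ y ∂π)) := by
  have ha2 : a ^ 2 < 1 := by nlinarith
  refine exists_unique_invariant_of_drift_of_minorization
    (V := fun x => langevinEnergy υ x.1 x.2) (measurable_langevinEnergy υ)
    (fun x => langevinEnergy_nonneg υ _ _) (γ := a ^ 2)
    (K := υ ^ 4 / 8 * (1 - a ^ 2) + v / 2) (by positivity) ha2 ?_
    (lintegral_langevinEnergy_splittingKernel_le hΦ hτ.le ha.le ha1.le)
    (hΦ.exists_minorization hυ hτ ha ha1 hv)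
  have : 0 ≤ 1 - a ^ 2 := by linarith
  positivity

end Minorization

/-! ### Unique ergodicity -/

theorem convolutionVar_ne_zero {υ σ T : ℝ} (hυ : 0 < υ) (hσ : 0 < σ) (hT : 0 < T) :
    convolutionVar υ σ T ≠ 0 := by
  refine (Real.toNNReal_pos.2 ?_).ne'
  have : Real.exp (-υ * T) < 1 := Real.exp_lt_one_iff.2 (by nlinarith)
  have : 0 < 1 - Real.exp (-υ * T) := by linarith
  positivity

section Chain

variable {Ω : Type u} {mΩ : MeasurableSpace Ω} {υ σ τ : ℝ} {μ : Measure Ω}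
  {𝓕 : Filtration ℝ≥0 mΩ} {W : ℝ≥0 → Ω → ℝ} {P₀ Q₀ : ℝ} {X : SplittingProcess Ω}
  {Φ : ℝ × ℝ → ℝ × ℝ} {hΦm : Measurable Φ}

namespace IsSplittingSolution

theorem measurable_grid (h : IsSplittingSolution υ σ τ μ 𝓕 W P₀ Q₀ X) (n : ℕ) :
    Measurable[𝓕 (gridTime τ n).toNNReal] (X.grid n) :=
  Measurable.prodMk (h.adapted_P n) (h.adapted_Q n)

theorem flow_grid (h : IsSplittingSolution υ σ τ μ 𝓕 W P₀ Q₀ X) (hΦ : IsHamiltonianFlow υ τ Φ)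
    (hυ : 0 ≤ υ) (hτ : 0 ≤ τ) (n : ℕ) :
    ∀ᵐ ω ∂μ, Φ (X.grid n ω)
      = (X.barP n (gridTime τ (n + 1)) ω, X.barQ n (gridTime τ (n + 1)) ω) := by
  filter_upwards [h.path] with ω hω
  have h1 := hω.isHamiltonianPath n
  rw [gridTime_succ] at h1
  have h2 := hΦ.apply_eq hυ hτ h1.shift
  simp only [add_zero] at h2
  rw [hω.barP_start, hω.barQ_start] at h2
  rw [gridTime_succ]
  exact h2

end IsSplittingSolution

variable [IsProbabilityMeasure μ]

/-- If the splitting system is solvable for every initial value, then its Hamiltonian part defines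
a flow map. -/
theorem exists_isHamiltonianFlow {Y : ℝ × ℝ → SplittingProcess Ω}
    (hY : ∀ x, IsSplittingSolution υ σ τ μ 𝓕 W x.1 x.2 (Y x)) :
    ∃ Φ, IsHamiltonianFlow υ τ Φ := by
  have h : ∀ x : ℝ × ℝ, ∃ y : ℝ × ℝ, ∃ p q : ℝ → ℝ, IsHamiltonianPath υ 0 τ p q ∧ p 0 = x.1 ∧
      q 0 = x.2 ∧ y = (p τ, q τ) := fun x => by
    -- On the first interval the Hamiltonian part starts from the deterministic value `x`, so a
    -- single good path provides the flow through `x`.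
    obtain ⟨ω, hω⟩ := (hY x).path.exists
    have h0 : gridTime τ 0 = 0 := by simp [gridTime]
    have h1 : gridTime τ 1 = τ := by simp [gridTime]
    have h2 := hω.isHamiltonianPath 0
    have h3 := hω.barP_start 0
    have h4 := hω.barQ_start 0
    simp only [zero_add] at h2
    rw [h0, h1] at h2
    rw [h0, hω.initP] at h3
    rw [h0, hω.initQ] at h4
    exact ⟨_, _, _, h2, h3, h4, rfl⟩
  choose Φ hΦ using h
  exact ⟨Φ, hΦ⟩

namespace IsSplittingSolution

/-- The restriction to an event `A` of the past gives the conditional law needed for the Markov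
property; with `A = univ` it gives the `n`-step laws by induction. -/
theorem setLIntegral_grid_succ (h : IsSplittingSolution υ σ τ μ 𝓕 W P₀ Q₀ X)
    (hW : IsWienerProcess μ 𝓕 W) (hΦ : IsHamiltonianFlow υ τ Φ) (hυ : 0 < υ) (hτ : 0 ≤ τ) (n : ℕ)
    {f : ℝ × ℝ → ℝ≥0∞} (hf : Measurable f) {A : Set Ω}
    (hA : MeasurableSet[𝓕 (gridTime τ n).toNNReal] A) :
    ∫⁻ ω in A, f (X.grid (n + 1) ω) ∂μ
      = ∫⁻ ω in A, ∫⁻ y, f y ∂(splittingKernel (Real.exp (-(υ / 2) * τ)) (convolutionVar υ σ τ)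
          Φ hΦm (X.grid n ω)) ∂μ := by
  have h1 := h.lintegral_tilde hW hυ hτ n (t := gridTime τ (n + 1))
    ⟨gridTime_le_succ hτ n, le_rfl⟩ hf hA
  rw [show gridTime τ (n + 1) - gridTime τ n = τ by rw [gridTime_succ]; ring] at h1
  rw [lintegral_congr_ae (g := fun ω => f (X.tildeP n (gridTime τ (n + 1)) ω,
    X.tildeQ n (gridTime τ (n + 1)) ω)) ?_, h1]
  · refine lintegral_congr_ae (ae_restrict_of_ae ?_)
    filter_upwards [h.flow_grid hΦ hυ.le hτ n] with ω hω
    rw [lintegral_splittingKernel _ hf, hω]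
  · refine ae_restrict_of_ae ?_
    filter_upwards [h.path] with ω hω
    rw [SplittingProcess.grid, hω.stepP, hω.stepQ]

theorem isMarkovChainFrom_grid (h : IsSplittingSolution υ σ τ μ 𝓕 W P₀ Q₀ X)
    (hW : IsWienerProcess μ 𝓕 W) (hΦ : IsHamiltonianFlow υ τ Φ) (hυ : 0 < υ) (hτ : 0 ≤ τ) :
    IsMarkovChainFrom μ (fun n => 𝓕 (gridTime τ n).toNNReal)
      (splittingKernel (Real.exp (-(υ / 2) * τ)) (convolutionVar υ σ τ) Φ hΦm) (P₀, Q₀) X.grid where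
  init := by
    filter_upwards [h.path] with ω hω
    rw [SplittingProcess.grid, hω.initP, hω.initQ]
  adapted := h.measurable_grid
  markov n A hA := by
    set κ := splittingKernel (Real.exp (-(υ / 2) * τ)) (convolutionVar υ σ τ) Φ hΦm
    have hle : 𝓕 (gridTime τ n).toNNReal ≤ mΩ := 𝓕.le _
    have hXm : Measurable (X.grid n) := (h.measurable_grid n).mono hle le_rfl
    have hXm' : Measurable (X.grid (n + 1)) := (h.measurable_grid (n + 1)).mono (𝓕.le _) le_rfl
    have hκm : Measurable fun y => (κ y).real A := (Kernel.measurable_coe κ hA).ennreal_toReal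
    have hint : Integrable (fun ω => (κ (X.grid n ω)).real A) μ :=
      Integrable.of_bound (hκm.comp hXm).aestronglyMeasurable 1 (ae_of_all _ fun ω => by
        rw [Real.norm_of_nonneg measureReal_nonneg]; exact measureReal_le_one)
    refine (ae_eq_condExp_of_forall_setIntegral_eq hle
      ((integrable_const (1 : ℝ)).indicator (hXm' hA)) (fun s _ _ => hint.integrableOn)
      (fun s hs _ => ?_) ?_).symm
    · have h1 := h.setLIntegral_grid_succ (hΦm := hΦm) hW hΦ hυ hτ n
        (measurable_one.indicator hA) hs
      rw [integral_indicator_const _ (hXm' hA), smul_eq_mul, mul_one,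
        integral_eq_lintegral_of_nonneg_ae (ae_of_all _ fun ω => measureReal_nonneg)
          (hκm.comp hXm).aestronglyMeasurable, measureReal_def]
      congr 1
      simp_rw [lintegral_indicator_one hA] at h1
      rw [← lintegral_indicator_one (hXm' hA)]
      refine Eq.trans ?_ (h1.symm.trans ?_)
      · exact lintegral_congr fun ω => ENNReal.ofReal_toReal (measure_ne_top _ _)
      · rfl
    · exact (hκm.comp (h.measurable_grid n)).stronglyMeasurable.aestronglyMeasurable

theorem map_grid (h : IsSplittingSolution υ σ τ μ 𝓕 W P₀ Q₀ X)
    (hW : IsWienerProcess μ 𝓕 W) (hΦ : IsHamiltonianFlow υ τ Φ) (hυ : 0 < υ) (hτ : 0 ≤ τ) (n : ℕ) :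
    μ.map (X.grid n) = ((splittingKernel (Real.exp (-(υ / 2) * τ)) (convolutionVar υ σ τ) Φ hΦm)
      ^ n : Kernel (ℝ × ℝ) (ℝ × ℝ)) (P₀, Q₀) := by
  have hXm : ∀ n, Measurable (X.grid n) := fun n => (h.measurable_grid n).mono (𝓕.le _) le_rfl
  set κ := splittingKernel (Real.exp (-(υ / 2) * τ)) (convolutionVar υ σ τ) Φ hΦm
  induction n with
  | zero =>
    have h1 : X.grid 0 =ᵐ[μ] fun _ => (P₀, Q₀) := by
      filter_upwards [h.path] with ω hω
      rw [SplittingProcess.grid, hω.initP, hω.initQ]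
    rw [Measure.map_congr h1, Measure.map_const, measure_univ, one_smul, pow_zero]
    exact (Kernel.id_apply _).symm
  | succ n ih =>
    refine Measure.ext fun A hA => ?_
    have h1 := h.setLIntegral_grid_succ (hΦm := hΦm) hW hΦ hυ hτ n
      (measurable_one.indicator hA) MeasurableSet.univ
    simp_rw [Measure.restrict_univ, lintegral_indicator_one hA] at h1
    rw [← lintegral_indicator_one hA, ← lintegral_indicator_one hA,
      lintegral_map (measurable_one.indicator hA) (hXm _),
      lintegral_pow_succ κ (measurable_one.indicator hA), h1, ← ih]
    simp_rw [lintegral_indicator_one hA]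
    rw [lintegral_map (Kernel.measurable_coe _ hA) (hXm n)]

end IsSplittingSolution

theorem isUniquelyErgodic_splitting (hυ : 0 < υ) (hσ : 0 < σ) (hτ : 0 < τ)
    (hW : IsWienerProcess μ 𝓕 W) {Y : ℝ × ℝ → SplittingProcess Ω}
    (hY : ∀ x, IsSplittingSolution υ σ τ μ 𝓕 W x.1 x.2 (Y x)) :
    IsUniquelyErgodic μ (fun n => 𝓕 (gridTime τ n).toNNReal) (fun x => (Y x).grid) := by
  obtain ⟨Φ, hΦ⟩ := exists_isHamiltonianFlow hY
  have hΦm : Measurable Φ := (hΦ.continuous hυ.le hτ.le).measurable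
  set κ := splittingKernel (Real.exp (-(υ / 2) * τ)) (convolutionVar υ σ τ) Φ hΦm
  obtain ⟨π, hπ, hinv, huniq, hmix⟩ := hΦ.exists_unique_invariant (hΦm := hΦm) hυ hτ
    (Real.exp_pos (-(υ / 2) * τ)) (Real.exp_lt_one_iff.2 (by nlinarith))
    (convolutionVar_ne_zero hυ hσ hτ)
  refine ⟨κ, inferInstance, fun x => (hY x).isMarkovChainFrom_grid hW hΦ hυ hτ.le, π, hπ, hinv,
    huniq, fun g hg => ?_⟩
  refine (tendsto_eLpNorm_average_sub_of_mixing hinv hmix hg).congr fun N => eLpNorm_congr_ae ?_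
  -- The expectation of `g` at the `n`-th grid point is an integral against `κ ^ n` only where `g`
  -- is measurable for that law, which is guaranteed for `π`-almost every initial value.
  have h1 : ∀ᵐ x ∂π, ∀ n, AEStronglyMeasurable g ((κ ^ n : Kernel (ℝ × ℝ) (ℝ × ℝ)) x) :=
    ae_all_iff.2 fun n => ae_aestronglyMeasurable_of_invariant (invariant_pow hinv n) hg.1
  filter_upwards [h1] with x hx
  congr 2
  refine Finset.sum_congr rfl fun n _ => ?_
  have h2 := (hY x).map_grid (hΦm := hΦm) hW hΦ hυ hτ.le n
  have h3 := hx n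
  have h4 : ((κ ^ n : Kernel (ℝ × ℝ) (ℝ × ℝ)) x) = μ.map ((Y x).grid n) := h2.symm
  rw [h4] at h3 ⊢
  exact integral_map (((hY x).measurable_grid n).mono (𝓕.le _) le_rfl).aemeasurable h3

end Chain

theorem proposition2p4 (υ σ : ℝ) (hυ : 0 < υ) (hσ : 0 < σ) :
    -- moments of all orders, bounded uniformly in time
    (∀ p : ℝ, 1 ≤ p → ∃ C : ℝ, 0 < C ∧
      ∀ τ ∈ Ioo (0 : ℝ) 1,
      ∀ {Ω : Type u} {mΩ : MeasurableSpace Ω} (μ : Measure Ω) [IsProbabilityMeasure μ]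
        (𝓕 : Filtration ℝ≥0 mΩ) (W : ℝ≥0 → Ω → ℝ), IsWienerProcess μ 𝓕 W →
      ∀ (P₀ Q₀ : ℝ) (X : SplittingProcess Ω), IsSplittingSolution υ σ τ μ 𝓕 W P₀ Q₀ X →
      ∀ n : ℕ, ∀ t ∈ Ico (gridTime τ n) (gridTime τ (n + 1)),
        Integrable (fun ω => |X.barP n t ω| ^ (2 * p) + |X.barQ n t ω| ^ (4 * p)
          + |X.tildeP n t ω| ^ (2 * p) + |X.tildeQ n t ω| ^ (4 * p)) μ ∧
        ∫ ω, (|X.barP n t ω| ^ (2 * p) + |X.barQ n t ω| ^ (4 * p)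
          + |X.tildeP n t ω| ^ (2 * p) + |X.tildeQ n t ω| ^ (4 * p)) ∂μ
          ≤ C * (1 + |langevinH υ P₀ Q₀| ^ p)) ∧
    -- unique ergodicity of the chain of grid values
    (∀ τ ∈ Ioo (0 : ℝ) 1,
      ∀ {Ω : Type u} {mΩ : MeasurableSpace Ω} (μ : Measure Ω) [IsProbabilityMeasure μ]
        (𝓕 : Filtration ℝ≥0 mΩ) (W : ℝ≥0 → Ω → ℝ), IsWienerProcess μ 𝓕 W →
      ∀ X : ℝ × ℝ → SplittingProcess Ω,
        (∀ x, IsSplittingSolution υ σ τ μ 𝓕 W x.1 x.2 (X x)) →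
        IsUniquelyErgodic μ (fun n => 𝓕 (gridTime τ n).toNNReal) (fun x => (X x).grid)) ∧
    -- exponential integrability
    (∃ C : ℝ, 0 < C ∧
      ∀ τ ∈ Ioo (0 : ℝ) 1,
      ∀ {Ω : Type u} {mΩ : MeasurableSpace Ω} (μ : Measure Ω) [IsProbabilityMeasure μ]
        (𝓕 : Filtration ℝ≥0 mΩ) (W : ℝ≥0 → Ω → ℝ), IsWienerProcess μ 𝓕 W →
      ∀ (P₀ Q₀ : ℝ) (X : SplittingProcess Ω), IsSplittingSolution υ σ τ μ 𝓕 W P₀ Q₀ X →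
      ∀ n : ℕ,
        Integrable (fun ω => Real.exp
          (langevinH υ (X.P n ω) (X.Q n ω) / Real.exp (σ ^ 2 * gridTime τ n))) μ ∧
        ∫ ω, Real.exp
          (langevinH υ (X.P n ω) (X.Q n ω) / Real.exp (σ ^ 2 * gridTime τ n)) ∂μ
          ≤ Real.exp (langevinH υ P₀ Q₀ + C * gridTime τ n)) :=
  ⟨IsSplittingSolution.moments_le hυ hσ,
    fun _ hτ _ _ _ _ _ _ hW _ hY => isUniquelyErgodic_splitting hυ hσ hτ.1 hW hY,
    IsSplittingSolution.exp_langevinH_le hυ hσ⟩
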